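/- **Conventions.** Let $M$ be a smooth (Hausdorff, $\sigma$-compact, finite-dimensional) manifold and $(A,[\cdot,\cdot],\rho)$ a Lie algebroid over $M$ (a smooth vector bundle of finite rank) with differential $\mathrm d$ on $\Gamma(\wedge^\bullet A^*)$. Contraction inserts in the first argument, and $i_{X\wedge Y}=i_X\circ i_Y$, so $i_{X\wedge Y}\varphi=\varphi(Y,X,-)$ for a $3$-form $\varphi$. The Schouten bracket of a Lie algebroid is the unique $\mathbb R$-bilinear bracket of degree $-1$ on its multisections that extends the bracket of sections, with $[X,f]=\rho(X)f$, $[P,Q]=-(-1)^{(p-1)(q-1)}[Q,P]$ and $[P,Q\wedge R]=[P,Q]\wedge R+(-1)^{(p-1)q}Q\wedge[P,R]$, where $p,q$ are the degrees of $P,Q$. A *Jacobi algebroid* $(A,\phi)$ is a Lie algebroid $A$ with $\phi\in\Gamma(A^*)$, $\mathrm d\phi=0$. Put $\mathrm d^\phi\omega=\mathrm d\omega+\phi\wedge\omega$, $\mathcal L^\phi_X=\mathrm d^\phi i_X+i_X\mathrm d^\phi$ and $$[P,Q]^\phi=[P,Q]+(p-1)P\wedge i_\phi Q-(-1)^{p-1}(q-1)\,i_\phi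 P\wedge Q ,\qquad p,q\ge 0 .$$ **Quasi-Jacobi bialgebroids.** Let $(B,\psi)$ be a Jacobi algebroid and $V\in\Gamma(B)$. A *$V$-quasi differential* is an $\mathbb R$-linear operator $D$ of degree $1$ on $\Gamma(\wedge^\bullet B)$ such that, for all homogeneous $P,Q$ (with $p=\deg P$), $$D(P\wedge Q)=DP\wedge Q+(-1)^pP\wedge DQ-V\wedge P\wedge Q,\qquad D[P,Q]^\psi=[DP,Q]^\psi+(-1)^{p+1}[P,DQ]^\psi .$$ $(B,\psi,D,\Xi)$, with $\Xi\in\Gamma(\wedge^3B)$, is a *quasi-Jacobi bialgebroid* if $D$ is a $V$-quasi differential for some $V$, $D\Xi=0$ and $D^2=[\Xi,-]^\psi$. **Jacobi quasi-Nijenhuis algebroids.** Let $(A,\phi)$ be a Jacobi algebroid, $\pi\in\Gamma(\wedge^2A)$ with $[\pi,\pi]^\phi=0$, and $\pi^\sharp:A^*\to A$, $\langle\beta,\pi^\sharp\alpha\rangle=\pi(\alpha,\beta)$. For $\alpha,\beta\in\Gamma(A^*)$ put $$[\alpha,\beta]_\pi=\mathcal L^\phi_{\pi^\sharp\alpha}\beta-\mathcal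 L^\phi_{\pi^\sharp\beta}\alpha-\mathrm d^\phi(\pi(\alpha,\beta)),$$ and let $A^*_\pi$ be $A^*$ with this bracket and the anchor $\rho\circ\pi^\sharp$. For a vector bundle map $N:A\to A$ over the identity put $[X,Y]_N=[NX,Y]+[X,NY]-N[X,Y]$ and $\mathcal T_N(X,Y)=[NX,NY]-N[X,Y]_N$, and let $\mathrm d_N$ be the operator on $\Gamma(\wedge^\bullet A^*)$ given by the Lie algebroid differential (Koszul) formula with the bracket $[\cdot,\cdot]_N$ and the anchor $\rho\circ N$; put $\mathrm d_N^{\theta}\omega=\mathrm d_N\omega+\theta\wedge\omega$ for $\theta\in\Gamma(A^*)$. $(A,\phi,\pi,N,\varphi)$ with $\varphi\in\Gamma(\wedge^3A^*)$ is a *Jacobi quasi-Nijenhuis algebroid* if - $N\pi^\sharp=\pi^\sharp N^*$ and $[\alpha,\beta]_{N\pi}=[N^*\alpha,\beta]_\pi+[\alpha,N^*\beta]_\pi-N^*[\alpha,\beta]_\pi$ for all $\alpha,\beta\in\Gamma(A^*)$, where $(N\pi)^\sharp=N\pi^\sharp$; - $\mathrm d^\phi\varphi=0$, $\ \mathcal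 T_N(X,Y)=-\pi^\sharp(i_{X\wedge Y}\varphi)$ for all $X,Y\in\Gamma(A)$, and $\mathrm d^\phi(i_N\varphi)=0$, where $i_N\varphi(X,Y,Z)=\varphi(NX,Y,Z)+\varphi(X,NY,Z)+\varphi(X,Y,NZ)$. **Theorem.** If $(A,\phi,\pi,N,\varphi)$ is a Jacobi quasi-Nijenhuis algebroid, then, with $W=-\pi^\sharp(\phi)\in\Gamma(A)=\Gamma((A^*)^*)$, the pair $(A^*_\pi,W)$ is a Jacobi algebroid and $(A^*_\pi,W,\mathrm d_N^{N^*\phi},\varphi)$ is a quasi-Jacobi bialgebroid; here $\mathrm d_N^{N^*\phi}$ is an $N^*\phi$-quasi differential. -/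

import Mathlib

open scoped Manifold ContDiff DirectSum

/-!
Sections are handled through the algebra `R = C^∞(M)` and the `R`-module `S = Γ(B)` of smooth
sections of a vector bundle `B → M` of finite rank.  By the tensoriality (localization) lemma:
* `Γ(B*)` is the module of `R`-linear maps `Γ(B) → R`;
* `Γ(⋀^p B)` is the module of alternating `R`-multilinear maps on `p` sections of `B*`, and
  `Γ(⋀^p B*)` that of alternating `R`-multilinear maps on `p` sections of `B`;
* vector bundle maps over the identity are `R`-linear maps between modules of sections;
* vector fields on `M` are derivations of `R`.
-/

noncomputable section

set_option linter.unusedSectionVars false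

namespace Algebroid

section Multisections

variable (R T : Type*) [CommRing R] [AddCommGroup T] [Module R T]

/-- Alternating `R`-multilinear maps in `p` arguments from `T`.  If `T = Γ(B*)` these are the
`p`-sections of `B`; if `T = Γ(B)` these are the `p`-forms on `B`. -/
abbrev Alt (p : ℕ) : Type _ := T [⋀^Fin p]→ₗ[R] R

/-- The graded module of all multisections. -/
abbrev Multi : Type _ := ⨁ p : ℕ, Alt R T p

variable {R T}

/-- The homogeneous multisection `P` of degree `p`. -/
abbrev hom (p : ℕ) (P : Alt R T p) : Multi R T := DirectSum.of (Alt R T) p P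

/-- A function as a multisection of degree `0`. -/
def fn (f : R) : Multi R T := hom 0 (AlternatingMap.constOfIsEmpty R T (Fin 0) f)

/-- An `R`-linear map `T → R` as a multisection of degree `1`. -/
def one (a : Module.Dual R T) : Multi R T :=
  hom 1 (AlternatingMap.ofSubsingleton R T R (0 : Fin 1) a)

/-- The wedge product of homogeneous multisections, a sum over shuffles:
`(α ∧ β)(x, y) = α x * β y - α y * β x` in degrees `1` and `1`. -/
def altWedge (p q : ℕ) : Alt R T p →ₗ[R] Alt R T q →ₗ[R] Alt R T (p + q) :=
  (TensorProduct.mk R (Alt R T p) (Alt R T q)).compr₂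
    ((AlternatingMap.domDomCongrₗ R finSumFinEquiv).toLinearMap ∘ₗ
      LinearMap.compAlternatingMapₗ R (LinearMap.mul' R R) ∘ₗ AlternatingMap.domCoprod')

/-- The wedge product on the graded module of multisections. -/
def wedge : Multi R T →ₗ[R] Multi R T →ₗ[R] Multi R T :=
  DirectSum.toModule R ℕ _ fun p =>
    LinearMap.flip (DirectSum.toModule R ℕ _ fun q =>
      LinearMap.flip ((altWedge p q).compr₂ (DirectSum.lof R ℕ (Alt R T) (p + q))))

/-- Contraction `i_t` of multisections with `t : T`, inserting `t` in the first argument. -/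
def contract (t : T) : Multi R T →ₗ[R] Multi R T :=
  DirectSum.toModule R ℕ _ fun p =>
    match p with
    | 0 => 0
    | p + 1 => DirectSum.lof R ℕ (Alt R T) p ∘ₗ
        (LinearMap.applyₗ t) ∘ₗ AlternatingMap.curryLeftLinearMap

end Multisections

variable {R S T : Type*} [CommRing R] [Algebra ℝ R]
  [AddCommGroup S] [Module R S] [Module ℝ S] [IsScalarTower ℝ R S]
  [AddCommGroup T] [Module R T]

variable (R S) in
/-- An anchor and a skew-symmetric bracket satisfying the Leibniz rule on the module `S` of
sections of a vector bundle.  It is a Lie algebroid if moreover `IsLie` holds. -/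
structure SkewAlgebroid where
  /-- the anchor -/
  anchor : S →ₗ[R] Derivation ℝ R R
  /-- the bracket of sections -/
  bracket : S →ₗ[ℝ] S →ₗ[ℝ] S
  bracket_self : ∀ X, bracket X X = 0
  leibniz : ∀ (X : S) (f : R) (Y : S), bracket X (f • Y) = f • bracket X Y + anchor X f • Y

instance (p : ℕ) : IsScalarTower ℝ R (Alt R T p) where
  smul_assoc c f P := by
    ext v
    simp only [AlternatingMap.smul_apply, smul_assoc]

instance : IsScalarTower ℝ R (Multi R T) where
  smul_assoc c f P := by
    refine DFinsupp.ext fun p => ?_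
    exact smul_assoc c f (P p)

namespace SkewAlgebroid

/-- Lie algebroids: the bracket satisfies the Jacobi identity and the anchor is a morphism of
Lie algebras into vector fields. -/
structure IsLie (A : SkewAlgebroid R S) : Prop where
  jacobi : ∀ X Y Z, A.bracket X (A.bracket Y Z) =
    A.bracket (A.bracket X Y) Z + A.bracket Y (A.bracket X Z)
  anchor_bracket : ∀ X Y, A.anchor (A.bracket X Y) = ⁅A.anchor X, A.anchor Y⁆

theorem bracket_swap (A : SkewAlgebroid R S) (X Y : S) : A.bracket X Y = -A.bracket Y X := by
  have h := A.bracket_self (X + Y)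
  simp only [map_add, LinearMap.add_apply, A.bracket_self, zero_add, add_zero] at h
  exact eq_neg_of_add_eq_zero_right h

theorem leibniz_left (A : SkewAlgebroid R S) (f : R) (X Y : S) :
    A.bracket (f • X) Y = f • A.bracket X Y - A.anchor Y f • X := by
  rw [A.bracket_swap, A.leibniz, A.bracket_swap Y X, smul_neg]
  abel

/-! ### The differential on forms -/

/-- A form regarded as an `ℝ`-multilinear map. -/
def realForm {k : ℕ} (η : Alt R S k) : S [⋀^Fin k]→ₗ[ℝ] R where
  __ := η.toMultilinearMap.restrictScalars ℝ
  map_eq_zero_of_eq' v _ _ h hij := η.map_eq_zero_of_eq v h hij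

@[simp]
theorem realForm_apply {k : ℕ} (η : Alt R S k) (v : Fin k → S) : realForm η v = η v := rfl

/-- `X ↦ ρ(X) ∘ η`. -/
def anchorComp (A : SkewAlgebroid R S) {k : ℕ} (η : Alt R S k) :
    S →ₗ[ℝ] S [⋀^Fin k]→ₗ[ℝ] R where
  toFun X := (A.anchor X : R →ₗ[ℝ] R).compAlternatingMap (realForm η)
  map_add' X Y := by ext v; simp
  map_smul' c X := by
    ext v
    rw [← algebraMap_smul R c X]
    simp [Algebra.smul_def]

/-- `(X, Y) ↦ i_{[X, Y]} η`. -/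
def bracketComp (A : SkewAlgebroid R S) {k : ℕ} (η : Alt R S (k + 1)) :
    S →ₗ[ℝ] S →ₗ[ℝ] S [⋀^Fin k]→ₗ[ℝ] R :=
  A.bracket.compr₂ (realForm η).curryLeft

/-- The terms of the differential of a form that contain the bracket,
`∑_{i < j} (-1)^{i + j} η([X_i, X_j], X_0, …, X̂_i, …, X̂_j, …, X_k)`. -/
def bracketTerm (A : SkewAlgebroid R S) : (k : ℕ) → Alt R S k → S [⋀^Fin (k + 1)]→ₗ[ℝ] R
  | 0, _ => 0
  | _ + 1, η => -(1 / 2 : ℝ) • AlternatingMap.alternatizeUncurryFin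
      (AlternatingMap.alternatizeUncurryFinLM ∘ₗ A.bracketComp η)

/-- The differential, as an `ℝ`-multilinear map. -/
def realDiff (A : SkewAlgebroid R S) {k : ℕ} (η : Alt R S k) : S [⋀^Fin (k + 1)]→ₗ[ℝ] R :=
  AlternatingMap.alternatizeUncurryFin (A.anchorComp η) + A.bracketTerm k η

theorem realDiff_cons_smul (A : SkewAlgebroid R S) {k : ℕ} (η : Alt R S k) (c : R) (x : S)
    (w : Fin k → S) :
    A.realDiff η (Matrix.vecCons (c • x) w) = c * A.realDiff η (Matrix.vecCons x w) := by
  have hrem : ∀ (m : ℕ) (y : S) (v : Fin (m + 1) → S) (a : Fin (m + 1)),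
      Fin.removeNth a.succ (Matrix.vecCons y v : Fin (m + 2) → S) =
        Matrix.vecCons y (Fin.removeNth a v) := by
    intro m y v a
    funext b
    refine Fin.cases ?_ (fun b => ?_) b <;> simp [Fin.removeNth_apply]
  have hrem0 : ∀ (m : ℕ) (y : S) (v : Fin m → S),
      Fin.removeNth 0 (Matrix.vecCons y v : Fin (m + 1) → S) = v := by
    intro m y v
    funext b
    simp [Fin.removeNth_apply]
  cases k with
  | zero =>
    simp [realDiff, bracketTerm, AlternatingMap.alternatizeUncurryFin_apply, anchorComp, hrem0]
  | succ k =>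
    have hz : ∀ (r : ℕ) (b : R), (-1 : ℤ) ^ r • b = (-1 : R) ^ r * b := by
      intro r b
      rw [zsmul_eq_mul]; push_cast; rfl
    set D : R := ∑ j : Fin (k + 1), (-1 : R) ^ (j : ℕ) *
      (A.anchor (w j) c * η (Matrix.vecCons x (j.removeNth w))) with hD
    have h1 : AlternatingMap.alternatizeUncurryFin (A.anchorComp η) (Matrix.vecCons (c • x) w) =
        c * AlternatingMap.alternatizeUncurryFin (A.anchorComp η) (Matrix.vecCons x w) - D := by
      rw [AlternatingMap.alternatizeUncurryFin_apply, AlternatingMap.alternatizeUncurryFin_apply,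
        Fin.sum_univ_succ, Fin.sum_univ_succ (n := k + 1), mul_add, Finset.mul_sum, add_sub_assoc,
        hD, ← Finset.sum_sub_distrib]
      simp only [hrem, hrem0, Matrix.cons_val_zero, Matrix.cons_val_succ, anchorComp,
        LinearMap.coe_mk, AddHom.coe_mk, LinearMap.compAlternatingMap_apply, realForm_apply,
        AlternatingMap.map_vecCons_smul, Derivation.coeFn_coe, smul_eq_mul, Derivation.leibniz,
        map_smul, Derivation.smul_apply, Fin.val_succ, Fin.val_zero, pow_zero, one_smul, pow_succ]
      congr 1
      refine Finset.sum_congr rfl fun j _ => ?_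
      ring
    have h2 : AlternatingMap.alternatizeUncurryFin
          (AlternatingMap.alternatizeUncurryFinLM ∘ₗ A.bracketComp η) (Matrix.vecCons (c • x) w) =
        c * AlternatingMap.alternatizeUncurryFin
          (AlternatingMap.alternatizeUncurryFinLM ∘ₗ A.bracketComp η) (Matrix.vecCons x w) -
        2 * D := by
      have hb : ∀ X Y (v : Fin k → S), A.bracketComp η X Y v =
          η (Matrix.vecCons (A.bracket X Y) v) := fun _ _ _ => rfl
      have ha : ∀ (y : S) (u : R) (z : S) (v : Fin k → S), η (Matrix.vecCons (y + u • z) v) =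
          η (Matrix.vecCons y v) + u * η (Matrix.vecCons z v) := by
        intro y u z v
        rw [AlternatingMap.map_vecCons_add, AlternatingMap.map_vecCons_smul, smul_eq_mul]
      have hl : ∀ Y (v : Fin k → S), η (Matrix.vecCons (A.bracket (c • x) Y) v) =
          c * η (Matrix.vecCons (A.bracket x Y) v) - A.anchor Y c * η (Matrix.vecCons x v) := by
        intro Y v
        rw [A.leibniz_left, sub_eq_add_neg, ← neg_smul, ha, AlternatingMap.map_vecCons_smul,
          smul_eq_mul]
        ring
      have hr : ∀ Y (v : Fin k → S), η (Matrix.vecCons (A.bracket Y (c • x)) v) =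
          c * η (Matrix.vecCons (A.bracket Y x) v) + A.anchor Y c * η (Matrix.vecCons x v) := by
        intro Y v
        rw [A.leibniz, ha, AlternatingMap.map_vecCons_smul, smul_eq_mul]
      have hin : ∀ (Z : S) (u : Fin k → S),
          AlternatingMap.alternatizeUncurryFin (A.bracketComp η Z) (Matrix.vecCons (c • x) u) =
          c * AlternatingMap.alternatizeUncurryFin (A.bracketComp η Z) (Matrix.vecCons x u) +
            A.anchor Z c * η (Matrix.vecCons x u) := by
        intro Z u
        cases k with
        | zero =>
          simp [AlternatingMap.alternatizeUncurryFin_apply, hb, hr, hrem0]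
        | succ k =>
          rw [AlternatingMap.alternatizeUncurryFin_apply, AlternatingMap.alternatizeUncurryFin_apply,
            Fin.sum_univ_succ, Fin.sum_univ_succ (n := k + 1), mul_add, Finset.mul_sum]
          have hsw : ∀ (y : S) (a : Fin (k + 1)),
              η (Matrix.vecCons y (Matrix.vecCons (c • x) (Fin.removeNth a u))) =
              c * η (Matrix.vecCons y (Matrix.vecCons x (Fin.removeNth a u))) := by
            intro y a
            have := (η.curryLeft y).map_vecCons_smul (Fin.removeNth a u) c x
            simpa using this
          simp only [hz, hrem, hrem0, Matrix.cons_val_zero, Matrix.cons_val_succ, hb, hr, hsw,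
            Fin.val_succ, Fin.val_zero, pow_zero, one_smul]
          rw [Finset.sum_congr rfl fun j _ => mul_left_comm _ _ _]
          ring
      have h0 : AlternatingMap.alternatizeUncurryFin (A.bracketComp η (c • x)) w =
          c * AlternatingMap.alternatizeUncurryFin (A.bracketComp η x) w - D := by
        rw [AlternatingMap.alternatizeUncurryFin_apply, AlternatingMap.alternatizeUncurryFin_apply,
          Finset.mul_sum, hD, ← Finset.sum_sub_distrib]
        refine Finset.sum_congr rfl fun j _ => ?_
        rw [hb, hb, hl, hz, hz]
        ring
      rw [AlternatingMap.alternatizeUncurryFin_apply, AlternatingMap.alternatizeUncurryFin_apply,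
        Fin.sum_univ_succ, Fin.sum_univ_succ (n := k + 1), mul_add, Finset.mul_sum]
      simp only [hz, hrem, hrem0, Matrix.cons_val_zero, Matrix.cons_val_succ, LinearMap.comp_apply,
        AlternatingMap.alternatizeUncurryFinLM_apply, h0, hin, Fin.val_succ, Fin.val_zero, pow_zero,
        one_smul]
      rw [two_mul, ← sub_sub, add_sub_right_comm, add_sub_assoc]
      congr 1
      rw [hD, ← Finset.sum_sub_distrib]
      refine Finset.sum_congr rfl fun j _ => ?_
      ring
    have e : (algebraMap ℝ R (1 / 2)) * 2 = 1 := by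
      rw [← map_ofNat (algebraMap ℝ R) 2, ← map_mul]; norm_num
    simp only [realDiff, bracketTerm, AlternatingMap.add_apply, AlternatingMap.smul_apply, h1, h2]
    rw [Algebra.smul_def, Algebra.smul_def, map_neg]
    linear_combination D * e

theorem realDiff_update_smul (A : SkewAlgebroid R S) {k : ℕ} (η : Alt R S k)
    (v : Fin (k + 1) → S) (i : Fin (k + 1)) (c : R) (x : S) :
    A.realDiff η (Function.update v i (c • x)) = c • A.realDiff η (Function.update v i x) := by
  have h : ∀ y, Function.update v i y = i.insertNth y (i.removeNth v) := fun y => by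
    simp [Fin.insertNth_removeNth]
  rw [h, h, AlternatingMap.map_insertNth, AlternatingMap.map_insertNth, realDiff_cons_smul,
    smul_eq_mul, mul_smul_comm]

/-- The differential `d` on `k`-forms,
`dη(X_0, …, X_k) = ∑_i (-1)^i ρ(X_i) η(X_0, …, X̂_i, …, X_k)
  + ∑_{i < j} (-1)^{i + j} η([X_i, X_j], X_0, …, X̂_i, …, X̂_j, …, X_k)`. -/
def altDiff (A : SkewAlgebroid R S) {k : ℕ} (η : Alt R S k) : Alt R S (k + 1) where
  toFun := A.realDiff η
  map_update_add' v i x y := (A.realDiff η).map_update_add' v i x y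
  map_update_smul' v i c x := by
    convert A.realDiff_update_smul η v i c x
  map_eq_zero_of_eq' v _ _ h hij := (A.realDiff η).map_eq_zero_of_eq v h hij

/-- `altDiff` as an `ℝ`-linear map. -/
def altDiffLM (A : SkewAlgebroid R S) (k : ℕ) : Alt R S k →ₗ[ℝ] Alt R S (k + 1) where
  toFun := A.altDiff
  map_add' η ζ := by
    ext v
    have h1 : A.anchorComp (η + ζ) = A.anchorComp η + A.anchorComp ζ := by
      ext X w
      simp [anchorComp]
    have h2 : A.bracketTerm k (η + ζ) = A.bracketTerm k η + A.bracketTerm k ζ := by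
      cases k with
      | zero => simp [bracketTerm]
      | succ k =>
        have h : A.bracketComp (η + ζ) = A.bracketComp η + A.bracketComp ζ := rfl
        simp only [bracketTerm, h, LinearMap.comp_add, AlternatingMap.alternatizeUncurryFin_add,
          smul_add]
    change A.realDiff (η + ζ) v = A.realDiff η v + A.realDiff ζ v
    simp only [realDiff, h1, h2, AlternatingMap.alternatizeUncurryFin_add,
      AlternatingMap.add_apply]
    ring
  map_smul' c η := by
    ext v
    have h1 : A.anchorComp (c • η) = c • A.anchorComp η := by
      ext X w
      simp [anchorComp]
    have h2 : A.bracketTerm k (c • η) = c • A.bracketTerm k η := by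
      cases k with
      | zero => simp [bracketTerm]
      | succ k =>
        have h : A.bracketComp (c • η) = c • A.bracketComp η := rfl
        simp only [bracketTerm, h, LinearMap.comp_smul, AlternatingMap.alternatizeUncurryFin_smul,
          smul_comm c]
    change A.realDiff (c • η) v = c • A.realDiff η v
    simp only [realDiff, h1, h2, AlternatingMap.alternatizeUncurryFin_smul,
      AlternatingMap.add_apply, AlternatingMap.smul_apply, smul_add]

/-- The differential `d` on the graded module of forms. -/
def diff (A : SkewAlgebroid R S) : Multi R S →ₗ[ℝ] Multi R S :=
  DirectSum.toModule ℝ ℕ _ fun k =>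
    DirectSum.lof ℝ ℕ (Alt R S) (k + 1) ∘ₗ A.altDiffLM k

/-- The twisted differential `d^θ η = dη + θ ∧ η`. -/
def twDiff (A : SkewAlgebroid R S) (θ : Module.Dual R S) : Multi R S →ₗ[ℝ] Multi R S :=
  A.diff + (wedge (one θ)).restrictScalars ℝ

/-! ### Differential and Lie derivatives in low degree -/

/-- `df` for a function `f`. -/
def dFun (A : SkewAlgebroid R S) (f : R) : Module.Dual R S where
  toFun X := A.anchor X f
  map_add' X Y := by simp
  map_smul' c X := by simp

/-- The Lie derivative `L_X α` of a `1`-form. -/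
def lieDer (A : SkewAlgebroid R S) (X : S) (α : Module.Dual R S) : Module.Dual R S where
  toFun Y := A.anchor X (α Y) - α (A.bracket X Y)
  map_add' Y Z := by simp only [map_add]; ring
  map_smul' c Y := by
    simp only [map_smul, map_add, A.leibniz, smul_eq_mul, Derivation.leibniz, RingHom.id_apply]
    ring

/-- `d^φ f = df + f φ` for a function `f`. -/
def dFunTw (A : SkewAlgebroid R S) (φ : Module.Dual R S) (f : R) : Module.Dual R S :=
  A.dFun f + f • φ

/-- `L^φ_X α = L_X α + φ(X) α`, that is `d^φ (i_X α) + i_X (d^φ α)`, for a `1`-form `α`. -/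
def lieDerTw (A : SkewAlgebroid R S) (φ : Module.Dual R S) (X : S) (α : Module.Dual R S) :
    Module.Dual R S :=
  A.lieDer X α + φ X • α

/-! ### Schouten brackets and Jacobi brackets

Here `S = Γ(B)` and `T = Γ(B*)`, and `pair : S → T → R` is the duality pairing.  Multisections of
`B` are elements of `Multi R T`. -/

/-- `br` is the Schouten bracket of `A`, extending the bracket of sections to multisections.  For
sections of a vector bundle and of its dual there is exactly one such bracket. -/
structure IsSchoutenBracket (A : SkewAlgebroid R S) (pair : S →ₗ[R] T →ₗ[R] R)
    (br : Multi R T →ₗ[ℝ] Multi R T →ₗ[ℝ] Multi R T) : Prop where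
  /-- the bracket has degree `-1` (so it vanishes on two functions) -/
  degree : ∀ (p q : ℕ) (P : Alt R T p) (Q : Alt R T q) (n : ℕ), n + 1 ≠ p + q →
    br (hom p P) (hom q Q) n = 0
  section_section : ∀ X Y : S, br (one (pair X)) (one (pair Y)) = one (pair (A.bracket X Y))
  section_function : ∀ (X : S) (f : R), br (one (pair X)) (fn f) = fn (A.anchor X f)
  /-- graded skew-symmetry, with sign `-(-1)^((p-1)(q-1))` -/
  skew : ∀ (p q : ℕ) (P : Alt R T p) (Q : Alt R T q),
    br (hom p P) (hom q Q) = -(-1 : ℝ) ^ ((p + 1) * (q + 1)) • br (hom q Q) (hom p P)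
  /-- graded Leibniz rule, with sign `(-1)^((p-1)q)` -/
  leibniz : ∀ (p q r : ℕ) (P : Alt R T p) (Q : Alt R T q) (U : Alt R T r),
    br (hom p P) (wedge (hom q Q) (hom r U)) =
      wedge (br (hom p P) (hom q Q)) (hom r U) +
        (-1 : ℝ) ^ ((p + 1) * q) • wedge (hom q Q) (br (hom p P) (hom r U))

/-- The Schouten-Jacobi bracket
`[P, Q]^φ = [P, Q] + (p - 1) P ∧ i_φ Q - (-1)^(p-1) (q - 1) i_φ P ∧ Q`
of multisections `P` of degree `p` and `Q` of degree `q`. -/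
def jacobiBracket (br : Multi R T →ₗ[ℝ] Multi R T →ₗ[ℝ] Multi R T) (φ : T) (p q : ℕ)
    (P Q : Multi R T) : Multi R T :=
  br P Q + ((p : ℝ) - 1) • wedge P (contract φ Q) -
    ((-1 : ℝ) ^ (p + 1) * ((q : ℝ) - 1)) • wedge (contract φ P) Q

/-- `φ ∈ Γ(B*)` is a `1`-cocycle: `dφ = 0`. -/
def IsCocycle (A : SkewAlgebroid R S) (pair : S →ₗ[R] T →ₗ[R] R) (φ : T) : Prop :=
  ∀ X Y : S, A.anchor X (pair Y φ) - A.anchor Y (pair X φ) - pair (A.bracket X Y) φ = 0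

/-- `(A, φ)` is a Jacobi algebroid. -/
structure IsJacobiAlgebroid (A : SkewAlgebroid R S) (pair : S →ₗ[R] T →ₗ[R] R) (φ : T) :
    Prop where
  isLie : A.IsLie
  cocycle : A.IsCocycle pair φ

/-- `D` is a (degree one) `W`-quasi differential on the Jacobi algebroid `(A, φ)` with Schouten
bracket `br`. -/
structure IsQuasiDifferential (br : Multi R T →ₗ[ℝ] Multi R T →ₗ[ℝ] Multi R T) (φ : T)
    (W : Module.Dual R T) (D : Multi R T →ₗ[ℝ] Multi R T) : Prop where
  degree : ∀ (p : ℕ) (P : Alt R T p) (n : ℕ), n ≠ p + 1 → D (hom p P) n = 0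
  leibniz : ∀ (p q : ℕ) (P : Alt R T p) (Q : Alt R T q),
    D (wedge (hom p P) (hom q Q)) =
      wedge (D (hom p P)) (hom q Q) + (-1 : ℝ) ^ p • wedge (hom p P) (D (hom q Q)) -
        wedge (one W) (wedge (hom p P) (hom q Q))
  bracket : ∀ (p q : ℕ) (P : Alt R T p) (Q : Alt R T q),
    D (jacobiBracket br φ p q (hom p P) (hom q Q)) =
      jacobiBracket br φ (p + 1) q (D (hom p P)) (hom q Q) +
        (-1 : ℝ) ^ (p + 1) • jacobiBracket br φ p (q + 1) (hom p P) (D (hom q Q))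

/-- `(A, φ, D, Ξ)` is a quasi-Jacobi bialgebroid, with `D` a `W`-quasi differential, `W ∈ Γ(B)`
and `Ξ ∈ Γ(⋀³ B)`. -/
def IsQuasiJacobiBialgebroid (A : SkewAlgebroid R S) (pair : S →ₗ[R] T →ₗ[R] R) (φ : T) (W : S)
    (D : Multi R T →ₗ[ℝ] Multi R T) (Ξ : Alt R T 3) : Prop :=
  A.IsJacobiAlgebroid pair φ ∧
    ∃ br, A.IsSchoutenBracket pair br ∧
      IsQuasiDifferential br φ (pair W) D ∧
      D (hom 3 Ξ) = 0 ∧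
      ∀ (q : ℕ) (Q : Alt R T q), D (D (hom q Q)) = jacobiBracket br φ 3 q (hom 3 Ξ) (hom q Q)

/-! ### Bivectors, deformations, Jacobi quasi-Nijenhuis structures -/

end SkewAlgebroid

variable (R S) in
/-- A bivector `π ∈ Γ(⋀² B)`, given by the skew-symmetric bundle map `π^♯ : B* → B`, with
`π(α, β) = ⟨β, π^♯ α⟩`. -/
structure Bivector where
  /-- the map `π^♯` -/
  sharp : Module.Dual R S →ₗ[R] S
  skew : ∀ α : Module.Dual R S, α (sharp α) = 0

/-- A bivector as an alternating bilinear form on `Γ(B*)`, `(α, β) ↦ ⟨β, π^♯ α⟩`. -/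
def Bivector.toAlt (π : Bivector R S) : Alt R (Module.Dual R S) 2 where
  toFun v := v 1 (π.sharp (v 0))
  map_update_add' v i x y := by
    fin_cases i <;> simp
  map_update_smul' v i c x := by
    fin_cases i <;> simp
  map_eq_zero_of_eq' v i j h hij := by
    have h01 : v 0 = v 1 := by
      clear * - h hij
      fin_cases i <;> fin_cases j <;> simp_all
    rw [h01, π.skew]

theorem Bivector.swap (π : Bivector R S) (α β : Module.Dual R S) :
    α (π.sharp β) = -β (π.sharp α) := by
  have h := π.skew (α + β)
  simp only [map_add, LinearMap.add_apply, π.skew, zero_add, add_zero] at h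
  linear_combination h

/-- The form `i_N η = ∑_i η(X_1, …, N X_i, …, X_k)`. -/
def insertEnd (N : S →ₗ[R] S) {k : ℕ} (η : Alt R S k) : Alt R S k where
  __ := ∑ i : Fin k, (η : MultilinearMap R (fun _ : Fin k => S) R).compLinearMap
    (Function.update (fun _ => LinearMap.id) i N)
  map_eq_zero_of_eq' v i j h hij := by
    have hup : ∀ a : Fin k, (fun b => (Function.update (fun _ => LinearMap.id) a N :
        Fin k → S →ₗ[R] S) b (v b)) = Function.update v a (N (v a)) := by
      intro a
      funext b
      by_cases hb : b = a
      · subst hb; simp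
      · simp [hb]
    suffices ∑ a : Fin k, η (Function.update v a (N (v a))) = 0 by
      simpa [sum_apply, hup] using this
    rw [Fintype.sum_eq_add i j hij]
    · have hsw : Function.update v j (N (v j)) =
          Function.update v i (N (v i)) ∘ Equiv.swap i j := by
        funext b
        by_cases hbi : b = i
        · subst hbi; simp [hij, hij.symm, h]
        · by_cases hbj : b = j
          · subst hbj; simp [h]
          · simp [hbi, hbj, Equiv.swap_apply_of_ne_of_ne hbi hbj]
      rw [hsw, AlternatingMap.map_swap _ _ hij, add_neg_cancel]
    · rintro a ⟨hai, haj⟩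
      exact η.map_eq_zero_of_eq _ (by simp [hai.symm, haj.symm, h]) hij

/-- `η(Y, X, -)`, that is `i_{X ∧ Y} η = i_X (i_Y η)`, as a `1`-form. -/
def contractPair (X Y : S) (η : Alt R S 3) : Module.Dual R S :=
  (AlternatingMap.ofSubsingleton R S R (0 : Fin 1)).symm ((η.curryLeft Y).curryLeft X)

namespace SkewAlgebroid

/-- The deformed bracket `[X, Y]_N = [NX, Y] + [X, NY] - N[X, Y]` with anchor `ρ ∘ N`. -/
def deform (A : SkewAlgebroid R S) (N : S →ₗ[R] S) : SkewAlgebroid R S where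
  anchor := A.anchor ∘ₗ N
  bracket := LinearMap.mk₂ ℝ (fun X Y => A.bracket (N X) Y + A.bracket X (N Y) - N (A.bracket X Y))
    (by intro X X' Y; simp only [map_add, LinearMap.add_apply]; abel)
    (by
      intro c X Y
      simp only [N.map_smul_of_tower, map_smul, LinearMap.smul_apply, smul_sub, smul_add])
    (by intro X Y Y'; simp only [map_add]; abel)
    (by
      intro c X Y
      rw [N.map_smul_of_tower, map_smul, map_smul, map_smul, N.map_smul_of_tower, smul_sub,
        smul_add])
  bracket_self X := by
    simp only [LinearMap.mk₂_apply, A.bracket_self, map_zero, sub_zero]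
    rw [A.bracket_swap, neg_add_cancel]
  leibniz X f Y := by
    simp only [LinearMap.mk₂_apply, map_smul, A.leibniz, map_add, LinearMap.comp_apply, smul_add,
      smul_sub]
    abel

/-- The torsion `T_N(X, Y) = [NX, NY] - N[X, Y]_N`. -/
def torsion (A : SkewAlgebroid R S) (N : S →ₗ[R] S) (X Y : S) : S :=
  A.bracket (N X) (N Y) - N ((A.deform N).bracket X Y)

/-- For a map `s : Γ(A*) → Γ(A)`, thought of as `π^♯`, the bracket
`[α, β]_π = L^φ_{π^♯ α} β - L^φ_{π^♯ β} α - d^φ (π(α, β))` of `1`-forms. -/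
def coBracket (A : SkewAlgebroid R S) (φ : Module.Dual R S) (s : Module.Dual R S →ₗ[R] S)
    (α β : Module.Dual R S) : Module.Dual R S :=
  A.lieDerTw φ (s α) β - A.lieDerTw φ (s β) α - A.dFunTw φ (β (s α))

/-- `A*_π`: the dual bundle with the bracket `[α, β]_π` and the anchor `ρ ∘ π^♯`. -/
def dualOf (A : SkewAlgebroid R S) (φ : Module.Dual R S) (π : Bivector R S) :
    SkewAlgebroid R (Module.Dual R S) where
  anchor := A.anchor ∘ₗ π.sharp
  bracket := LinearMap.mk₂ ℝ (A.coBracket φ π.sharp)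
    (by
      intro α α' β
      ext X
      simp only [coBracket, lieDerTw, lieDer, dFunTw, dFun, map_add, LinearMap.add_apply,
        LinearMap.sub_apply, LinearMap.smul_apply, LinearMap.coe_mk, AddHom.coe_mk, smul_eq_mul,
        Derivation.add_apply]
      ring)
    (by
      intro c α β
      ext X
      rw [← algebraMap_smul R c α, ← algebraMap_smul R c (A.coBracket φ π.sharp α β)]
      simp only [coBracket, lieDerTw, lieDer, dFunTw, dFun, map_smul, A.leibniz_left, map_sub,
        LinearMap.add_apply, LinearMap.sub_apply, LinearMap.smul_apply, LinearMap.coe_mk,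
        AddHom.coe_mk, smul_eq_mul, Derivation.smul_apply, Derivation.leibniz,
        Derivation.map_algebraMap]
      ring)
    (by
      intro α β β'
      ext X
      simp only [coBracket, lieDerTw, lieDer, dFunTw, dFun, map_add, LinearMap.add_apply,
        LinearMap.sub_apply, LinearMap.smul_apply, LinearMap.coe_mk, AddHom.coe_mk, smul_eq_mul,
        Derivation.add_apply]
      ring)
    (by
      intro c α β
      ext X
      rw [← algebraMap_smul R c β, ← algebraMap_smul R c (A.coBracket φ π.sharp α β)]
      simp only [coBracket, lieDerTw, lieDer, dFunTw, dFun, map_smul, A.leibniz_left, map_sub,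
        LinearMap.add_apply, LinearMap.sub_apply, LinearMap.smul_apply, LinearMap.coe_mk,
        AddHom.coe_mk, smul_eq_mul, Derivation.smul_apply, Derivation.leibniz,
        Derivation.map_algebraMap]
      ring)
  bracket_self α := by
    ext X
    simp [coBracket, dFunTw, dFun, π.skew]
  leibniz α f β := by
    ext X
    simp only [LinearMap.mk₂_apply, coBracket, lieDerTw, lieDer, dFunTw, dFun, map_smul,
      LinearMap.add_apply, LinearMap.comp_apply, A.leibniz_left, map_sub,
      LinearMap.sub_apply, LinearMap.smul_apply, LinearMap.coe_mk, AddHom.coe_mk, smul_eq_mul,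
      Derivation.smul_apply, Derivation.leibniz, π.swap α β]
    ring

/-- `π` is a Jacobi bivector on `(A, φ)`: `[π, π]^φ = 0`. -/
def IsJacobiBivector (A : SkewAlgebroid R S) (φ : Module.Dual R S) (π : Bivector R S) : Prop :=
  ∃ br, A.IsSchoutenBracket (Module.Dual.eval R S) br ∧
    jacobiBracket br φ 2 2 (hom 2 π.toAlt) (hom 2 π.toAlt) = 0

/-- `N` is compatible with the bivector `π`: `N π^♯ = π^♯ N*`, and the Magri-Morosi concomitant
`[α, β]_{Nπ} - ([N* α, β]_π + [α, N* β]_π - N* [α, β]_π)` vanishes. -/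
structure IsCompatible (A : SkewAlgebroid R S) (φ : Module.Dual R S) (π : Bivector R S)
    (N : S →ₗ[R] S) : Prop where
  comm : N ∘ₗ π.sharp = π.sharp ∘ₗ N.dualMap
  concomitant : ∀ α β, A.coBracket φ (N ∘ₗ π.sharp) α β =
    ((A.dualOf φ π).deform N.dualMap).bracket α β

/-- `(A, φ, π, N, η)` is a Jacobi quasi-Nijenhuis algebroid. -/
structure IsJacobiQuasiNijenhuis (A : SkewAlgebroid R S) (φ : Module.Dual R S) (π : Bivector R S)
    (N : S →ₗ[R] S) (η : Alt R S 3) : Prop where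
  jacobiAlgebroid : A.IsJacobiAlgebroid (Module.Dual.eval R S) φ
  jacobiBivector : A.IsJacobiBivector φ π
  compatible : A.IsCompatible φ π N
  closed : A.twDiff φ (hom 3 η) = 0
  torsion_eq : ∀ X Y, A.torsion N X Y =
    -π.sharp (contractPair X Y η)
  closed_insert : A.twDiff φ (hom 3 (insertEnd N η)) = 0

end SkewAlgebroid
end Algebroid

section Sections

variable {E : Type*} [NormedAddCommGroup E] [NormedSpace ℝ E]
  {H : Type*} [TopologicalSpace H] {I : ModelWithCorners ℝ E H}
  {M : Type*} [TopologicalSpace M] [ChartedSpace H M]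
  {F : Type*} [NormedAddCommGroup F] [NormedSpace ℝ F]
  {V : M → Type*} [TopologicalSpace (Bundle.TotalSpace F V)]
  [∀ x, TopologicalSpace (V x)] [FiberBundle F V]
  [∀ x, AddCommGroup (V x)] [∀ x, Module ℝ (V x)] [VectorBundle ℝ F V]

/-- Smooth sections form a module over smooth functions, by pointwise multiplication. -/
instance sectionModule : Module C^∞⟮I, M; ℝ⟯ Cₛ^∞⟮I; F, V⟯ where
  smul f s := ⟨fun x => f x • s x, f.contMDiff.smul_section s.contMDiff⟩
  one_smul s := by ext x; exact one_smul ℝ (s x)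
  mul_smul f g s := by ext x; exact mul_smul (f x) (g x) (s x)
  smul_zero f := by ext x; exact smul_zero (f x)
  smul_add f s t := by ext x; exact smul_add (f x) (s x) (t x)
  add_smul f g s := by ext x; exact add_smul (f x) (g x) (s x)
  zero_smul s := by ext x; exact zero_smul ℝ (s x)

instance sectionTower : IsScalarTower ℝ C^∞⟮I, M; ℝ⟯ Cₛ^∞⟮I; F, V⟯ where
  smul_assoc c f s := by ext x; exact smul_assoc c (f x) (s x)

end Sections

end

noncomputable section

set_option linter.unusedSectionVars false

/-! ### Contraction of an alternatization -/

/-- A sum over the permutations of `Fin (n + 1)`, sorted by the position of `0`. -/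
theorem Equiv.Perm.sum_sign_smul_cons {G T : Type*} [AddCommGroup G] {n : ℕ}
    (F : (Fin (n + 1) → T) → G) (t : T) (x : Fin n → T) :
    ∑ σ : Equiv.Perm (Fin (n + 1)), Equiv.Perm.sign σ • F (fun i => Matrix.vecCons t x (σ i)) =
      ∑ i : Fin (n + 1), (-1 : ℤˣ) ^ (i : ℕ) •
        ∑ τ : Equiv.Perm (Fin n), Equiv.Perm.sign τ • F (i.insertNth t fun j => x (τ j)) := by
  let g : Fin (n + 1) × Equiv.Perm (Fin n) → Equiv.Perm (Fin (n + 1)) := fun a =>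
    Equiv.Perm.decomposeFin.symm (0, a.2) * a.1.cycleRange
  have h0 : ∀ a, (g a)⁻¹ 0 = a.1 := by
    intro a
    rw [Equiv.Perm.inv_eq_iff_eq]
    simp [g]
  have hg : Function.Bijective g := by
    rw [Fintype.bijective_iff_injective_and_card]
    constructor
    · intro a b hab
      have h1 : a.1 = b.1 := by rw [← h0 a, ← h0 b, hab]
      have h2 : a.2 = b.2 := by
        have h3 := hab
        simp only [g, h1, mul_left_inj] at h3
        simpa using Equiv.Perm.decomposeFin.symm.injective h3
      exact Prod.ext h1 h2
    · simp [Fintype.card_perm, Nat.factorial_succ]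
  rw [← hg.sum_comp, Fintype.sum_prod_type]
  refine Finset.sum_congr rfl fun i _ => ?_
  rw [Finset.smul_sum]
  refine Finset.sum_congr rfl fun τ _ => ?_
  have hs : Equiv.Perm.sign (g (i, τ)) = (-1) ^ (i : ℕ) * Equiv.Perm.sign τ := by
    simp [g, Equiv.Perm.sign_mul, Equiv.Perm.decomposeFin.symm_sign, mul_comm]
  have hv : (fun j => Matrix.vecCons t x (g (i, τ) j)) = i.insertNth t fun j => x (τ j) := by
    rw [← Fin.cons_comp_cycleRange]
    funext j
    simp only [g, Equiv.Perm.mul_apply, Function.comp_apply]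
    generalize i.cycleRange j = k
    refine Fin.cases ?_ (fun k => ?_) k
    · simp
    · simp [Equiv.Perm.decomposeFin_symm_apply_succ]
  rw [hs, hv, mul_smul]

namespace Algebroid

section Product

variable {R T M₁ M₂ : Type*} [CommRing R] [AddCommGroup T] [Module R T]
  [AddCommGroup M₁] [Module R M₁] [AddCommGroup M₂] [Module R M₂]

/-- The exterior product of alternating maps with values in modules paired by `B`. -/
def altProd (B : M₁ →ₗ[R] M₂ →ₗ[R] R) (p q : ℕ) :
    (T [⋀^Fin p]→ₗ[R] M₁) →ₗ[R] (T [⋀^Fin q]→ₗ[R] M₂) →ₗ[R] Alt R T (p + q) :=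
  (TensorProduct.mk R _ _).compr₂
    ((AlternatingMap.domDomCongrₗ R finSumFinEquiv).toLinearMap ∘ₗ
      LinearMap.compAlternatingMapₗ R (TensorProduct.lift B) ∘ₗ AlternatingMap.domCoprod')

theorem altWedge_eq_altProd (p q : ℕ) :
    (altWedge p q : Alt R T p →ₗ[R] Alt R T q →ₗ[R] Alt R T (p + q)) =
      altProd (LinearMap.mul R R) p q := rfl

/-- The value of an alternatized product before normalization by `p! q!`. -/
def altSum (B : M₁ →ₗ[R] M₂ →ₗ[R] R) {p q n : ℕ} (h : p + q = n)
    (P : T [⋀^Fin p]→ₗ[R] M₁) (Q : T [⋀^Fin q]→ₗ[R] M₂) (v : Fin n → T) : R :=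
  ∑ σ : Equiv.Perm (Fin n), Equiv.Perm.sign σ •
    B (P fun i => v (σ (Fin.cast h (Fin.castAdd q i))))
      (Q fun j => v (σ (Fin.cast h (Fin.natAdd p j))))

theorem factorial_smul_altProd (B : M₁ →ₗ[R] M₂ →ₗ[R] R) {p q n : ℕ} (h : p + q = n)
    (P : T [⋀^Fin p]→ₗ[R] M₁) (Q : T [⋀^Fin q]→ₗ[R] M₂) (v : Fin n → T) :
    (p.factorial * q.factorial) • altProd B p q P Q (fun i => v (Fin.cast h i)) =
      altSum B h P Q v := by
  subst h
  have h := congrArg (fun A => TensorProduct.lift B (A fun i => v (finSumFinEquiv i)))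
    (MultilinearMap.domCoprod_alternization_eq P Q)
  simp only [Fintype.card_fin, AlternatingMap.smul_apply, map_nsmul] at h
  have h' : altProd B p q P Q v =
      TensorProduct.lift B (P.domCoprod Q fun i => v (finSumFinEquiv i)) := rfl
  simp only [Fin.cast_eq_self]
  rw [h', ← h, MultilinearMap.alternatization_apply, map_sum, altSum]
  refine Fintype.sum_equiv (finSumFinEquiv.permCongr) _ _ fun σ => ?_
  rw [Equiv.Perm.sign_permCongr]
  have hz : ∀ (u : ℤˣ) (x : TensorProduct R M₁ M₂),
      TensorProduct.lift B (u • x) = u • TensorProduct.lift B x := by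
    intro u x
    rw [Units.smul_def, Units.smul_def, map_zsmul]
  rw [hz]
  simp only [MultilinearMap.domDomCongr_apply, MultilinearMap.domCoprod_apply,
    AlternatingMap.coe_multilinearMap, TensorProduct.lift.tmul, Equiv.permCongr_apply,
    Fin.cast_eq_self, finSumFinEquiv_symm_apply_castAdd, finSumFinEquiv_symm_apply_natAdd]

theorem insertNth_castAdd {p q n : ℕ} (h : p + 1 + q = n + 1) (h' : p + q = n) (i : Fin (p + 1))
    (t : T) (x : Fin n → T) :
    (fun j : Fin (p + 1) => (Fin.cast h (Fin.castAdd q i)).insertNth (α := fun _ => T) t x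
      (Fin.cast h (Fin.castAdd q j))) =
        i.insertNth t (fun j => x (Fin.cast h' (Fin.castAdd q j))) ∧
    (fun j : Fin q => (Fin.cast h (Fin.castAdd q i)).insertNth (α := fun _ => T) t x
      (Fin.cast h (Fin.natAdd (p + 1) j))) = fun j => x (Fin.cast h' (Fin.natAdd p j)) := by
  subst h'
  constructor
  · funext j
    rcases Fin.eq_self_or_eq_succAbove i j with rfl | ⟨k, rfl⟩
    · simp
    · have e : Fin.cast h (Fin.castAdd q (i.succAbove k)) =
          (Fin.cast h (Fin.castAdd q i)).succAbove (Fin.castAdd q k) := by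
        ext
        simp only [Fin.succAbove, Fin.lt_def]
        simp only [Fin.val_cast, Fin.val_castAdd, Fin.val_castSucc]
        split_ifs <;> simp
      rw [e, Fin.insertNth_apply_succAbove, Fin.insertNth_apply_succAbove]
      rfl
  · funext j
    have e : Fin.cast h (Fin.natAdd (p + 1) j) =
        (Fin.cast h (Fin.castAdd q i)).succAbove (Fin.natAdd p j) := by
      have := i.isLt
      rw [Fin.succAbove_of_le_castSucc]
      · ext; simp; omega
      · simp [Fin.le_def]; omega
    rw [e, Fin.insertNth_apply_succAbove]
    rfl

theorem insertNth_natAdd {p q n : ℕ} (h : p + (q + 1) = n + 1) (h' : p + q = n) (i : Fin (q + 1))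
    (t : T) (x : Fin n → T) :
    (fun j : Fin (q + 1) => (Fin.cast h (Fin.natAdd p i)).insertNth (α := fun _ => T) t x
      (Fin.cast h (Fin.natAdd p j))) =
        i.insertNth t (fun j => x (Fin.cast h' (Fin.natAdd p j))) ∧
    (fun j : Fin p => (Fin.cast h (Fin.natAdd p i)).insertNth (α := fun _ => T) t x
      (Fin.cast h (Fin.castAdd (q + 1) j))) = fun j => x (Fin.cast h' (Fin.castAdd q j)) := by
  subst h'
  constructor
  · funext j
    rcases Fin.eq_self_or_eq_succAbove i j with rfl | ⟨k, rfl⟩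
    · simp
    · have e : Fin.cast h (Fin.natAdd p (i.succAbove k)) =
          (Fin.cast h (Fin.natAdd p i)).succAbove (Fin.natAdd p k) := by
        ext
        simp only [Fin.succAbove, Fin.lt_def]
        simp only [Fin.val_cast, Fin.val_natAdd, Fin.val_castSucc, add_lt_add_iff_left]
        split_ifs <;> simp [add_assoc]
      rw [e, Fin.insertNth_apply_succAbove, Fin.insertNth_apply_succAbove]
      rfl
  · funext j
    have e : Fin.cast h (Fin.castAdd (q + 1) j) =
        (Fin.cast h (Fin.natAdd p i)).succAbove (Fin.castAdd q j) := by
      have := j.isLt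
      rw [Fin.succAbove_of_castSucc_lt]
      · ext; simp
      · simp [Fin.lt_def]; omega
    rw [e, Fin.insertNth_apply_succAbove]
    rfl

theorem altSum_cons (B : M₁ →ₗ[R] M₂ →ₗ[R] R) {p q n : ℕ} (h : p + q = n + 1)
    (P : T [⋀^Fin p]→ₗ[R] M₁) (Q : T [⋀^Fin q]→ₗ[R] M₂) (t : T) (x : Fin n → T) :
    altSum B h P Q (Matrix.vecCons t x) =
      (∑ i : Fin p, (-1 : ℤˣ) ^ (i : ℕ) • ∑ τ : Equiv.Perm (Fin n), Equiv.Perm.sign τ •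
        B (P fun j => (Fin.cast h (Fin.castAdd q i)).insertNth (α := fun _ => T) t
            (fun k => x (τ k)) (Fin.cast h (Fin.castAdd q j)))
          (Q fun j => (Fin.cast h (Fin.castAdd q i)).insertNth (α := fun _ => T) t
            (fun k => x (τ k)) (Fin.cast h (Fin.natAdd p j)))) +
      ∑ i : Fin q, (-1 : ℤˣ) ^ (p + i : ℕ) • ∑ τ : Equiv.Perm (Fin n), Equiv.Perm.sign τ •
        B (P fun j => (Fin.cast h (Fin.natAdd p i)).insertNth (α := fun _ => T) t
            (fun k => x (τ k)) (Fin.cast h (Fin.castAdd q j)))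
          (Q fun j => (Fin.cast h (Fin.natAdd p i)).insertNth (α := fun _ => T) t
            (fun k => x (τ k)) (Fin.cast h (Fin.natAdd p j))) := by
  rw [altSum, Equiv.Perm.sum_sign_smul_cons (F := fun w : Fin (n + 1) → T =>
    B (P fun i => w (Fin.cast h (Fin.castAdd q i))) (Q fun j => w (Fin.cast h (Fin.natAdd p j)))),
    ← (finCongr h).sum_comp, Fin.sum_univ_add]
  rfl

theorem sum_insert_left (B : M₁ →ₗ[R] M₂ →ₗ[R] R) {p q n : ℕ} (h : p + 1 + q = n + 1)
    (h' : p + q = n)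
    (P : T [⋀^Fin (p + 1)]→ₗ[R] M₁) (Q : T [⋀^Fin q]→ₗ[R] M₂) (t : T) (x : Fin n → T) :
    (∑ i : Fin (p + 1), (-1 : ℤˣ) ^ (i : ℕ) • ∑ τ : Equiv.Perm (Fin n), Equiv.Perm.sign τ •
        B (P fun j => (Fin.cast h (Fin.castAdd q i)).insertNth (α := fun _ => T) t
            (fun k => x (τ k)) (Fin.cast h (Fin.castAdd q j)))
          (Q fun j => (Fin.cast h (Fin.castAdd q i)).insertNth (α := fun _ => T) t
            (fun k => x (τ k)) (Fin.cast h (Fin.natAdd (p + 1) j)))) =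
      (p + 1) • altSum B h' (P.curryLeft t) Q x := by
  have key : ∀ i : Fin (p + 1), ((-1 : ℤˣ) ^ (i : ℕ) • ∑ τ : Equiv.Perm (Fin n),
      Equiv.Perm.sign τ •
        B (P fun j => (Fin.cast h (Fin.castAdd q i)).insertNth (α := fun _ => T) t
            (fun k => x (τ k)) (Fin.cast h (Fin.castAdd q j)))
          (Q fun j => (Fin.cast h (Fin.castAdd q i)).insertNth (α := fun _ => T) t
            (fun k => x (τ k)) (Fin.cast h (Fin.natAdd (p + 1) j)))) =
      altSum B h' (P.curryLeft t) Q x := by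
    intro i
    rw [altSum, Finset.smul_sum]
    refine Finset.sum_congr rfl fun τ _ => ?_
    rw [(insertNth_castAdd h h' i t _).1, (insertNth_castAdd h h' i t _).2,
      AlternatingMap.map_insertNth, AlternatingMap.curryLeft_apply_apply, map_zsmul,
      LinearMap.smul_apply, smul_comm, Units.smul_def ((-1 : ℤˣ) ^ _)]
    simp only [Units.val_pow_eq_pow_val, Units.val_neg, Units.val_one, smul_smul, ← mul_pow]
    simp
  rw [Finset.sum_congr rfl fun i _ => key i]
  simp

theorem sum_insert_right (B : M₁ →ₗ[R] M₂ →ₗ[R] R) {p q n : ℕ} (h : p + (q + 1) = n + 1)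
    (h' : p + q = n)
    (P : T [⋀^Fin p]→ₗ[R] M₁) (Q : T [⋀^Fin (q + 1)]→ₗ[R] M₂) (t : T) (x : Fin n → T) :
    (∑ i : Fin (q + 1), (-1 : ℤˣ) ^ (p + i : ℕ) • ∑ τ : Equiv.Perm (Fin n), Equiv.Perm.sign τ •
        B (P fun j => (Fin.cast h (Fin.natAdd p i)).insertNth (α := fun _ => T) t
            (fun k => x (τ k)) (Fin.cast h (Fin.castAdd (q + 1) j)))
          (Q fun j => (Fin.cast h (Fin.natAdd p i)).insertNth (α := fun _ => T) t
            (fun k => x (τ k)) (Fin.cast h (Fin.natAdd p j)))) =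
      (q + 1) • ((-1 : ℤˣ) ^ p • altSum B h' P (Q.curryLeft t) x) := by
  have key : ∀ i : Fin (q + 1), ((-1 : ℤˣ) ^ (p + i : ℕ) • ∑ τ : Equiv.Perm (Fin n),
      Equiv.Perm.sign τ •
        B (P fun j => (Fin.cast h (Fin.natAdd p i)).insertNth (α := fun _ => T) t
            (fun k => x (τ k)) (Fin.cast h (Fin.castAdd (q + 1) j)))
          (Q fun j => (Fin.cast h (Fin.natAdd p i)).insertNth (α := fun _ => T) t
            (fun k => x (τ k)) (Fin.cast h (Fin.natAdd p j)))) =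
      (-1 : ℤˣ) ^ p • altSum B h' P (Q.curryLeft t) x := by
    intro i
    rw [altSum, Finset.smul_sum, Finset.smul_sum]
    refine Finset.sum_congr rfl fun τ _ => ?_
    rw [(insertNth_natAdd h h' i t _).1, (insertNth_natAdd h h' i t _).2,
      AlternatingMap.map_insertNth, AlternatingMap.curryLeft_apply_apply, map_zsmul,
      pow_add, mul_smul, smul_comm ((-1 : ℤˣ) ^ (i : ℕ)), Units.smul_def ((-1 : ℤˣ) ^ (i : ℕ))]
    simp only [Units.val_pow_eq_pow_val, Units.val_neg, Units.val_one, smul_smul, ← mul_pow]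
    simp
  rw [Finset.sum_congr rfl fun i _ => key i]
  simp

end Product

end Algebroid

namespace Algebroid

section Graded

variable {R T : Type*} [CommRing R] [Algebra ℝ R] [AddCommGroup T] [Module R T]

instance multiAddCommGroup : AddCommGroup (Multi R T) := inferInstance

instance multiModule : Module R (Multi R T) := inferInstance

instance multiRealModule : Module ℝ (Multi R T) := inferInstance

theorem hom_eq_lof {p : ℕ} (P : Alt R T p) : hom p P = DirectSum.lof R ℕ (Alt R T) p P := rfl

theorem hom_add {p : ℕ} (P Q : Alt R T p) : hom p (P + Q) = hom p P + hom p Q :=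
  map_add (DirectSum.lof R ℕ (Alt R T) p) P Q

theorem hom_smul {p : ℕ} (f : R) (P : Alt R T p) : hom p (f • P) = f • hom p P :=
  map_smul (DirectSum.lof R ℕ (Alt R T) p) f P

theorem nsmul_cancel {k : ℕ} (hk : k ≠ 0) {a b : R} (h : k • a = k • b) : a = b := by
  have hk' : (k : ℝ) ≠ 0 := by exact_mod_cast hk
  have h2 : (k : ℝ) • a = (k : ℝ) • b := by simpa only [Nat.cast_smul_eq_nsmul] using h
  simpa [smul_smul, inv_mul_cancel₀ hk'] using congrArg (fun x => (k : ℝ)⁻¹ • x) h2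

theorem hom_congr {m n : ℕ} (h : m = n) {P : Alt R T m} {Q : Alt R T n}
    (hPQ : ∀ v : Fin n → T, P (fun i => v (Fin.cast h i)) = Q v) : hom m P = hom n Q := by
  subst h
  congr 1
  ext v
  exact hPQ v

@[simp]
theorem contract_hom_zero (t : T) (P : Alt R T 0) : contract t (hom 0 P) = 0 := by
  rw [contract, hom_eq_lof, DirectSum.toModule_lof]
  rfl

@[simp]
theorem contract_hom_succ (t : T) {p : ℕ} (P : Alt R T (p + 1)) :
    contract t (hom (p + 1) P) = hom p (P.curryLeft t) := by
  rw [contract, hom_eq_lof, DirectSum.toModule_lof]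
  rfl

@[simp]
theorem wedge_hom {p q : ℕ} (P : Alt R T p) (Q : Alt R T q) :
    wedge (hom p P) (hom q Q) = hom (p + q) (altWedge p q P Q) := by
  rw [wedge, hom_eq_lof, hom_eq_lof, DirectSum.toModule_lof,
    LinearMap.flip_apply, DirectSum.toModule_lof]
  rfl

/-! ### Components of degree `0` and `1` -/

/-- The component of degree `0` of a multisection. -/
def scalarPart : Multi R T →ₗ[R] R where
  toFun P := P 0 0
  map_add' _ _ := rfl
  map_smul' _ _ := rfl

@[simp]
theorem scalarPart_hom_zero (P : Alt R T 0) : scalarPart (hom 0 P) = P 0 := by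
  simp [scalarPart]

@[simp]
theorem scalarPart_hom_succ {p : ℕ} (P : Alt R T (p + 1)) : scalarPart (hom (p + 1) P) = 0 := by
  simp [scalarPart, DirectSum.of_eq_of_ne]

theorem contract_add_left (s t : T) (P : Multi R T) :
    contract (s + t) P = contract s P + contract t P := by
  induction P using DirectSum.induction_on with
  | zero => simp
  | of p P =>
    cases p with
    | zero => simp
    | succ p => rw [contract_hom_succ, contract_hom_succ, contract_hom_succ, map_add, hom_add]
  | add P Q hP hQ => simp only [map_add, hP, hQ]; abel

theorem contract_smul_left (f : R) (t : T) (P : Multi R T) :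
    contract (f • t) P = f • contract t P := by
  induction P using DirectSum.induction_on with
  | zero => simp
  | of p P =>
    cases p with
    | zero => simp
    | succ p =>
      rw [contract_hom_succ, contract_hom_succ, map_smul, hom_smul]
  | add P Q hP hQ => simp only [map_add, hP, hQ, smul_add]

/-- Contraction, as a linear map in both arguments. -/
def contractₗ : T →ₗ[R] Multi R T →ₗ[R] Multi R T where
  toFun := contract
  map_add' s t := LinearMap.ext (contract_add_left s t)
  map_smul' f t := LinearMap.ext (contract_smul_left f t)

@[simp]
theorem contractₗ_apply (t : T) (P : Multi R T) : contractₗ t P = contract t P := rfl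

theorem contract_neg_left (t : T) (P : Multi R T) : contract (-t) P = -contract t P := by
  simp only [← contractₗ_apply, map_neg, LinearMap.neg_apply]

theorem contract_sub_left (s t : T) (P : Multi R T) :
    contract (s - t) P = contract s P - contract t P := by
  simp only [← contractₗ_apply, map_sub, LinearMap.sub_apply]

/-- The component of degree `1` of a multisection. -/
def linearPart : Multi R T →ₗ[R] Module.Dual R T :=
  (contractₗ.flip).compr₂ scalarPart

theorem linearPart_apply (P : Multi R T) (t : T) :
    linearPart P t = scalarPart (contract t P) := rfl

theorem contract_contract_self (t : T) (P : Multi R T) : contract t (contract t P) = 0 := by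
  induction P using DirectSum.induction_on with
  | zero => simp
  | of p P =>
    cases p with
    | zero => simp
    | succ p =>
      cases p with
      | zero => simp
      | succ p => simp
  | add P Q hP hQ => simp only [map_add, hP, hQ, add_zero]

theorem contract_contract_swap (s t : T) (P : Multi R T) :
    contract s (contract t P) = -contract t (contract s P) := by
  have h := contract_contract_self (s + t) P
  simp only [contract_add_left, map_add, contract_contract_self, zero_add, add_zero] at h
  exact eq_neg_of_add_eq_zero_right h

theorem eq_zero_of_contract {P : Multi R T} (h0 : scalarPart P = 0)
    (h : ∀ t, contract t P = 0) : P = 0 := by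
  have key : ∀ (t : T) (Q : Multi R T) (p : ℕ), contract t Q p = (Q (p + 1)).curryLeft t := by
    intro t Q p
    induction Q using DirectSum.induction_on with
    | zero => simp
    | of q Q =>
      cases q with
      | zero =>
        rw [contract_hom_zero, DirectSum.of_eq_of_ne _ _ _ (by simp)]
        simp
      | succ q =>
        rw [contract_hom_succ]
        by_cases hpq : p = q
        · subst hpq; simp
        · rw [DirectSum.of_eq_of_ne _ _ _ hpq, DirectSum.of_eq_of_ne _ _ _ (by omega)]
          simp
    | add P Q hP hQ => simp only [map_add, DirectSum.add_apply, hP, hQ]; rfl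
  refine DFinsupp.ext fun p => ?_
  cases p with
  | zero =>
    ext v
    rw [Subsingleton.elim v 0]
    exact h0
  | succ p =>
    ext v
    have h1 := key (v 0) P p
    rw [h (v 0)] at h1
    have h2 := congrArg (fun A => A (Fin.tail v)) h1
    have h3 : Matrix.vecCons (v 0) (Fin.tail v) = v := Fin.cons_self_tail v
    simp only [AlternatingMap.curryLeft_apply_apply, h3] at h2
    exact h2.symm

theorem ext_contract {P Q : Multi R T} (h0 : scalarPart P = scalarPart Q)
    (h : ∀ t, contract t P = contract t Q) : P = Q := by
  rw [← sub_eq_zero]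
  refine eq_zero_of_contract ?_ fun t => ?_
  · rw [map_sub, h0, sub_self]
  · rw [map_sub, h t, sub_self]

/-! ### The grade involution and the degree operator -/

/-- The grade involution `P ↦ (-1)^p P`. -/
def invol : Multi R T →ₗ[R] Multi R T :=
  DirectSum.toModule R ℕ _ fun p => (-1 : R) ^ p • DirectSum.lof R ℕ (Alt R T) p

/-- The degree operator `P ↦ p P`. -/
def degOp : Multi R T →ₗ[R] Multi R T :=
  DirectSum.toModule R ℕ _ fun p => (p : R) • DirectSum.lof R ℕ (Alt R T) p

theorem neg_one_pow_smul (p : ℕ) (P : Multi R T) : (-1 : R) ^ p • P = (-1 : ℝ) ^ p • P := by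
  rcases neg_one_pow_eq_or ℝ p with h | h
  · have h' : (-1 : R) ^ p = 1 := by
      have := congrArg (algebraMap ℝ R) h
      simpa using this
    rw [h, h', one_smul, one_smul]
  · have h' : (-1 : R) ^ p = -1 := by
      have := congrArg (algebraMap ℝ R) h
      simpa using this
    rw [h, h', neg_smul, neg_smul, one_smul, one_smul]

theorem invol_hom {p : ℕ} (P : Alt R T p) : invol (hom p P) = (-1 : ℝ) ^ p • hom p P := by
  rw [invol, hom_eq_lof, DirectSum.toModule_lof, LinearMap.smul_apply,
    neg_one_pow_smul]

theorem degOp_hom {p : ℕ} (P : Alt R T p) : degOp (hom p P) = (p : ℝ) • hom p P := by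
  rw [degOp, hom_eq_lof, DirectSum.toModule_lof, LinearMap.smul_apply,
    Nat.cast_smul_eq_nsmul, Nat.cast_smul_eq_nsmul]

theorem invol_hom_eq_or {p : ℕ} (P : Alt R T p) :
    invol (hom p P) = hom p P ∨ invol (hom p P) = -hom p P := by
  rw [invol_hom]
  rcases neg_one_pow_eq_or ℝ p with h | h <;> rw [h]
  · left; rw [one_smul]
  · right; rw [neg_smul, one_smul]

theorem contract_real_smul (c : ℝ) (t : T) (P : Multi R T) :
    contract t (c • P) = c • contract t P := (contract t).map_smul_of_tower c P

@[simp]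
theorem contract_invol (t : T) (P : Multi R T) : contract t (invol P) = -invol (contract t P) := by
  induction P using DirectSum.induction_on with
  | zero => simp
  | of p P =>
    cases p with
    | zero => rw [invol_hom, contract_real_smul, contract_hom_zero]; simp
    | succ p =>
      rw [invol_hom, contract_real_smul, contract_hom_succ, invol_hom, pow_succ]
      simp
  | add P Q hP hQ => simp only [map_add, hP, hQ]; abel

@[simp]
theorem invol_invol (P : Multi R T) : invol (invol P) = P := by
  induction P using DirectSum.induction_on with
  | zero => simp
  | of p P =>
    rcases invol_hom_eq_or P with h | h
    · change invol (invol (hom p P)) = hom p P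
      rw [h, h]
    · change invol (invol (hom p P)) = hom p P
      rw [h, map_neg, h, neg_neg]
  | add P Q hP hQ => simp only [map_add, hP, hQ]

@[simp]
theorem scalarPart_invol (P : Multi R T) : scalarPart (invol P) = scalarPart P := by
  induction P using DirectSum.induction_on with
  | zero => simp
  | of p P =>
    cases p with
    | zero => rw [invol_hom]; simp
    | succ p =>
      rw [invol_hom, LinearMap.map_smul_of_tower, scalarPart_hom_succ]; simp
  | add P Q hP hQ => simp only [map_add, hP, hQ]

@[simp]
theorem linearPart_invol (P : Multi R T) : linearPart (invol P) = -linearPart P := by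
  ext t
  simp [linearPart_apply]

/-! ### Induction by contraction -/

theorem eq_zero_of_contract₁ (Δ : Multi R T → Multi R T)
    (hadd : ∀ P P', Δ (P + P') = Δ P + Δ P')
    (h0 : ∀ P, scalarPart (Δ P) = 0)
    (h : ∀ t P, Δ (contract t P) = 0 → contract t (Δ P) = 0) (P : Multi R T) : Δ P = 0 := by
  have hz : Δ 0 = 0 := by simpa [left_eq_add] using hadd 0 0
  have key : ∀ (p : ℕ) (P : Alt R T p), Δ (hom p P) = 0 := by
    intro p
    induction p with
    | zero =>
      intro P
      exact eq_zero_of_contract (h0 _) fun t => h t _ (by rw [contract_hom_zero, hz])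
    | succ p ih =>
      intro P
      exact eq_zero_of_contract (h0 _) fun t => h t _ (by rw [contract_hom_succ, ih])
  induction P using DirectSum.induction_on with
  | zero => exact hz
  | of p P => exact key p P
  | add P Q hP hQ => rw [hadd, hP, hQ, add_zero]

theorem eq_zero_of_contract₃ (Δ : Multi R T → Multi R T → Multi R T → Multi R T)
    (hadd₁ : ∀ P P' Q U, Δ (P + P') Q U = Δ P Q U + Δ P' Q U)
    (hadd₂ : ∀ P Q Q' U, Δ P (Q + Q') U = Δ P Q U + Δ P Q' U)
    (hadd₃ : ∀ P Q U U', Δ P Q (U + U') = Δ P Q U + Δ P Q U')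
    (h0 : ∀ P Q U, scalarPart (Δ P Q U) = 0)
    (h : ∀ t P Q U, Δ (contract t P) Q U = 0 → Δ (invol P) (contract t Q) U = 0 →
      Δ (invol P) (invol Q) (contract t U) = 0 → contract t (Δ P Q U) = 0)
    (P Q U : Multi R T) : Δ P Q U = 0 := by
  have hz₁ : ∀ Q U, Δ 0 Q U = 0 := fun Q U => by simpa [left_eq_add] using hadd₁ 0 0 Q U
  have hz₂ : ∀ P U, Δ P 0 U = 0 := fun P U => by simpa [left_eq_add] using hadd₂ P 0 0 U
  have hz₃ : ∀ P Q, Δ P Q 0 = 0 := fun P Q => by simpa [left_eq_add] using hadd₃ P Q 0 0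
  have hn₁ : ∀ P Q U, Δ (-P) Q U = -Δ P Q U := fun P Q U =>
    eq_neg_of_add_eq_zero_left (by rw [← hadd₁, neg_add_cancel, hz₁])
  have hn₂ : ∀ P Q U, Δ P (-Q) U = -Δ P Q U := fun P Q U =>
    eq_neg_of_add_eq_zero_left (by rw [← hadd₂, neg_add_cancel, hz₂])
  have hi₁ : ∀ (p : ℕ) (P : Alt R T p) Q U, Δ (hom p P) Q U = 0 → Δ (invol (hom p P)) Q U = 0 := by
    intro p P Q U hP
    rcases invol_hom_eq_or P with h | h <;> simp [h, hn₁, hP]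
  have hi₂ : ∀ P (q : ℕ) (Q : Alt R T q) U, Δ P (hom q Q) U = 0 → Δ P (invol (hom q Q)) U = 0 := by
    intro P q Q U hP
    rcases invol_hom_eq_or Q with h | h <;> simp [h, hn₂, hP]
  have key : ∀ (n p q r : ℕ) (P : Alt R T p) (Q : Alt R T q) (U : Alt R T r), p + q + r ≤ n →
      Δ (hom p P) (hom q Q) (hom r U) = 0 := by
    intro n
    induction n with
    | zero =>
      intro p q r P Q U hn
      obtain rfl : p = 0 := by omega
      obtain rfl : q = 0 := by omega
      obtain rfl : r = 0 := by omega
      exact eq_zero_of_contract (h0 _ _ _) fun t => h t _ _ _ (by rw [contract_hom_zero, hz₁])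
        (by rw [contract_hom_zero, hz₂]) (by rw [contract_hom_zero, hz₃])
    | succ n ih =>
      intro p q r P Q U hn
      refine eq_zero_of_contract (h0 _ _ _) fun t => h t _ _ _ ?_ (hi₁ _ _ _ _ ?_)
        (hi₁ _ _ _ _ (hi₂ _ _ _ _ ?_))
      · cases p with
        | zero => rw [contract_hom_zero, hz₁]
        | succ p => rw [contract_hom_succ]; exact ih _ _ _ _ _ _ (by omega)
      · cases q with
        | zero => rw [contract_hom_zero, hz₂]
        | succ p => rw [contract_hom_succ]; exact ih _ _ _ _ _ _ (by omega)
      · cases r with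
        | zero => rw [contract_hom_zero, hz₃]
        | succ p => rw [contract_hom_succ]; exact ih _ _ _ _ _ _ (by omega)
  induction P using DirectSum.induction_on with
  | zero => exact hz₁ _ _
  | add P P' hP hP' => rw [hadd₁, hP, hP', add_zero]
  | of p P =>
    induction Q using DirectSum.induction_on with
    | zero => exact hz₂ _ _
    | add P P' hP hP' => rw [hadd₂, hP, hP', add_zero]
    | of q Q =>
      induction U using DirectSum.induction_on with
      | zero => exact hz₃ _ _
      | add P P' hP hP' => rw [hadd₃, hP, hP', add_zero]
      | of r U => exact key _ _ _ _ P Q U le_rfl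

theorem eq_zero_of_contract₂ (Δ : Multi R T → Multi R T → Multi R T)
    (hadd₁ : ∀ P P' Q, Δ (P + P') Q = Δ P Q + Δ P' Q)
    (hadd₂ : ∀ P Q Q', Δ P (Q + Q') = Δ P Q + Δ P Q')
    (h0 : ∀ P Q, scalarPart (Δ P Q) = 0)
    (h : ∀ t P Q, Δ (contract t P) Q = 0 → Δ (invol P) (contract t Q) = 0 →
      contract t (Δ P Q) = 0)
    (P Q : Multi R T) : Δ P Q = 0 := by
  have hz₁ : ∀ Q, Δ 0 Q = 0 := fun Q => by simpa [left_eq_add] using hadd₁ 0 0 Q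
  have hz₂ : ∀ P, Δ P 0 = 0 := fun P => by simpa [left_eq_add] using hadd₂ P 0 0
  have hn₁ : ∀ P Q, Δ (-P) Q = -Δ P Q := fun P Q =>
    eq_neg_of_add_eq_zero_left (by rw [← hadd₁, neg_add_cancel, hz₁])
  have hi₁ : ∀ (p : ℕ) (P : Alt R T p) Q, Δ (hom p P) Q = 0 → Δ (invol (hom p P)) Q = 0 := by
    intro p P Q hP
    rcases invol_hom_eq_or P with h | h <;> simp [h, hn₁, hP]
  have key : ∀ (n p q : ℕ) (P : Alt R T p) (Q : Alt R T q), p + q ≤ n →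
      Δ (hom p P) (hom q Q) = 0 := by
    intro n
    induction n with
    | zero =>
      intro p q P Q hn
      obtain rfl : p = 0 := by omega
      obtain rfl : q = 0 := by omega
      exact eq_zero_of_contract (h0 _ _) fun t => h t _ _ (by rw [contract_hom_zero, hz₁])
        (by rw [contract_hom_zero, hz₂])
    | succ n ih =>
      intro p q P Q hn
      refine eq_zero_of_contract (h0 _ _) fun t => h t _ _ ?_ (hi₁ _ _ _ ?_)
      · cases p with
        | zero => rw [contract_hom_zero, hz₁]
        | succ p => rw [contract_hom_succ]; exact ih _ _ _ _ (by omega)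
      · cases q with
        | zero => rw [contract_hom_zero, hz₂]
        | succ p => rw [contract_hom_succ]; exact ih _ _ _ _ (by omega)
  induction P using DirectSum.induction_on with
  | zero => exact hz₁ _
  | add P P' hP hP' => rw [hadd₁, hP, hP', add_zero]
  | of p P =>
    induction Q using DirectSum.induction_on with
    | zero => exact hz₂ _
    | add P P' hP hP' => rw [hadd₂, hP, hP', add_zero]
    | of q Q => exact key _ _ _ P Q le_rfl

/-! ### Contraction of products -/

section Product

variable {M₁ M₂ : Type*} [AddCommGroup M₁] [Module R M₁] [AddCommGroup M₂] [Module R M₂]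
  (B : M₁ →ₗ[R] M₂ →ₗ[R] R)

theorem altProd_zero_zero (P : T [⋀^Fin 0]→ₗ[R] M₁) (Q : T [⋀^Fin 0]→ₗ[R] M₂) (v : Fin 0 → T) :
    altProd B 0 0 P Q v = B (P 0) (Q 0) := by
  have h := factorial_smul_altProd B (Nat.zero_add 0) P Q v
  rw [altSum] at h
  simp only [Nat.factorial, mul_one, one_smul, Finset.univ_unique, Finset.sum_singleton,
    Equiv.Perm.default_eq, Equiv.Perm.sign_one] at h
  rw [Subsingleton.elim v (fun i => v (Fin.cast (Nat.zero_add 0) i)), h]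
  congr 1
  · congr 2; exact Subsingleton.elim _ _
  · congr 1; exact Subsingleton.elim _ _

theorem contract_altProd_succ_succ {p q : ℕ} (t : T) (P : T [⋀^Fin (p + 1)]→ₗ[R] M₁)
    (Q : T [⋀^Fin (q + 1)]→ₗ[R] M₂) :
    contract t (hom (p + 1 + (q + 1)) (altProd B _ _ P Q)) =
      hom (p + (q + 1)) (altProd B _ _ (P.curryLeft t) Q) +
        (-1 : ℝ) ^ (p + 1) • hom (p + 1 + q) (altProd B _ _ P (Q.curryLeft t)) := by
  have hn : p + 1 + q = p + (q + 1) := by omega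
  rw [show contract t (hom (p + 1 + (q + 1)) (altProd B _ _ P Q)) =
    hom (p + 1 + q) (AlternatingMap.curryLeft (n := p + 1 + q) (altProd B _ _ P Q) t) from
      contract_hom_succ t _]
  have e1 : hom (p + (q + 1)) (altProd B _ _ (P.curryLeft t) Q) = hom (p + 1 + q)
      ((altProd B _ _ (P.curryLeft t) Q).domDomCongr (finCongr hn.symm)) :=
    hom_congr hn.symm fun v => rfl
  rw [e1, ← neg_one_pow_smul, ← hom_smul, ← hom_add]
  congr 1
  ext x
  refine nsmul_cancel (k := (p + 1).factorial * (q + 1).factorial) (by positivity) ?_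
  rw [AlternatingMap.curryLeft_apply_apply]
  have a1 := factorial_smul_altProd B (n := p + 1 + (q + 1)) rfl P Q (Matrix.vecCons t x)
  have a2 := factorial_smul_altProd B (n := p + 1 + q) hn.symm (P.curryLeft t) Q x
  have a3 := factorial_smul_altProd B (n := p + 1 + q) rfl P (Q.curryLeft t) x
  have a4 := (altSum_cons B (p := p + 1) (q := q + 1) (n := p + 1 + q) rfl P Q t x).trans
    (congrArg₂ (· + ·) (sum_insert_left B (p := p) (q := q + 1) rfl hn.symm P Q t x)
      (sum_insert_right B (p := p + 1) (q := q) rfl rfl P Q t x))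
  rw [a4, ← a2, ← a3] at a1
  refine a1.trans ?_
  simp only [AlternatingMap.add_apply, AlternatingMap.smul_apply, AlternatingMap.domDomCongr_apply,
    Nat.factorial_succ, nsmul_eq_mul, Units.smul_def, zsmul_eq_mul, smul_eq_mul]
  push_cast
  have e2 : (altProd B p (q + 1) (P.curryLeft t) Q) (x ∘ (finCongr hn.symm)) =
    (altProd B p (q + 1) (P.curryLeft t) Q) (fun i => x (Fin.cast hn.symm i)) := rfl
  simp only [Fin.cast_eq_self]
  rw [e2]
  ring

theorem contract_altProd_succ_zero {p : ℕ} (t : T) (P : T [⋀^Fin (p + 1)]→ₗ[R] M₁)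
    (Q : T [⋀^Fin 0]→ₗ[R] M₂) :
    contract t (hom (p + 1 + 0) (altProd B _ _ P Q)) =
      hom (p + 0) (altProd B _ _ (P.curryLeft t) Q) := by
  rw [show contract t (hom (p + 1 + 0) (altProd B _ _ P Q)) =
    hom p (AlternatingMap.curryLeft (n := p) (altProd B _ _ P Q) t) from contract_hom_succ t _]
  congr 1
  ext x
  refine nsmul_cancel (k := (p + 1).factorial * (0).factorial) (by positivity) ?_
  rw [AlternatingMap.curryLeft_apply_apply]
  have a1 := factorial_smul_altProd B (p := p + 1) (q := 0) (n := p + 1) rfl P Q (Matrix.vecCons t x)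
  have a2 := factorial_smul_altProd B (p := p) (q := 0) (n := p) rfl (P.curryLeft t) Q x
  have a4 := (altSum_cons B (p := p + 1) (q := 0) (n := p) rfl P Q t x).trans
    (congrArg₂ (· + ·) (sum_insert_left B (p := p) (q := 0) rfl rfl P Q t x) (Fin.sum_univ_zero _))
  simp only [add_zero] at a4
  rw [a4, ← a2] at a1
  refine a1.trans ?_
  simp only [Nat.factorial_succ, nsmul_eq_mul]
  push_cast
  simp only [Fin.cast_eq_self, mul_assoc]

theorem contract_altProd_zero_succ {q : ℕ} (t : T) (P : T [⋀^Fin 0]→ₗ[R] M₁)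
    (Q : T [⋀^Fin (q + 1)]→ₗ[R] M₂) :
    contract t (hom (0 + (q + 1)) (altProd B _ _ P Q)) =
      hom (0 + q) (altProd B _ _ P (Q.curryLeft t)) := by
  rw [show contract t (hom (0 + (q + 1)) (altProd B _ _ P Q)) =
    hom (0 + q) (AlternatingMap.curryLeft (n := 0 + q) (altProd B _ _ P Q) t) from
      contract_hom_succ t _]
  congr 1
  ext x
  refine nsmul_cancel (k := (0).factorial * (q + 1).factorial) (by positivity) ?_
  rw [AlternatingMap.curryLeft_apply_apply]
  have a1 := factorial_smul_altProd B (p := 0) (q := q + 1) (n := 0 + (q + 1)) rfl P Q (Matrix.vecCons t x)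
  have a2 := factorial_smul_altProd B (n := 0 + q) rfl P (Q.curryLeft t) x
  have a4 := (altSum_cons B (p := 0) (q := q + 1) (n := 0 + q) rfl P Q t x).trans
    (congrArg₂ (· + ·) (Fin.sum_univ_zero _) (sum_insert_right B (p := 0) (q := q) rfl rfl P Q t x))
  simp only [zero_add (M := R)] at a4
  rw [a4, ← a2] at a1
  refine a1.trans ?_
  simp only [Nat.factorial_succ, nsmul_eq_mul, pow_zero, one_smul]
  push_cast
  simp only [Fin.cast_eq_self]
  ring

end Product

end Graded

end Algebroid

namespace Algebroid

section Graded

variable {R T : Type*} [CommRing R] [Algebra ℝ R] [AddCommGroup T] [Module R T]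

theorem wedge_real_smul_left (c : ℝ) (P Q : Multi R T) : wedge (c • P) Q = c • wedge P Q := by
  rw [LinearMap.map_smul_of_tower, LinearMap.smul_apply]

theorem wedge_real_smul_right (c : ℝ) (P Q : Multi R T) : wedge P (c • Q) = c • wedge P Q :=
  (wedge P).map_smul_of_tower c Q

/-! ### The wedge product -/

theorem contract_wedge (t : T) (P Q : Multi R T) :
    contract t (wedge P Q) = wedge (contract t P) Q + wedge (invol P) (contract t Q) := by
  induction P using DirectSum.induction_on with
  | zero => simp
  | add P P' hP hP' => simp only [map_add, LinearMap.add_apply, hP, hP']; abel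
  | of p P =>
    induction Q using DirectSum.induction_on with
    | zero => simp
    | add Q Q' hQ hQ' => simp only [map_add, hQ, hQ']; abel
    | of q Q =>
      change contract t (wedge (hom p P) (hom q Q)) = wedge (contract t (hom p P)) (hom q Q) +
        wedge (invol (hom p P)) (contract t (hom q Q))
      rw [invol_hom, wedge_real_smul_left, wedge_hom, altWedge_eq_altProd]
      cases p with
      | zero =>
        cases q with
        | zero =>
          rw [contract_hom_zero t P, contract_hom_zero t Q, map_zero, map_zero, LinearMap.zero_apply,
            smul_zero, add_zero (0 : Multi R T)]
          exact contract_hom_zero t _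
        | succ q =>
          rw [contract_altProd_zero_succ, contract_hom_zero, contract_hom_succ, wedge_hom,
            altWedge_eq_altProd]
          simp
      | succ p =>
        cases q with
        | zero =>
          rw [contract_altProd_succ_zero, contract_hom_zero, contract_hom_succ, wedge_hom,
            altWedge_eq_altProd]
          simp
        | succ q =>
          rw [contract_altProd_succ_succ, contract_hom_succ, contract_hom_succ, wedge_hom,
            wedge_hom, altWedge_eq_altProd, altWedge_eq_altProd]

@[simp]
theorem scalarPart_wedge (P Q : Multi R T) :
    scalarPart (wedge P Q) = scalarPart P * scalarPart Q := by
  induction P using DirectSum.induction_on with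
  | zero => simp
  | add P P' hP hP' => simp only [map_add, LinearMap.add_apply, hP, hP']; ring
  | of p P =>
    induction Q using DirectSum.induction_on with
    | zero => simp
    | add Q Q' hQ hQ' => simp only [map_add, hQ, hQ']; ring
    | of q Q =>
      change scalarPart (wedge (hom p P) (hom q Q)) =
        scalarPart (hom p P) * scalarPart (hom q Q)
      rw [wedge_hom, altWedge_eq_altProd]
      cases q with
      | succ q =>
        rw [scalarPart_hom_succ Q, mul_zero]
        exact scalarPart_hom_succ (p := p + q) _
      | zero =>
        cases p with
        | zero =>
          rw [scalarPart_hom_zero P, scalarPart_hom_zero Q]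
          exact (scalarPart_hom_zero _).trans (altProd_zero_zero _ P Q 0)
        | succ p =>
          rw [scalarPart_hom_succ P, zero_mul]
          exact scalarPart_hom_succ (p := p) _

@[simp]
theorem linearPart_wedge (P Q : Multi R T) :
    linearPart (wedge P Q) = scalarPart P • linearPart Q + scalarPart Q • linearPart P := by
  ext t
  simp [linearPart_apply, contract_wedge]
  ring

@[simp]
theorem scalarPart_fn (f : R) : scalarPart (fn f : Multi R T) = f := scalarPart_hom_zero _

@[simp]
theorem contract_fn (t : T) (f : R) : contract t (fn f) = 0 := contract_hom_zero _ _

@[simp]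
theorem invol_fn (f : R) : invol (fn f : Multi R T) = fn f := by
  rw [fn, invol_hom, pow_zero, one_smul]

@[simp]
theorem scalarPart_one (a : Module.Dual R T) : scalarPart (one a) = 0 := scalarPart_hom_succ _

@[simp]
theorem invol_one (a : Module.Dual R T) : invol (one a) = -one a := by
  rw [one, invol_hom, pow_one, neg_smul, one_smul]

@[simp]
theorem contract_one (t : T) (a : Module.Dual R T) : contract t (one a) = fn (a t) := by
  rw [one, contract_hom_succ, fn]
  congr 1

@[simp]
theorem linearPart_one (a : Module.Dual R T) : linearPart (one a) = a := by
  ext t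
  simp [linearPart_apply]

theorem fn_add (f g : R) : (fn (f + g) : Multi R T) = fn f + fn g :=
  ext_contract (by simp) (by simp)

theorem fn_smul (f g : R) : (fn (f * g) : Multi R T) = f • fn g :=
  ext_contract (by simp) (by simp)

theorem fn_sub (f g : R) : (fn (f - g) : Multi R T) = fn f - fn g :=
  ext_contract (by simp) (by simp)

theorem fn_neg (f : R) : (fn (-f) : Multi R T) = -fn f :=
  ext_contract (by simp) (by simp)

@[simp]
theorem fn_zero : (fn 0 : Multi R T) = 0 :=
  ext_contract (by simp) (by simp)

theorem one_add (a b : Module.Dual R T) : one (a + b) = one a + one b :=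
  ext_contract (by simp) (by simp [fn_add])

theorem one_sub (a b : Module.Dual R T) : one (a - b) = one a - one b :=
  ext_contract (by simp) (by simp [fn_sub])

theorem one_neg (a : Module.Dual R T) : one (-a) = -one a :=
  ext_contract (by simp) (by simp [fn_neg])

theorem one_smul' (f : R) (a : Module.Dual R T) : one (f • a) = f • one a :=
  ext_contract (by simp) (by simp [fn_smul])

@[simp]
theorem one_zero : one (0 : Module.Dual R T) = 0 :=
  ext_contract (by simp) (by simp)

theorem fn_wedge (f : R) (P : Multi R T) : wedge (fn f) P = f • P := by
  rw [← sub_eq_zero]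
  refine eq_zero_of_contract₁ (fun P => wedge (fn f) P - f • P) ?_ ?_ ?_ P
  · intro P P'; simp only [map_add, smul_add]; abel
  · intro P; simp
  · intro t P h
    simpa [contract_wedge] using h

theorem wedge_fn (f : R) (P : Multi R T) : wedge P (fn f) = f • P := by
  rw [← sub_eq_zero]
  refine eq_zero_of_contract₁ (fun P => wedge P (fn f) - f • P) ?_ ?_ ?_ P
  · intro P P'; simp only [map_add, smul_add, LinearMap.add_apply]; abel
  · intro P; simp [mul_comm]
  · intro t P h
    simpa [contract_wedge] using h

theorem invol_wedge (P Q : Multi R T) : invol (wedge P Q) = wedge (invol P) (invol Q) := by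
  rw [← sub_eq_zero]
  refine eq_zero_of_contract₂ (fun P Q => invol (wedge P Q) - wedge (invol P) (invol Q))
    ?_ ?_ ?_ ?_ P Q
  · intro P P' Q; simp only [map_add, LinearMap.add_apply]; abel
  · intro P Q Q'; simp only [map_add]; abel
  · intro P Q; simp
  · intro t P Q h1 h2
    simp only [invol_invol] at h2
    simp only [map_sub, contract_invol, contract_wedge, map_neg, LinearMap.neg_apply, invol_invol,
      map_add]
    linear_combination (norm := module) -h1 - h2

theorem wedge_assoc (P Q U : Multi R T) : wedge (wedge P Q) U = wedge P (wedge Q U) := by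
  rw [← sub_eq_zero]
  refine eq_zero_of_contract₃ (fun P Q U => wedge (wedge P Q) U - wedge P (wedge Q U))
    ?_ ?_ ?_ ?_ ?_ P Q U
  · intro P P' Q U; simp only [map_add, LinearMap.add_apply]; abel
  · intro P Q Q' U; simp only [map_add, LinearMap.add_apply]; abel
  · intro P Q U U'; simp only [map_add]; abel
  · intro P Q U; simp [mul_assoc]
  · intro t P Q U h1 h2 h3
    simp only [map_sub, contract_wedge, invol_wedge, map_add, LinearMap.add_apply]
    linear_combination (norm := module) h1 + h2 + h3

/-- Graded commutativity of the wedge product. -/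
theorem two_wedge_comm (P Q : Multi R T) :
    (2 : ℝ) • wedge P Q =
      wedge (Q + invol Q) P + wedge (Q - invol Q) (invol P) := by
  rw [← sub_eq_zero]
  refine eq_zero_of_contract₂ (fun P Q => (2 : ℝ) • wedge P Q -
      (wedge (Q + invol Q) P + wedge (Q - invol Q) (invol P))) ?_ ?_ ?_ ?_ P Q
  · intro P P' Q; simp only [map_add, LinearMap.add_apply, smul_add]; abel
  · intro P Q Q'; simp only [map_add, map_sub, LinearMap.add_apply, smul_add, LinearMap.sub_apply]
    abel
  · intro P Q
    simp only [map_sub, map_add, scalarPart_wedge, scalarPart_invol,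
      LinearMap.add_apply, LinearMap.sub_apply, two_smul]
    ring
  · intro t P Q h1 h2
    simp only [map_sub, map_add, contract_wedge, LinearMap.add_apply, LinearMap.sub_apply,
      contract_real_smul, contract_invol, map_neg, LinearMap.neg_apply, invol_invol] at h1 h2 ⊢
    linear_combination (norm := module) h1 + h2

theorem wedge_comm_hom {p q : ℕ} (P : Alt R T p) (Q : Alt R T q) :
    wedge (hom p P) (hom q Q) = (-1 : ℝ) ^ (p * q) • wedge (hom q Q) (hom p P) := by
  have h := two_wedge_comm (hom p P) (hom q Q)
  have h2 : ∀ x y : Multi R T, (2 : ℝ) • x = (2 : ℝ) • y → x = y := fun x y hxy => by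
    simpa [smul_smul] using congrArg (fun z => (1 / 2 : ℝ) • z) hxy
  refine h2 _ _ (h.trans ?_)
  rw [invol_hom, invol_hom, pow_mul]
  simp only [map_add, map_sub, LinearMap.add_apply, LinearMap.sub_apply, wedge_real_smul_left,
    wedge_real_smul_right]
  rcases neg_one_pow_eq_or ℝ p with h | h <;> rw [h]
  · simp only [one_pow]; module
  · module

theorem one_wedge_one_self (a : Module.Dual R T) : wedge (one a) (one a) = 0 := by
  have h := wedge_comm_hom (AlternatingMap.ofSubsingleton R T R (0 : Fin 1) a)
    (AlternatingMap.ofSubsingleton R T R (0 : Fin 1) a)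
  change wedge (one a) (one a) = (-1 : ℝ) ^ (1 * 1) • wedge (one a) (one a) at h
  have h2 : (2 : ℝ) • wedge (one a) (one a) = 0 := by
    linear_combination (norm := module) h
  simpa using h2

end Graded

end Algebroid

namespace Algebroid

section Brace

variable {R T : Type*} [CommRing R] [Algebra ℝ R] [AddCommGroup T] [Module R T]

/-- An alternating map as an alternating map with values in `T → R`, separating off the first
argument. -/
def headForm {p : ℕ} : Alt R T (p + 1) →ₗ[R] T [⋀^Fin p]→ₗ[R] Module.Dual R T where
  toFun P :=
    { toFun := fun v =>
        { toFun := fun y => P.curryLeft y v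
          map_add' := fun y z => by rw [map_add]; rfl
          map_smul' := fun c y => by rw [map_smul]; rfl }
      map_update_add' := fun v i x y => by
        ext z
        exact (P.curryLeft z).map_update_add v i x y
      map_update_smul' := fun v i c x => by
        ext z
        exact (P.curryLeft z).map_update_smul v i c x
      map_eq_zero_of_eq' := fun v i j h hij => by
        ext z
        exact (P.curryLeft z).map_eq_zero_of_eq v h hij }
  map_add' _ _ := rfl
  map_smul' _ _ := rfl

theorem headForm_apply {p : ℕ} (P : Alt R T (p + 1)) (v : Fin p → T) (y : T) :
    headForm P v y = P (Matrix.vecCons y v) := rfl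

theorem curryLeft_headForm {p : ℕ} (P : Alt R T (p + 2)) (t : T) :
    (headForm P).curryLeft t = -headForm (P.curryLeft t) := by
  ext v y
  have h := congrArg (fun A => A v) (P.curryLeft_same (t + y))
  have h1 := congrArg (fun A => A v) (P.curryLeft_same t)
  have h2 := congrArg (fun A => A v) (P.curryLeft_same y)
  simp only [map_add, AlternatingMap.curryLeft_add, LinearMap.add_apply, AlternatingMap.add_apply]
    at h h1 h2
  simp only [AlternatingMap.curryLeft_apply_apply, AlternatingMap.zero_apply] at h h1 h2
  simp only [AlternatingMap.curryLeft_apply_apply, AlternatingMap.neg_apply, LinearMap.neg_apply,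
    headForm_apply]
  linear_combination h - h1 - h2

theorem hom_neg {p : ℕ} (P : Alt R T p) : hom p (-P) = -hom p P :=
  map_neg (DirectSum.lof R ℕ (Alt R T) p) P

theorem altProd_neg_left (B : Module.Dual R T →ₗ[R] Module.Dual R T →ₗ[R] R) {p q : ℕ}
    (P : T [⋀^Fin p]→ₗ[R] Module.Dual R T) (Q : T [⋀^Fin q]→ₗ[R] Module.Dual R T) :
    altProd B p q (-P) Q = -altProd B p q P Q :=
  LinearMap.map_neg₂ (altProd B p q) P Q

theorem altProd_neg_right (B : Module.Dual R T →ₗ[R] Module.Dual R T →ₗ[R] R) {p q : ℕ}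
    (P : T [⋀^Fin p]→ₗ[R] Module.Dual R T) (Q : T [⋀^Fin q]→ₗ[R] Module.Dual R T) :
    altProd B p q P (-Q) = -altProd B p q P Q :=
  map_neg (altProd B p q P) Q

variable (B : Module.Dual R T →ₗ[R] Module.Dual R T →ₗ[R] R)

/-- The component of `brace` in degrees `p` and `q`. -/
def homBrace : (p q : ℕ) → Alt R T p →ₗ[R] Alt R T q →ₗ[R] Multi R T
  | p + 1, q + 1 => ((altProd B p q).compl₁₂ headForm headForm).compr₂
      (DirectSum.lof R ℕ (Alt R T) (p + q))
  | 0, _ => 0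
  | _ + 1, 0 => 0

/-- The extension of a bilinear form on `1`-forms to a biderivation of degree `-2` of the exterior
algebra of forms. -/
def brace : Multi R T →ₗ[R] Multi R T →ₗ[R] Multi R T :=
  DirectSum.toModule R ℕ _ fun p =>
    LinearMap.flip (DirectSum.toModule R ℕ _ fun q => LinearMap.flip (homBrace B p q))

theorem brace_hom {p q : ℕ} (P : Alt R T p) (Q : Alt R T q) :
    brace B (hom p P) (hom q Q) = homBrace B p q P Q := by
  rw [brace, hom_eq_lof, hom_eq_lof, DirectSum.toModule_lof, LinearMap.flip_apply,
    DirectSum.toModule_lof, LinearMap.flip_apply]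

theorem brace_hom_zero_left {q : ℕ} (P : Alt R T 0) (Q : Alt R T q) :
    brace B (hom 0 P) (hom q Q) = 0 := by
  rw [brace_hom, homBrace]
  rfl

theorem brace_hom_zero_right {p : ℕ} (P : Alt R T p) (Q : Alt R T 0) :
    brace B (hom p P) (hom 0 Q) = 0 := by
  rw [brace_hom]
  cases p <;> (rw [homBrace]; rfl)

theorem brace_hom_succ {p q : ℕ} (P : Alt R T (p + 1)) (Q : Alt R T (q + 1)) :
    brace B (hom (p + 1) P) (hom (q + 1) Q) =
      hom (p + q) (altProd B p q (headForm P) (headForm Q)) := by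
  rw [brace_hom, homBrace]
  rfl

theorem brace_real_smul_left (c : ℝ) (P Q : Multi R T) :
    brace B (c • P) Q = c • brace B P Q := by
  rw [LinearMap.map_smul_of_tower, LinearMap.smul_apply]

theorem brace_real_smul_right (c : ℝ) (P Q : Multi R T) :
    brace B P (c • Q) = c • brace B P Q :=
  (brace B P).map_smul_of_tower c Q

@[simp]
theorem contract_brace (t : T) (P Q : Multi R T) :
    contract t (brace B P Q) = -brace B (contract t P) Q + brace B (invol P) (contract t Q) := by
  induction P using DirectSum.induction_on with
  | zero => simp
  | add P P' hP hP' => simp only [map_add, LinearMap.add_apply, hP, hP']; abel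
  | of p P =>
    induction Q using DirectSum.induction_on with
    | zero => simp
    | add Q Q' hQ hQ' => simp only [map_add, hQ, hQ']; abel
    | of q Q =>
      change contract t (brace B (hom p P) (hom q Q)) = -brace B (contract t (hom p P)) (hom q Q) +
        brace B (invol (hom p P)) (contract t (hom q Q))
      rw [invol_hom, brace_real_smul_left]
      cases p with
      | zero =>
        rw [contract_hom_zero t P, brace_hom_zero_left]
        cases q with
        | zero => rw [contract_hom_zero t Q]; simp
        | succ q => rw [contract_hom_succ, brace_hom_zero_left]; simp
      | succ p =>
        cases q with
        | zero =>
          rw [contract_hom_succ, brace_hom_zero_right, brace_hom_zero_right, contract_hom_zero t Q]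
          simp
        | succ q =>
          rw [brace_hom_succ, contract_hom_succ, contract_hom_succ]
          cases p with
          | zero =>
            cases q with
            | zero =>
              rw [brace_hom_zero_left, brace_hom_zero_right]
              simp
            | succ q =>
              rw [brace_hom_zero_left, contract_altProd_zero_succ, brace_hom_succ,
                curryLeft_headForm, altProd_neg_right, hom_neg]
              simp
          | succ p =>
            cases q with
            | zero =>
              rw [brace_hom_zero_right, contract_altProd_succ_zero, brace_hom_succ,
                curryLeft_headForm, altProd_neg_left, hom_neg]
              simp
            | succ q =>
              rw [contract_altProd_succ_succ, brace_hom_succ, brace_hom_succ,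
                curryLeft_headForm, curryLeft_headForm, altProd_neg_left, altProd_neg_right, hom_neg,
                hom_neg, pow_succ (-1 : ℝ) (p + 1)]
              simp

@[simp]
theorem scalarPart_brace (P Q : Multi R T) :
    scalarPart (brace B P Q) = B (linearPart P) (linearPart Q) := by
  induction P using DirectSum.induction_on with
  | zero => simp
  | add P P' hP hP' => simp only [map_add, LinearMap.add_apply, hP, hP']
  | of p P =>
    induction Q using DirectSum.induction_on with
    | zero => simp
    | add Q Q' hQ hQ' => simp only [map_add, hQ, hQ']
    | of q Q =>
      change scalarPart (brace B (hom p P) (hom q Q)) =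
        B (linearPart (hom p P)) (linearPart (hom q Q))
      have h0 : ∀ U : Alt R T 0, linearPart (hom 0 U) = 0 := fun U => by
        ext t; rw [linearPart_apply, contract_hom_zero]; rfl
      have h2 : ∀ (n : ℕ) (U : Alt R T (n + 2)), linearPart (hom (n + 2) U) = 0 := fun n U => by
        ext t; rw [linearPart_apply, contract_hom_succ, scalarPart_hom_succ]; rfl
      cases p with
      | zero => rw [brace_hom_zero_left, h0]; simp
      | succ p =>
        cases q with
        | zero => rw [brace_hom_zero_right, h0]; simp
        | succ q =>
          rw [brace_hom_succ]
          cases q with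
          | succ q =>
            rw [h2 _ Q, map_zero]
            exact scalarPart_hom_succ (p := p + q) _
          | zero =>
            cases p with
            | succ p =>
              rw [h2 _ P, map_zero]
              exact scalarPart_hom_succ (p := p) _
            | zero =>
              refine (scalarPart_hom_zero _).trans ((altProd_zero_zero B _ _ 0).trans ?_)
              congr 1
              · congr 1
                ext t
                rw [linearPart_apply, contract_hom_succ, scalarPart_hom_zero]
                rfl
              · ext t
                rw [linearPart_apply, contract_hom_succ, scalarPart_hom_zero]
                rfl

@[simp]
theorem brace_fn_left (f : R) (Q : Multi R T) : brace B (fn f) Q = 0 := by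
  induction Q using DirectSum.induction_on with
  | zero => simp
  | add Q Q' hQ hQ' => simp only [map_add, hQ, hQ', add_zero]
  | of q Q => exact brace_hom_zero_left _ _ _

@[simp]
theorem brace_fn_right (f : R) (Q : Multi R T) : brace B Q (fn f) = 0 := by
  induction Q using DirectSum.induction_on with
  | zero => simp
  | add Q Q' hQ hQ' => simp only [map_add, hQ, hQ', add_zero, LinearMap.add_apply]
  | of q Q => exact brace_hom_zero_right _ _ _

theorem invol_brace (P Q : Multi R T) :
    invol (brace B P Q) = brace B (invol P) (invol Q) := by
  rw [← sub_eq_zero]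
  refine eq_zero_of_contract₂ (fun P Q => invol (brace B P Q) - brace B (invol P) (invol Q))
    ?_ ?_ ?_ ?_ P Q
  · intro P P' Q; simp only [map_add, LinearMap.add_apply]; abel
  · intro P Q Q'; simp only [map_add]; abel
  · intro P Q; simp
  · intro t P Q h1 h2
    simp only [invol_invol] at h2
    simp only [map_sub, contract_invol, contract_brace, map_neg, LinearMap.neg_apply, invol_invol,
      map_add]
    linear_combination (norm := module) h1 - h2

/-- The biderivation property of `brace`. -/
theorem two_brace_wedge (P Q U : Multi R T) :
    (2 : ℝ) • brace B P (wedge Q U) = (2 : ℝ) • wedge (brace B P Q) U +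
      wedge (Q + invol Q) (brace B P U) + wedge (Q - invol Q) (brace B (invol P) U) := by
  rw [← sub_eq_zero]
  refine eq_zero_of_contract₃ (fun P Q U => (2 : ℝ) • brace B P (wedge Q U) -
      ((2 : ℝ) • wedge (brace B P Q) U +
      wedge (Q + invol Q) (brace B P U) + wedge (Q - invol Q) (brace B (invol P) U)))
    ?_ ?_ ?_ ?_ ?_ P Q U
  · intro P P' Q U; simp only [map_add, LinearMap.add_apply, smul_add]; abel
  · intro P Q Q' U
    simp only [map_add, map_sub, LinearMap.add_apply, LinearMap.sub_apply, smul_add]; abel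
  · intro P Q U U'; simp only [map_add, smul_add]; abel
  · intro P Q U
    simp only [map_sub, map_add, scalarPart_wedge, scalarPart_brace, scalarPart_invol,
      LinearMap.add_apply, LinearMap.sub_apply, two_smul, linearPart_wedge, map_smul, smul_eq_mul]
    ring
  · intro t P Q U h1 h2 h3
    simp only [map_sub, map_add, contract_wedge, contract_brace, LinearMap.add_apply,
      LinearMap.sub_apply, contract_real_smul, contract_invol, map_neg, LinearMap.neg_apply,
      invol_invol, invol_brace, smul_add, smul_neg] at h1 h2 h3 ⊢
    linear_combination (norm := module) -h1 + h2 + h3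

theorem two_brace_swap (hB : ∀ a, B a a = 0) (P Q : Multi R T) :
    (2 : ℝ) • brace B P Q = -brace B Q (P - invol P) + brace B (invol Q) (P + invol P) := by
  have hB' : ∀ a b, B a b = -B b a := fun a b => by
    have h := hB (a + b)
    simp only [map_add, LinearMap.add_apply, hB, zero_add, add_zero] at h
    linear_combination h
  rw [← sub_eq_zero]
  refine eq_zero_of_contract₂ (fun P Q => (2 : ℝ) • brace B P Q -
    (-brace B Q (P - invol P) + brace B (invol Q) (P + invol P))) ?_ ?_ ?_ ?_ P Q
  · intro P P' Q; simp only [map_add, map_sub, LinearMap.add_apply, smul_add]; abel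
  · intro P Q Q'; simp only [map_add, LinearMap.add_apply, smul_add]
    abel
  · intro P Q
    simp only [map_sub, map_add, map_neg, scalarPart_brace, linearPart_invol,
      LinearMap.neg_apply, two_smul, hB' (linearPart P)]
    ring
  · intro t P Q h1 h2
    simp only [map_sub, map_add, contract_brace, contract_real_smul, contract_invol, map_neg,
      LinearMap.neg_apply, invol_invol, smul_add, smul_neg] at h1 h2 ⊢
    linear_combination (norm := module) -h1 + h2

end Brace

section Insert

variable {R S : Type*} [CommRing R] [Algebra ℝ R] [AddCommGroup S] [Module R S]

theorem insertEnd_apply (N : S →ₗ[R] S) {k : ℕ} (η : Alt R S k) (v : Fin k → S) :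
    insertEnd N η v = ∑ i, η (Function.update v i (N (v i))) := by
  have hup : ∀ a : Fin k, (fun b => (Function.update (fun _ => LinearMap.id) a N :
      Fin k → S →ₗ[R] S) b (v b)) = Function.update v a (N (v a)) := by
    intro a
    funext b
    by_cases hb : b = a
    · subst hb; simp
    · simp [hb]
  change (∑ i : Fin k, (η : MultilinearMap R (fun _ : Fin k => S) R).compLinearMap
    (Function.update (fun _ => LinearMap.id) i N)) v = _
  simp [sum_apply, hup]

/-- Insertion of an endomorphism, as a derivation of the graded module of forms. -/
def ins (N : S →ₗ[R] S) : Multi R S →ₗ[R] Multi R S :=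
  DirectSum.toModule R ℕ _ fun k => DirectSum.lof R ℕ (Alt R S) k ∘ₗ
    { toFun := insertEnd N
      map_add' := fun η ζ => by
        ext v
        simp [insertEnd_apply, Finset.sum_add_distrib]
      map_smul' := fun c η => by
        ext v
        simp [insertEnd_apply, Finset.mul_sum] }

theorem ins_hom (N : S →ₗ[R] S) {k : ℕ} (η : Alt R S k) :
    ins N (hom k η) = hom k (insertEnd N η) := by
  rw [ins, hom_eq_lof, DirectSum.toModule_lof]
  rfl

@[simp]
theorem contract_ins (N : S →ₗ[R] S) (t : S) (P : Multi R S) :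
    contract t (ins N P) = ins N (contract t P) + contract (N t) P := by
  induction P using DirectSum.induction_on with
  | zero => simp
  | add P P' hP hP' => simp only [map_add, hP, hP']; abel
  | of p P =>
    change contract t (ins N (hom p P)) = ins N (contract t (hom p P)) + contract (N t) (hom p P)
    cases p with
    | zero => rw [ins_hom, contract_hom_zero, contract_hom_zero, contract_hom_zero]; simp
    | succ p =>
      rw [ins_hom, contract_hom_succ, contract_hom_succ, contract_hom_succ, ins_hom, ← hom_add]
      congr 1
      ext v
      have h0 : Function.update (Matrix.vecCons t v) 0 (N t) = Matrix.vecCons (N t) v :=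
        Fin.update_cons_zero _ _ _
      have h1 : ∀ (i : Fin p) (y : S), Function.update (Matrix.vecCons t v) i.succ y =
        Matrix.vecCons t (Function.update v i y) := fun i y => (Fin.cons_update _ _ _ _).symm
      rw [AlternatingMap.add_apply, AlternatingMap.curryLeft_apply_apply, insertEnd_apply,
        insertEnd_apply, Fin.sum_univ_succ]
      simp only [Matrix.cons_val_zero, Matrix.cons_val_succ, h0, h1,
        AlternatingMap.curryLeft_apply_apply]
      ring

@[simp]
theorem scalarPart_ins (N : S →ₗ[R] S) (P : Multi R S) : scalarPart (ins N P) = 0 := by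
  induction P using DirectSum.induction_on with
  | zero => simp
  | add P P' hP hP' => simp only [map_add, hP, hP', add_zero]
  | of p P =>
    change scalarPart (ins N (hom p P)) = 0
    rw [ins_hom]
    cases p with
    | zero => rw [scalarPart_hom_zero, insertEnd_apply]; simp
    | succ p => rw [scalarPart_hom_succ]

@[simp]
theorem ins_fn (N : S →ₗ[R] S) (f : R) : ins N (fn f) = 0 :=
  ext_contract (by simp) (by simp)

@[simp]
theorem ins_one (N : S →ₗ[R] S) (a : Module.Dual R S) : ins N (one a) = one (N.dualMap a) :=
  ext_contract (by simp) (by simp)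

theorem invol_ins (N : S →ₗ[R] S) (P : Multi R S) : invol (ins N P) = ins N (invol P) := by
  rw [← sub_eq_zero]
  refine eq_zero_of_contract₁ (fun P => invol (ins N P) - ins N (invol P)) ?_ ?_ ?_ P
  · intro P P'; simp only [map_add]; abel
  · intro P; simp
  · intro t P h
    simp only [map_sub, contract_invol, contract_ins, map_add, map_neg]
    linear_combination (norm := module) -h

theorem ins_wedge (N : S →ₗ[R] S) (P Q : Multi R S) :
    ins N (wedge P Q) = wedge (ins N P) Q + wedge P (ins N Q) := by
  rw [← sub_eq_zero]
  refine eq_zero_of_contract₂ (fun P Q => ins N (wedge P Q) -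
    (wedge (ins N P) Q + wedge P (ins N Q))) ?_ ?_ ?_ ?_ P Q
  · intro P P' Q; simp only [map_add, LinearMap.add_apply]; abel
  · intro P Q Q'; simp only [map_add]; abel
  · intro P Q; simp
  · intro t P Q h1 h2
    simp only [map_sub, map_add, contract_wedge, contract_ins, LinearMap.add_apply, invol_ins]
    linear_combination (norm := module) h1 + h2

end Insert

end Algebroid

namespace Algebroid

variable {R S : Type*} [CommRing R] [Algebra ℝ R]
  [AddCommGroup S] [Module R S] [Module ℝ S] [IsScalarTower ℝ R S]

namespace SkewAlgebroid

theorem removeNth_succ_vecCons {m : ℕ} (y : S) (v : Fin (m + 1) → S) (a : Fin (m + 1)) :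
    Fin.removeNth a.succ (Matrix.vecCons y v : Fin (m + 2) → S) =
      Matrix.vecCons y (Fin.removeNth a v) := by
  funext b
  refine Fin.cases ?_ (fun b => ?_) b <;> simp [Fin.removeNth_apply]

theorem removeNth_zero_vecCons {m : ℕ} (y : S) (v : Fin m → S) :
    Fin.removeNth 0 (Matrix.vecCons y v : Fin (m + 1) → S) = v := by
  funext b
  simp [Fin.removeNth_apply]

theorem neg_one_zsmul (r : ℕ) (b : R) : (-1 : ℤ) ^ r • b = (-1 : R) ^ r * b := by
  rw [zsmul_eq_mul]; push_cast; rfl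

theorem altDiff_apply (A : SkewAlgebroid R S) {k : ℕ} (η : Alt R S k) (v : Fin (k + 1) → S) :
    A.altDiff η v = A.realDiff η v := rfl

theorem anchorComp_apply (A : SkewAlgebroid R S) {k : ℕ} (η : Alt R S k) (X : S) (v : Fin k → S) :
    A.anchorComp η X v = A.anchor X (η v) := rfl

theorem bracketComp_apply (A : SkewAlgebroid R S) {k : ℕ} (η : Alt R S (k + 1)) (X Y : S)
    (v : Fin k → S) : A.bracketComp η X Y v = η (Matrix.vecCons (A.bracket X Y) v) := rfl

theorem altDiff_zero_cons (A : SkewAlgebroid R S) (η : Alt R S 0) (X : S) (v : Fin 0 → S) :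
    A.altDiff η (Matrix.vecCons X v) = A.anchor X (η v) := by
  simp [altDiff_apply, realDiff, bracketTerm, AlternatingMap.alternatizeUncurryFin_apply,
    anchorComp_apply]

theorem vecCons_swap {k : ℕ} (η : Alt R S (k + 2)) (x y : S) (v : Fin k → S) :
    η (Matrix.vecCons x (Matrix.vecCons y v)) = -η (Matrix.vecCons y (Matrix.vecCons x v)) := by
  have h := congrArg (fun A => A v y) (curryLeft_headForm η x)
  simp only [AlternatingMap.curryLeft_apply_apply, AlternatingMap.neg_apply, LinearMap.neg_apply,
    headForm_apply] at h
  rw [h, neg_neg]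

theorem update_eq_sign_smul {k : ℕ} (η : Alt R S (k + 1)) (v : Fin (k + 1) → S) (i : Fin (k + 1))
    (y : S) : η (Function.update v i y) =
      (-1 : R) ^ (i : ℕ) * η (Matrix.vecCons y (i.removeNth v)) := by
  have h : Function.update v i y = i.insertNth y (i.removeNth v) := by
    simp [Fin.insertNth_removeNth]
  rw [h, AlternatingMap.map_insertNth, neg_one_zsmul]

theorem altDiff_succ_cons (A : SkewAlgebroid R S) {k : ℕ} (η : Alt R S (k + 1)) (X : S)
    (v : Fin (k + 1) → S) :
    A.altDiff η (Matrix.vecCons X v) = A.anchor X (η v) -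
      ∑ i, η (Function.update v i (A.bracket X (v i))) - A.altDiff (η.curryLeft X) v := by
  set D : R := ∑ j : Fin (k + 1), (-1 : R) ^ (j : ℕ) *
    η (Matrix.vecCons (A.bracket X (v j)) (j.removeNth v)) with hD
  have hsum : ∑ i, η (Function.update v i (A.bracket X (v i))) = D :=
    Finset.sum_congr rfl fun i _ => update_eq_sign_smul _ _ _ _
  have h1 : AlternatingMap.alternatizeUncurryFin (A.anchorComp η) (Matrix.vecCons X v) =
      A.anchor X (η v) -
        AlternatingMap.alternatizeUncurryFin (A.anchorComp (η.curryLeft X)) v := by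
    rw [AlternatingMap.alternatizeUncurryFin_apply, AlternatingMap.alternatizeUncurryFin_apply,
      Fin.sum_univ_succ, sub_eq_add_neg, ← Finset.sum_neg_distrib]
    simp only [removeNth_succ_vecCons, removeNth_zero_vecCons, Matrix.cons_val_zero,
      Matrix.cons_val_succ, anchorComp_apply, Fin.val_zero, pow_zero, one_smul, Fin.val_succ,
      AlternatingMap.curryLeft_apply_apply]
    congr 1
    refine Finset.sum_congr rfl fun j _ => ?_
    rw [pow_succ]
    simp
  have hin : ∀ (Z : S) (u : Fin k → S),
      AlternatingMap.alternatizeUncurryFin (A.bracketComp η Z) (Matrix.vecCons X u) =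
        η (Matrix.vecCons (A.bracket Z X) u) +
          (match (generalizing := false) k, η, u with
          | 0, _, _ => 0
          | _ + 1, η, u => AlternatingMap.alternatizeUncurryFin
            (A.bracketComp (η.curryLeft X) Z) u) := by
    intro Z u
    cases k with
    | zero =>
      simp [AlternatingMap.alternatizeUncurryFin_apply, bracketComp_apply]
    | succ k =>
      rw [AlternatingMap.alternatizeUncurryFin_apply, Fin.sum_univ_succ]
      simp only [removeNth_succ_vecCons, removeNth_zero_vecCons, Matrix.cons_val_zero,
        Matrix.cons_val_succ, bracketComp_apply, Fin.val_zero, pow_zero, one_smul, Fin.val_succ]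
      rw [AlternatingMap.alternatizeUncurryFin_apply]
      congr 1
      refine Finset.sum_congr rfl fun j _ => ?_
      rw [bracketComp_apply, AlternatingMap.curryLeft_apply_apply, vecCons_swap, pow_succ]
      simp
  have h0 : AlternatingMap.alternatizeUncurryFin (A.bracketComp η X) v = D := by
    rw [AlternatingMap.alternatizeUncurryFin_apply, hD]
    exact Finset.sum_congr rfl fun j _ => neg_one_zsmul _ _
  have e : (algebraMap ℝ R (1 / 2)) * 2 = 1 := by
    rw [← map_ofNat (algebraMap ℝ R) 2, ← map_mul]; norm_num
  have hbr : ∀ Z, A.bracket Z X = -A.bracket X Z := fun Z => A.bracket_swap Z X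
  have hneg : ∀ (y : S) (u : Fin k → S), η (Matrix.vecCons (-y) u) = -η (Matrix.vecCons y u) := by
    intro y u
    have := η.map_vecCons_smul u (-1) y
    simpa using this
  rw [hsum, altDiff_apply, altDiff_apply]
  cases k with
  | zero =>
    have h2 : AlternatingMap.alternatizeUncurryFin
        (AlternatingMap.alternatizeUncurryFinLM ∘ₗ A.bracketComp η) (Matrix.vecCons X v) =
        2 * D := by
      rw [AlternatingMap.alternatizeUncurryFin_apply, Fin.sum_univ_succ]
      simp only [neg_one_zsmul, removeNth_succ_vecCons, removeNth_zero_vecCons,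
        Matrix.cons_val_zero, Matrix.cons_val_succ, LinearMap.comp_apply,
        AlternatingMap.alternatizeUncurryFinLM_apply, h0, hin, Fin.val_succ, Fin.val_zero, pow_zero,
        one_smul, hbr, hneg]
      rw [two_mul]
      congr 1
      rw [hD]
      refine Finset.sum_congr rfl fun j _ => ?_
      ring
    simp only [realDiff, bracketTerm, AlternatingMap.add_apply, AlternatingMap.smul_apply, h1, h2,
      AlternatingMap.zero_apply]
    rw [Algebra.smul_def, map_neg]
    linear_combination -D * e
  | succ k =>
    have h2 : AlternatingMap.alternatizeUncurryFin
        (AlternatingMap.alternatizeUncurryFinLM ∘ₗ A.bracketComp η) (Matrix.vecCons X v) =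
        2 * D - AlternatingMap.alternatizeUncurryFin
        (AlternatingMap.alternatizeUncurryFinLM ∘ₗ A.bracketComp (η.curryLeft X)) v := by
      rw [AlternatingMap.alternatizeUncurryFin_apply, Fin.sum_univ_succ,
        AlternatingMap.alternatizeUncurryFin_apply]
      simp only [neg_one_zsmul, removeNth_succ_vecCons, removeNth_zero_vecCons,
        Matrix.cons_val_zero, Matrix.cons_val_succ, LinearMap.comp_apply,
        AlternatingMap.alternatizeUncurryFinLM_apply, h0, hin, Fin.val_succ, Fin.val_zero, pow_zero,
        one_smul, hbr, hneg]
      rw [two_mul, add_sub_assoc]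
      congr 1
      rw [hD, ← Finset.sum_sub_distrib]
      refine Finset.sum_congr rfl fun j _ => ?_
      ring
    simp only [realDiff, bracketTerm, AlternatingMap.add_apply, AlternatingMap.smul_apply, h1, h2]
    rw [Algebra.smul_def, Algebra.smul_def, map_neg]
    linear_combination -D * e

theorem diff_hom (A : SkewAlgebroid R S) {k : ℕ} (η : Alt R S k) :
    A.diff (hom k η) = hom (k + 1) (A.altDiff η) := by
  change A.diff (DirectSum.lof ℝ ℕ (Alt R S) k η) = _
  rw [diff, DirectSum.toModule_lof]
  rfl

/-- The Lie derivative of forms, `i_X d + d i_X`. -/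
def lie (A : SkewAlgebroid R S) (X : S) : Multi R S →ₗ[ℝ] Multi R S :=
  (contract X).restrictScalars ℝ ∘ₗ A.diff + A.diff ∘ₗ (contract X).restrictScalars ℝ

theorem lie_apply (A : SkewAlgebroid R S) (X : S) (P : Multi R S) :
    A.lie X P = contract X (A.diff P) + A.diff (contract X P) := rfl

theorem lie_hom (A : SkewAlgebroid R S) (X : S) {k : ℕ} (η : Alt R S k) :
    ∃ ζ : Alt R S k, A.lie X (hom k η) = hom k ζ ∧
      ∀ v, ζ v = A.anchor X (η v) - ∑ i, η (Function.update v i (A.bracket X (v i))) := by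
  cases k with
  | zero =>
    refine ⟨(A.altDiff η).curryLeft X, ?_, fun v => ?_⟩
    · rw [lie_apply, diff_hom, contract_hom_succ, contract_hom_zero, map_zero, add_zero]
    · rw [AlternatingMap.curryLeft_apply_apply, altDiff_zero_cons, Fin.sum_univ_zero, sub_zero]
  | succ k =>
    refine ⟨(A.altDiff η).curryLeft X + A.altDiff (η.curryLeft X), ?_, fun v => ?_⟩
    · rw [lie_apply, diff_hom, contract_hom_succ, contract_hom_succ, diff_hom, hom_add]
    · rw [AlternatingMap.add_apply, AlternatingMap.curryLeft_apply_apply, altDiff_succ_cons]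
      ring

@[simp]
theorem scalarPart_lie (A : SkewAlgebroid R S) (X : S) (P : Multi R S) :
    scalarPart (A.lie X P) = A.anchor X (scalarPart P) := by
  induction P using DirectSum.induction_on with
  | zero => simp
  | add P P' hP hP' => simp only [map_add, hP, hP']
  | of p P =>
    obtain ⟨ζ, h, hζ⟩ := A.lie_hom X P
    change scalarPart (A.lie X (hom p P)) = A.anchor X (scalarPart (hom p P))
    rw [h]
    cases p with
    | zero => rw [scalarPart_hom_zero, scalarPart_hom_zero, hζ, Fin.sum_univ_zero, sub_zero]
    | succ p => rw [scalarPart_hom_succ, scalarPart_hom_succ, map_zero]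

@[simp]
theorem contract_lie (A : SkewAlgebroid R S) (X t : S) (P : Multi R S) :
    contract t (A.lie X P) = A.lie X (contract t P) - contract (A.bracket X t) P := by
  induction P using DirectSum.induction_on with
  | zero => simp
  | add P P' hP hP' => simp only [map_add, hP, hP']; abel
  | of p P =>
    obtain ⟨ζ, h, hζ⟩ := A.lie_hom X P
    change contract t (A.lie X (hom p P)) =
      A.lie X (contract t (hom p P)) - contract (A.bracket X t) (hom p P)
    rw [h]
    cases p with
    | zero => rw [contract_hom_zero, contract_hom_zero, contract_hom_zero]; simp
    | succ p =>
      rw [contract_hom_succ, contract_hom_succ, contract_hom_succ]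
      obtain ⟨ξ, h', hξ⟩ := A.lie_hom X (P.curryLeft t)
      rw [h', eq_sub_iff_add_eq, ← hom_add]
      congr 1
      ext v
      have h0 : ∀ y, Function.update (Matrix.vecCons t v) 0 y = Matrix.vecCons y v :=
        fun _ => Fin.update_cons_zero _ _ _
      have h1 : ∀ (i : Fin p) (y : S), Function.update (Matrix.vecCons t v) i.succ y =
        Matrix.vecCons t (Function.update v i y) := fun i y => (Fin.cons_update _ _ _ _).symm
      rw [AlternatingMap.add_apply, AlternatingMap.curryLeft_apply_apply, hζ, hξ,
        Fin.sum_univ_succ]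
      simp only [Matrix.cons_val_zero, Matrix.cons_val_succ, h0, h1,
        AlternatingMap.curryLeft_apply_apply]
      ring

@[simp]
theorem scalarPart_diff (A : SkewAlgebroid R S) (P : Multi R S) :
    scalarPart (A.diff P) = 0 := by
  induction P using DirectSum.induction_on with
  | zero => simp
  | add P P' hP hP' => simp only [map_add, hP, hP', add_zero]
  | of p P =>
    change scalarPart (A.diff (hom p P)) = 0
    rw [diff_hom, scalarPart_hom_succ]

/-- Cartan's formula. -/
theorem contract_diff (A : SkewAlgebroid R S) (t : S) (P : Multi R S) :
    contract t (A.diff P) = A.lie t P - A.diff (contract t P) := by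
  rw [lie_apply]; abel

theorem lie_fn (A : SkewAlgebroid R S) (X : S) (f : R) : A.lie X (fn f) = fn (A.anchor X f) :=
  ext_contract (by simp) (by simp)

theorem diff_fn (A : SkewAlgebroid R S) (f : R) : A.diff (fn f) = one (A.dFun f) := by
  refine ext_contract (by simp) fun t => ?_
  rw [contract_diff, contract_fn, map_zero, sub_zero, lie_fn, contract_one]
  rfl

theorem lie_one (A : SkewAlgebroid R S) (X : S) (a : Module.Dual R S) :
    A.lie X (one a) = one (A.lieDer X a) := by
  refine ext_contract (by simp) fun t => ?_
  rw [contract_lie, contract_one, contract_one, contract_one, lie_fn, ← fn_sub]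
  rfl

theorem contract_contract_diff_one (A : SkewAlgebroid R S) (X Y : S) (a : Module.Dual R S) :
    contract Y (contract X (A.diff (one a))) =
      fn (A.anchor X (a Y) - A.anchor Y (a X) - a (A.bracket X Y)) := by
  rw [contract_diff, map_sub, lie_one, contract_one, contract_one, contract_diff, lie_fn,
    contract_fn, map_zero, sub_zero, ← fn_sub]
  congr 1
  change A.anchor X (a Y) - a (A.bracket X Y) - A.anchor Y (a X) = _
  ring

theorem invol_diff (A : SkewAlgebroid R S) (P : Multi R S) :
    invol (A.diff P) = -A.diff (invol P) := by
  induction P using DirectSum.induction_on with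
  | zero => simp
  | add P P' hP hP' => simp only [map_add, hP, hP']; abel
  | of p P =>
    change invol (A.diff (hom p P)) = -A.diff (invol (hom p P))
    rw [diff_hom, invol_hom, invol_hom, map_smul, diff_hom, pow_succ]
    module

theorem invol_lie (A : SkewAlgebroid R S) (X : S) (P : Multi R S) :
    invol (A.lie X P) = A.lie X (invol P) := by
  have h := contract_invol X (A.diff P)
  rw [invol_diff, map_neg] at h
  rw [eq_comm] at h
  have h' : invol (contract X (A.diff P)) = contract X (A.diff (invol P)) := by
    simpa using h
  rw [lie_apply, lie_apply, map_add, contract_invol, map_neg, invol_diff, h']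

theorem lie_wedge (A : SkewAlgebroid R S) (X : S) (P Q : Multi R S) :
    A.lie X (wedge P Q) = wedge (A.lie X P) Q + wedge P (A.lie X Q) := by
  rw [← sub_eq_zero]
  refine eq_zero_of_contract₂ (fun P Q => A.lie X (wedge P Q) -
    (wedge (A.lie X P) Q + wedge P (A.lie X Q))) ?_ ?_ ?_ ?_ P Q
  · intro P P' Q; simp only [map_add, LinearMap.add_apply]; abel
  · intro P Q Q'; simp only [map_add]; abel
  · intro P Q; simp; ring
  · intro t P Q h1 h2
    simp only [map_sub, map_add, contract_wedge, contract_lie, LinearMap.sub_apply, invol_lie]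
    linear_combination (norm := module) h1 + h2

theorem diff_wedge (A : SkewAlgebroid R S) (P Q : Multi R S) :
    A.diff (wedge P Q) = wedge (A.diff P) Q + wedge (invol P) (A.diff Q) := by
  rw [← sub_eq_zero]
  refine eq_zero_of_contract₂ (fun P Q => A.diff (wedge P Q) -
    (wedge (A.diff P) Q + wedge (invol P) (A.diff Q))) ?_ ?_ ?_ ?_ P Q
  · intro P P' Q; simp only [map_add, LinearMap.add_apply]; abel
  · intro P Q Q'; simp only [map_add]; abel
  · intro P Q; simp
  · intro t P Q h1 h2
    simp only [map_sub, map_add, contract_wedge, contract_diff, LinearMap.sub_apply,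
      invol_diff, lie_wedge, contract_invol, map_neg, LinearMap.neg_apply,
      invol_invol] at h1 h2 ⊢
    linear_combination (norm := module) -h1 - h2

theorem lie_bracket {A : SkewAlgebroid R S} (hA : A.IsLie) (X Y : S) (P : Multi R S) :
    A.lie (A.bracket X Y) P = A.lie X (A.lie Y P) - A.lie Y (A.lie X P) := by
  rw [← sub_eq_zero]
  refine eq_zero_of_contract₁ (fun P => A.lie (A.bracket X Y) P -
    (A.lie X (A.lie Y P) - A.lie Y (A.lie X P))) ?_ ?_ ?_ P
  · intro P P'; simp only [map_add]; abel
  · intro P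
    simp only [map_sub, scalarPart_lie, hA.anchor_bracket, Derivation.commutator_apply, sub_self]
  · intro t P h
    have hJ : A.bracket (A.bracket X Y) t =
        A.bracket X (A.bracket Y t) - A.bracket Y (A.bracket X t) := by
      rw [hA.jacobi X Y t]; abel
    simp only [map_sub, contract_lie, hJ, contract_sub_left]
    linear_combination (norm := module) h

theorem lie_diff {A : SkewAlgebroid R S} (hA : A.IsLie) (X : S) (P : Multi R S) :
    A.lie X (A.diff P) = A.diff (A.lie X P) := by
  rw [← sub_eq_zero]
  refine eq_zero_of_contract₁ (fun P => A.lie X (A.diff P) - A.diff (A.lie X P)) ?_ ?_ ?_ P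
  · intro P P'; simp only [map_add]; abel
  · intro P
    simp only [map_sub, scalarPart_lie, scalarPart_diff, map_zero, sub_self]
  · intro t P h
    simp only [map_sub, contract_lie, contract_diff, lie_bracket hA]
    linear_combination (norm := module) -h

theorem diff_diff {A : SkewAlgebroid R S} (hA : A.IsLie) (P : Multi R S) :
    A.diff (A.diff P) = 0 := by
  refine eq_zero_of_contract₁ (fun P => A.diff (A.diff P)) ?_ ?_ ?_ P
  · intro P P'; simp only [map_add]
  · intro P; simp
  · intro t P h
    simp only [map_sub, contract_diff, lie_diff hA]
    linear_combination (norm := module) h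

end SkewAlgebroid

end Algebroid

namespace Algebroid

section Local

variable {R T U : Type*} [CommRing R] [Algebra ℝ R] [AddCommGroup T] [Module R T]
  [AddCommGroup U] [Module R U]

/-- Multiplication by `f` on `T` factors through a finite free module by means of functionals of
the form `pair e`. -/
def IsDualizable (pair : U →ₗ[R] T →ₗ[R] R) (f : R) : Prop :=
  ∃ (n : ℕ) (e : Fin n → U) (t : Fin n → T), ∀ x : T, f • x = ∑ i, pair (e i) x • t i

/-- The elements `f` as in `IsDualizable` detect the vanishing of elements of `R`. -/
def IsLocallyDualizable (pair : U →ₗ[R] T →ₗ[R] R) : Prop :=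
  ∀ r : R, (∀ f, IsDualizable pair f → ∃ k : ℕ, f ^ k * r = 0) → r = 0

theorem contract_degOp (t : T) (P : Multi R T) :
    contract t (degOp P) = degOp (contract t P) + contract t P := by
  induction P using DirectSum.induction_on with
  | zero => simp
  | add P P' hP hP' => simp only [map_add, hP, hP']; abel
  | of p P =>
    change contract t (degOp (hom p P)) = degOp (contract t (hom p P)) + contract t (hom p P)
    rw [degOp_hom, contract_real_smul]
    cases p with
    | zero => rw [contract_hom_zero]; simp
    | succ p =>
      rw [contract_hom_succ, degOp_hom]
      push_cast
      module

theorem scalarPart_degOp (P : Multi R T) : scalarPart (degOp P) = 0 := by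
  induction P using DirectSum.induction_on with
  | zero => simp
  | add P P' hP hP' => simp only [map_add, hP, hP', add_zero]
  | of p P =>
    change scalarPart (degOp (hom p P)) = 0
    rw [degOp_hom, LinearMap.map_smul_of_tower]
    cases p with
    | zero => simp
    | succ p => rw [scalarPart_hom_succ, smul_zero]

theorem sum_wedge_contract {pair : U →ₗ[R] T →ₗ[R] R} {f : R} {n : ℕ} {e : Fin n → U}
    {t : Fin n → T} (h : ∀ x : T, f • x = ∑ i, pair (e i) x • t i) (P : Multi R T) :
    ∑ i, wedge (one (pair (e i))) (contract (t i) P) = f • degOp P := by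
  rw [← sub_eq_zero]
  refine eq_zero_of_contract₁
    (fun P => ∑ i, wedge (one (pair (e i))) (contract (t i) P) - f • degOp P) ?_ ?_ ?_ P
  · intro P P'
    simp only [map_add, Finset.sum_add_distrib, smul_add]
    abel
  · intro P
    simp [scalarPart_degOp]
  · intro x P hP
    have h1 : contract (f • x) P = ∑ i, pair (e i) x • contract (t i) P := by
      rw [h x, ← contractₗ_apply, map_sum, LinearMap.sum_apply]
      simp only [map_smul, LinearMap.smul_apply, contractₗ_apply]
    rw [contract_smul_left] at h1
    have h2 : contract x (∑ i, wedge (one (pair (e i))) (contract (t i) P)) =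
        f • contract x P + ∑ i, wedge (one (pair (e i))) (contract (t i) (contract x P)) := by
      rw [h1, map_sum, ← Finset.sum_add_distrib]
      refine Finset.sum_congr rfl fun i _ => ?_
      rw [contract_wedge, contract_one, fn_wedge, invol_one, map_neg, LinearMap.neg_apply,
        contract_contract_swap x, map_neg, neg_neg]
    rw [map_sub, h2, map_smul, contract_degOp, smul_add]
    linear_combination (norm := module) hP

theorem pow_smul_hom_mem {pair : U →ₗ[R] T →ₗ[R] R} {f : R} (hf : IsDualizable pair f)
    (Z : Submodule R (Multi R T)) (h0 : ∀ g, fn g ∈ Z)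
    (h1 : ∀ e, ∀ Q ∈ Z, wedge (one (pair e)) Q ∈ Z) (p : ℕ) (P : Alt R T p) :
    f ^ p • hom p P ∈ Z := by
  obtain ⟨n, e, t, h⟩ := hf
  induction p with
  | zero =>
    rw [pow_zero, one_smul]
    have hP : hom 0 P = fn (P 0) := by
      unfold fn
      congr 1
      ext v
      rw [Subsingleton.elim v 0]
      rfl
    rw [hP]
    exact h0 _
  | succ p ih =>
    have hs := sum_wedge_contract h (hom (p + 1) P)
    have h2 : f ^ p • (f • degOp (hom (p + 1) P)) ∈ Z := by
      rw [← hs, Finset.smul_sum]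
      refine Z.sum_mem fun i _ => ?_
      rw [contract_hom_succ, ← map_smul]
      exact h1 _ _ (ih _)
    have h3 : f ^ (p + 1) • hom (p + 1) P =
        algebraMap ℝ R (1 / (p + 1 : ℝ)) • f ^ p • (f • degOp (hom (p + 1) P)) := by
      have hp : (p + 1 : ℝ) ≠ 0 := by positivity
      have h4 : degOp (hom (p + 1) P) = algebraMap ℝ R (p + 1) • hom (p + 1) P := by
        rw [degOp_hom, algebraMap_smul]
        push_cast
        rfl
      rw [h4, smul_smul, smul_smul, smul_smul, pow_succ]
      congr 1
      have h5 : algebraMap ℝ R (1 / (p + 1)) * algebraMap ℝ R (p + 1) = 1 := by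
        rw [← map_mul, one_div, inv_mul_cancel₀ hp, map_one]
      linear_combination -(f ^ p * f) * h5
    rw [h3]
    exact Z.smul_mem _ h2

/-- An additive and `R`-homogeneous operator vanishes if it vanishes on functions and its kernel
is closed under exterior multiplication by sections. -/
theorem eq_zero_of_local {pair : U →ₗ[R] T →ₗ[R] R} (hloc : IsLocallyDualizable pair)
    (K : Multi R T → Multi R T) (hadd : ∀ P Q, K (P + Q) = K P + K Q)
    (hsmul : ∀ (f : R) P, K (f • P) = f • K P) (hfn : ∀ f, K (fn f) = 0)
    (hw : ∀ e Q, K Q = 0 → K (wedge (one (pair e)) Q) = 0) (P : Multi R T) : K P = 0 := by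
  let Z : Submodule R (Multi R T) :=
    { carrier := {P | K P = 0}
      add_mem' := fun {P Q} hP hQ => by
        change K (P + Q) = 0
        rw [hadd, hP, hQ, add_zero]
      zero_mem' := by
        have := hsmul 0 0
        rwa [zero_smul, zero_smul] at this
      smul_mem' := fun f P hP => by
        change K (f • P) = 0
        rw [hsmul, hP, smul_zero] }
  have key : ∀ (p : ℕ) (P : Alt R T p), K (hom p P) = 0 := by
    intro p P
    refine DFinsupp.ext fun n => ?_
    ext v
    refine hloc _ fun f hf => ⟨p, ?_⟩
    have h : K (f ^ p • hom p P) = 0 := pow_smul_hom_mem hf Z hfn hw p P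
    rw [hsmul] at h
    exact congrArg (fun Q : Multi R T => Q n v) h
  induction P using DirectSum.induction_on with
  | zero => exact Z.zero_mem
  | of p P => exact key p P
  | add P Q hP hQ => rw [hadd, hP, hQ, add_zero]

end Local

section Degree

variable {R T : Type*} [CommRing R] [Algebra ℝ R] [AddCommGroup T] [Module R T]

/-- `P` is homogeneous of degree `p`. -/
def HasDeg (p : ℕ) (P : Multi R T) : Prop := ∃ P₀ : Alt R T p, P = hom p P₀

theorem hasDeg_hom {p : ℕ} (P : Alt R T p) : HasDeg p (hom p P) := ⟨P, rfl⟩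

theorem hasDeg_fn (f : R) : HasDeg 0 (fn f : Multi R T) := ⟨_, rfl⟩

theorem hasDeg_one (a : Module.Dual R T) : HasDeg 1 (one a) := ⟨_, rfl⟩

theorem HasDeg.add {p : ℕ} {P Q : Multi R T} (hP : HasDeg p P) (hQ : HasDeg p Q) :
    HasDeg p (P + Q) := by
  obtain ⟨P, rfl⟩ := hP
  obtain ⟨Q, rfl⟩ := hQ
  exact ⟨P + Q, (hom_add P Q).symm⟩

theorem HasDeg.wedge {p q : ℕ} {P Q : Multi R T} (hP : HasDeg p P) (hQ : HasDeg q Q) :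
    HasDeg (p + q) (wedge P Q) := by
  obtain ⟨P, rfl⟩ := hP
  obtain ⟨Q, rfl⟩ := hQ
  exact ⟨_, wedge_hom P Q⟩

theorem HasDeg.diff {S : Type*} [AddCommGroup S] [Module R S] [Module ℝ S] [IsScalarTower ℝ R S]
    (A : SkewAlgebroid R S) {p : ℕ} {P : Multi R S} (hP : HasDeg p P) :
    HasDeg (p + 1) (A.diff P) := by
  obtain ⟨P, rfl⟩ := hP
  exact ⟨_, A.diff_hom P⟩

theorem HasDeg.ins (N : T →ₗ[R] T) {p : ℕ} {P : Multi R T} (hP : HasDeg p P) :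
    HasDeg p (ins N P) := by
  obtain ⟨P, rfl⟩ := hP
  exact ⟨_, ins_hom N P⟩

theorem HasDeg.contract (t : T) {p : ℕ} {P : Multi R T} (hP : HasDeg (p + 1) P) :
    HasDeg p (contract t P) := by
  obtain ⟨P, rfl⟩ := hP
  exact ⟨_, contract_hom_succ t P⟩

theorem HasDeg.contract_zero (t : T) {P : Multi R T} (hP : HasDeg 0 P) :
    Algebroid.contract t P = 0 := by
  obtain ⟨P, rfl⟩ := hP
  exact contract_hom_zero t P

theorem HasDeg.invol_eq {p : ℕ} {P : Multi R T} (hP : HasDeg p P) :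
    invol P = (-1 : ℝ) ^ p • P := by
  obtain ⟨P, rfl⟩ := hP
  exact invol_hom P

theorem HasDeg.degOp_eq {p : ℕ} {P : Multi R T} (hP : HasDeg p P) :
    degOp P = (p : ℝ) • P := by
  obtain ⟨P, rfl⟩ := hP
  exact degOp_hom P

theorem HasDeg.wedge_comm {p q : ℕ} {P Q : Multi R T} (hP : HasDeg p P) (hQ : HasDeg q Q) :
    Algebroid.wedge P Q = (-1 : ℝ) ^ (p * q) • Algebroid.wedge Q P := by
  obtain ⟨P, rfl⟩ := hP
  obtain ⟨Q, rfl⟩ := hQ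
  exact wedge_comm_hom P Q

theorem two_smul_cancel {x y : Multi R T} (h : (2 : ℝ) • x = (2 : ℝ) • y) : x = y := by
  simpa [smul_smul] using congrArg (fun z => (1 / 2 : ℝ) • z) h

theorem HasDeg.brace_wedge (B : Module.Dual R T →ₗ[R] Module.Dual R T →ₗ[R] R) {p q : ℕ}
    {P Q : Multi R T} (hP : HasDeg p P) (hQ : HasDeg q Q) (U : Multi R T) :
    brace B P (Algebroid.wedge Q U) = Algebroid.wedge (brace B P Q) U +
      (-1 : ℝ) ^ (p * q) • Algebroid.wedge Q (brace B P U) := by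
  refine two_smul_cancel ((two_brace_wedge B P Q U).trans ?_)
  rw [hP.invol_eq, hQ.invol_eq, pow_mul]
  simp only [map_add, map_sub, LinearMap.add_apply, LinearMap.sub_apply, wedge_real_smul_left,
    wedge_real_smul_right, brace_real_smul_left]
  rcases neg_one_pow_eq_or ℝ p with h | h <;> rw [h]
  · simp only [one_pow]; module
  · module

theorem HasDeg.brace_swap {B : Module.Dual R T →ₗ[R] Module.Dual R T →ₗ[R] R}
    (hB : ∀ a, B a a = 0) {p q : ℕ} {P Q : Multi R T} (hP : HasDeg p P) (hQ : HasDeg q Q) :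
    brace B P Q = -(-1 : ℝ) ^ ((p + 1) * (q + 1)) • brace B Q P := by
  refine two_smul_cancel ((two_brace_swap B hB P Q).trans ?_)
  rw [hP.invol_eq, hQ.invol_eq, pow_mul, pow_succ (-1 : ℝ) p]
  simp only [map_add, map_sub, brace_real_smul_left, brace_real_smul_right]
  rcases neg_one_pow_eq_or ℝ p with h | h <;> rw [h]
  · rw [one_mul, pow_succ]; module
  · rw [neg_one_mul, neg_neg, one_pow]; module

theorem one_wedge_comm (a : Module.Dual R T) (Q : Multi R T) :
    wedge (one a) Q = wedge (invol Q) (one a) := by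
  refine two_smul_cancel ((two_wedge_comm (one a) Q).trans ?_)
  simp only [invol_one, map_add, map_sub, map_neg, LinearMap.add_apply, LinearMap.sub_apply]
  module

end Degree

end Algebroid

namespace Algebroid

section SharpForm

variable {R S : Type*} [CommRing R] [Algebra ℝ R] [AddCommGroup S] [Module R S]

/-- The bilinear form `(α, β) ↦ ⟨β, s α⟩` defined by `s : Γ(A*) → Γ(A)`. -/
def sharpForm (s : Module.Dual R S →ₗ[R] S) : Module.Dual R S →ₗ[R] Module.Dual R S →ₗ[R] R :=
  Module.Dual.eval R S ∘ₗ s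

@[simp]
theorem sharpForm_apply (s : Module.Dual R S →ₗ[R] S) (a b : Module.Dual R S) :
    sharpForm s a b = b (s a) := rfl

theorem brace_one_left (s : Module.Dual R S →ₗ[R] S) (a : Module.Dual R S) (Q : Multi R S) :
    brace (sharpForm s) (one a) Q = contract (s a) Q := by
  rw [← sub_eq_zero]
  refine eq_zero_of_contract₁ (fun Q => brace (sharpForm s) (one a) Q - contract (s a) Q)
    ?_ ?_ ?_ Q
  · intro P P'
    simp only [map_add]
    abel
  · intro P
    simp [linearPart_apply]
  · intro t P h
    rw [map_sub, contract_brace, contract_one, brace_fn_left, invol_one, map_neg,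
      LinearMap.neg_apply, contract_contract_swap t]
    linear_combination (norm := module) -h

theorem brace_one_right {s : Module.Dual R S →ₗ[R] S} (hs : ∀ a : Module.Dual R S, a (s a) = 0)
    (a : Module.Dual R S) {p : ℕ} {P : Multi R S} (hP : HasDeg p P) :
    brace (sharpForm s) P (one a) = -contract (s a) P := by
  rw [hP.brace_swap hs (hasDeg_one a), brace_one_left, Even.neg_one_pow ⟨p + 1, by ring⟩]
  module

theorem degOp_wedge (P Q : Multi R S) :
    degOp (wedge P Q) = wedge (degOp P) Q + wedge P (degOp Q) := by
  induction P using DirectSum.induction_on with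
  | zero => simp
  | add P P' h h' => simp only [map_add, LinearMap.add_apply, h, h']; abel
  | of p P =>
    induction Q using DirectSum.induction_on with
    | zero => simp
    | add Q Q' h h' => simp only [map_add, h, h']; abel
    | of q Q =>
      have hP := hasDeg_hom P
      have hQ := hasDeg_hom Q
      change degOp (wedge (hom p P) (hom q Q)) =
        wedge (degOp (hom p P)) (hom q Q) + wedge (hom p P) (degOp (hom q Q))
      rw [(hP.wedge hQ).degOp_eq, hP.degOp_eq, hQ.degOp_eq, wedge_real_smul_left,
        wedge_real_smul_right]
      push_cast
      module

theorem degOp_brace (B : Module.Dual R S →ₗ[R] Module.Dual R S →ₗ[R] R) (P Q : Multi R S) :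
    degOp (brace B P Q) = brace B (degOp P) Q + brace B P (degOp Q) - (2 : ℝ) • brace B P Q := by
  induction P using DirectSum.induction_on with
  | zero => simp
  | add P P' h h' => simp only [map_add, LinearMap.add_apply, h, h', smul_add]; abel
  | of p P =>
    induction Q using DirectSum.induction_on with
    | zero => simp
    | add Q Q' h h' => simp only [map_add, h, h', smul_add]; abel
    | of q Q =>
      change degOp (brace B (hom p P) (hom q Q)) = brace B (degOp (hom p P)) (hom q Q) +
        brace B (hom p P) (degOp (hom q Q)) - (2 : ℝ) • brace B (hom p P) (hom q Q)
      rw [degOp_hom, degOp_hom, brace_real_smul_left, brace_real_smul_right]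
      cases p with
      | zero => simp [brace_hom_zero_left]
      | succ p =>
        cases q with
        | zero => simp [brace_hom_zero_right]
        | succ q =>
          rw [brace_hom_succ, degOp_hom]
          push_cast
          module

theorem degOp_contract (t : S) (P : Multi R S) :
    degOp (contract t P) = contract t (degOp P) - contract t P := by
  rw [contract_degOp, add_sub_cancel_right]

/-- An eigenvector of the degree operator is homogeneous. -/
theorem apply_eq_zero_of_degOp {c : ℝ} {P : Multi R S} (h : degOp P = c • P) {n : ℕ}
    (hn : (n : ℝ) ≠ c) : P n = 0 := by
  have h1 : ∀ Q : Multi R S, (degOp Q) n = (n : ℝ) • Q n := by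
    intro Q
    induction Q using DirectSum.induction_on with
    | zero => simp
    | add Q Q' h h' => rw [map_add, DirectSum.add_apply, h, h', DirectSum.add_apply, smul_add]
    | of q Q =>
      change (degOp (hom q Q)) n = (n : ℝ) • (hom q Q : Multi R S) n
      rw [degOp_hom]
      change (q : ℝ) • (hom q Q : Multi R S) n = (n : ℝ) • (hom q Q : Multi R S) n
      by_cases hq : q = n
      · subst hq; rfl
      · rw [DirectSum.of_eq_of_ne _ _ _ (Ne.symm hq), smul_zero, smul_zero]
  have h2 : (n : ℝ) • P n = c • P n := by
    rw [← h1, h]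
    rfl
  ext v
  have h3 : (n : ℝ) • P n v = c • P n v := congrArg (fun Q : Alt R S n => Q v) h2
  have h4 : ((n : ℝ) - c) • P n v = 0 := by rw [sub_smul, h3, sub_self]
  have h5 := congrArg (fun r => ((n : ℝ) - c)⁻¹ • r) h4
  simpa [smul_smul, inv_mul_cancel₀ (sub_ne_zero.mpr hn)] using h5

end SharpForm

variable {R S : Type*} [CommRing R] [Algebra ℝ R]
  [AddCommGroup S] [Module R S] [Module ℝ S] [IsScalarTower ℝ R S]

namespace SkewAlgebroid

section TwistedDifferential

theorem twDiff_apply (A : SkewAlgebroid R S) (φ : Module.Dual R S) (P : Multi R S) :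
    A.twDiff φ P = A.diff P + wedge (one φ) P := rfl

theorem twDiff_real_smul (A : SkewAlgebroid R S) (φ : Module.Dual R S) (c : ℝ) (P : Multi R S) :
    A.twDiff φ (c • P) = c • A.twDiff φ P := map_smul _ c P

theorem invol_twDiff (A : SkewAlgebroid R S) (φ : Module.Dual R S) (P : Multi R S) :
    invol (A.twDiff φ P) = -A.twDiff φ (invol P) := by
  simp only [twDiff_apply, map_add, invol_diff, invol_wedge, invol_one, map_neg,
    LinearMap.neg_apply]
  abel

theorem hasDeg_twDiff (A : SkewAlgebroid R S) (φ : Module.Dual R S) {p : ℕ} {P : Multi R S}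
    (hP : HasDeg p P) : HasDeg (p + 1) (A.twDiff φ P) := by
  refine (hP.diff A).add ?_
  rw [add_comm]
  exact (hasDeg_one φ).wedge hP

theorem degOp_twDiff (A : SkewAlgebroid R S) (φ : Module.Dual R S) (P : Multi R S) :
    degOp (A.twDiff φ P) = A.twDiff φ (degOp P) + A.twDiff φ P := by
  induction P using DirectSum.induction_on with
  | zero => simp
  | add P P' h h' => simp only [map_add, h, h']; abel
  | of p P =>
    have hP := hasDeg_hom P
    change degOp (A.twDiff φ (hom p P)) = A.twDiff φ (degOp (hom p P)) + A.twDiff φ (hom p P)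
    rw [(A.hasDeg_twDiff φ hP).degOp_eq, hP.degOp_eq, twDiff_real_smul]
    push_cast
    module

theorem twDiff_fn (A : SkewAlgebroid R S) (φ : Module.Dual R S) (f : R) :
    A.twDiff φ (fn f) = one (A.dFunTw φ f) := by
  rw [twDiff_apply, diff_fn, wedge_fn, dFunTw, one_add, one_smul']

theorem twDiff_wedge (A : SkewAlgebroid R S) (φ : Module.Dual R S) (P Q : Multi R S) :
    A.twDiff φ (wedge P Q) = wedge (A.twDiff φ P) Q + wedge (invol P) (A.twDiff φ Q) -
      wedge (one φ) (wedge P Q) := by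
  simp only [twDiff_apply, diff_wedge, map_add, LinearMap.add_apply, wedge_assoc]
  rw [← wedge_assoc (invol P), ← one_wedge_comm, wedge_assoc]
  abel

theorem diff_one_eq_zero {A : SkewAlgebroid R S} {φ : Module.Dual R S}
    (hφ : A.IsCocycle (Module.Dual.eval R S) φ) : A.diff (one φ) = 0 := by
  refine eq_zero_of_contract (by simp) fun X => eq_zero_of_contract ?_ fun Y => ?_
  · rw [contract_diff, contract_one, lie_one, diff_fn]
    simp
  · rw [contract_contract_diff_one]
    have h := hφ X Y
    simp only [Module.Dual.eval_apply] at h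
    rw [h, fn_zero]

theorem twDiff_twDiff {A : SkewAlgebroid R S} {φ : Module.Dual R S} (hA : A.IsLie)
    (hφ : A.IsCocycle (Module.Dual.eval R S) φ) (P : Multi R S) :
    A.twDiff φ (A.twDiff φ P) = 0 := by
  simp only [twDiff_apply, map_add, diff_diff hA, diff_wedge, diff_one_eq_zero hφ, map_zero,
    LinearMap.zero_apply, invol_one, map_neg, LinearMap.neg_apply, ← wedge_assoc,
    one_wedge_one_self]
  abel

end TwistedDifferential

section Koszul

/-- The bracket `δ{P, Q} + {δP, Q} - {εP, δQ}` of forms generated by `δ = d^φ` and the brace `{,}`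
of `s`. -/
def kos (A : SkewAlgebroid R S) (φ : Module.Dual R S) (s : Module.Dual R S →ₗ[R] S) :
    Multi R S →ₗ[ℝ] Multi R S →ₗ[ℝ] Multi R S :=
  LinearMap.mk₂ ℝ (fun P Q => A.twDiff φ (brace (sharpForm s) P Q) +
      brace (sharpForm s) (A.twDiff φ P) Q - brace (sharpForm s) (invol P) (A.twDiff φ Q))
    (by intro P P' Q; simp only [map_add, LinearMap.add_apply]; abel)
    (by
      intro c P Q
      rw [brace_real_smul_left, map_smul, map_smul, brace_real_smul_left,
        invol.map_smul_of_tower, brace_real_smul_left, smul_sub, smul_add])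
    (by intro P Q Q'; simp only [map_add]; abel)
    (by
      intro c P Q
      simp only [brace_real_smul_right, map_smul, smul_sub, smul_add])

variable (A : SkewAlgebroid R S) (φ : Module.Dual R S) (s : Module.Dual R S →ₗ[R] S)

theorem kos_apply (P Q : Multi R S) : A.kos φ s P Q =
    A.twDiff φ (brace (sharpForm s) P Q) + brace (sharpForm s) (A.twDiff φ P) Q -
      brace (sharpForm s) (invol P) (A.twDiff φ Q) := rfl

theorem kos_wedge {p q : ℕ} {P Q : Multi R S} (hP : HasDeg p P) (hQ : HasDeg q Q)
    (U : Multi R S) :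
    A.kos φ s P (wedge Q U) = wedge (A.kos φ s P Q) U +
      (-1 : ℝ) ^ ((p + 1) * q) • wedge Q (A.kos φ s P U) +
      (-1 : ℝ) ^ p • wedge (brace (sharpForm s) P (one φ)) (wedge Q U) := by
  simp only [kos_apply, hP.invol_eq, twDiff_wedge, hQ.invol_eq, map_add, map_sub,
    LinearMap.add_apply, LinearMap.sub_apply, hP.brace_wedge _ hQ,
    hP.brace_wedge _ (A.hasDeg_twDiff φ hQ), hP.brace_wedge _ (hasDeg_one φ),
    (A.hasDeg_twDiff φ hP).brace_wedge _ hQ, twDiff_real_smul, wedge_real_smul_left,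
    wedge_real_smul_right, brace_real_smul_left, brace_real_smul_right, invol_brace,
    smul_add, smul_sub, pow_mul, pow_succ, mul_one]
  rcases neg_one_pow_eq_or ℝ p with h | h <;> rcases neg_one_pow_eq_or ℝ q with h' | h' <;>
    simp only [h, h', one_mul, one_pow, neg_mul, mul_one, neg_neg] <;> module

theorem kos_swap {s : Module.Dual R S →ₗ[R] S} (hs : ∀ a : Module.Dual R S, a (s a) = 0) {p q : ℕ}
    {P Q : Multi R S} (hP : HasDeg p P) (hQ : HasDeg q Q) :
    A.kos φ s P Q = -(-1 : ℝ) ^ ((p + 1) * (q + 1)) • A.kos φ s Q P := by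
  rw [kos_apply, kos_apply, hP.invol_eq, hQ.invol_eq, brace_real_smul_left, brace_real_smul_left,
    hP.brace_swap hs hQ, (A.hasDeg_twDiff φ hP).brace_swap hs hQ,
    hP.brace_swap hs (A.hasDeg_twDiff φ hQ), twDiff_real_smul]
  simp only [pow_mul, pow_succ]
  rcases neg_one_pow_eq_or ℝ p with h | h <;> rcases neg_one_pow_eq_or ℝ q with h' | h' <;>
    simp only [h, h', one_pow, mul_one, neg_neg, mul_neg] <;> module

theorem kos_one_one {s : Module.Dual R S →ₗ[R] S} (hs : ∀ a : Module.Dual R S, a (s a) = 0)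
    (a b : Module.Dual R S) :
    A.kos φ s (one a) (one b) = one (A.coBracket φ s a b) := by
  have hab : a (s b) = -b (s a) := by
    have h := hs (a + b)
    simp only [map_add, LinearMap.add_apply, hs, zero_add, add_zero] at h
    linear_combination h
  have h1 : ∀ (X : S) (c : Module.Dual R S), contract X (A.twDiff φ (one c)) =
      one (A.lieDerTw φ X c) - one (A.dFunTw φ (c X)) := by
    intro X c
    rw [twDiff_apply, map_add, contract_diff, lie_one, contract_one, diff_fn, contract_wedge,
      contract_one, fn_wedge, invol_one, map_neg, LinearMap.neg_apply, contract_one, wedge_fn,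
      lieDerTw, dFunTw, one_add, one_add, one_smul', one_smul']
    abel
  rw [kos_apply, brace_one_left, invol_one, map_neg, LinearMap.neg_apply, brace_one_left,
    brace_one_right hs b (A.hasDeg_twDiff φ (hasDeg_one a)), contract_one, twDiff_fn, h1, h1, hab,
    coBracket, one_sub, one_sub]
  have h2 : A.dFunTw φ (-b (s a)) = -A.dFunTw φ (b (s a)) := by
    ext X
    simp [dFunTw, dFun]
    ring
  rw [h2, one_neg]
  abel

theorem kos_one_fn (a : Module.Dual R S) (g : R) :
    A.kos φ s (one a) (fn g) = fn (A.anchor (s a) g + g * φ (s a)) := by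
  rw [kos_apply, brace_fn_right, brace_fn_right, invol_one, map_neg, LinearMap.neg_apply,
    brace_one_left, twDiff_fn, contract_one]
  simp [dFunTw, dFun]

theorem kos_fn_fn (f g : R) : A.kos φ s (fn f) (fn g) = 0 := by
  simp [kos_apply]

theorem twDiff_kos {A : SkewAlgebroid R S} {φ : Module.Dual R S} (hA : A.IsLie)
    (hφ : A.IsCocycle (Module.Dual.eval R S) φ) (P Q : Multi R S) :
    A.twDiff φ (A.kos φ s P Q) =
      A.kos φ s (A.twDiff φ P) Q - A.kos φ s (invol P) (A.twDiff φ Q) := by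
  simp only [kos_apply, map_add, map_sub, twDiff_twDiff hA hφ, invol_twDiff, invol_invol, map_neg,
    LinearMap.neg_apply, map_zero, LinearMap.zero_apply]
  abel

theorem degOp_kos (P Q : Multi R S) : degOp (A.kos φ s P Q) =
    A.kos φ s (degOp P) Q + A.kos φ s P (degOp Q) - A.kos φ s P Q := by
  have h : degOp (invol P) = invol (degOp P) := by
    induction P using DirectSum.induction_on with
    | zero => simp
    | add P P' h h' => simp only [map_add, h, h']
    | of p P =>
      change degOp (invol (hom p P)) = invol (degOp (hom p P))
      rw [invol_hom, degOp_hom, LinearMap.map_smul_of_tower, LinearMap.map_smul_of_tower,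
        degOp_hom, invol_hom, smul_comm]
  simp only [kos_apply, map_add, map_sub, degOp_twDiff, degOp_brace, LinearMap.add_apply,
    twDiff_real_smul, h]
  module

end Koszul

end SkewAlgebroid

end Algebroid

namespace Algebroid
namespace SkewAlgebroid

variable {R S : Type*} [CommRing R] [Algebra ℝ R]
  [AddCommGroup S] [Module R S] [Module ℝ S] [IsScalarTower ℝ R S]

theorem wedge_contract_comm (w : S) {p q : ℕ} {P Q : Multi R S} (hP : HasDeg p P)
    (hQ : HasDeg q Q) :
    wedge Q (contract w P) = (-1 : ℝ) ^ ((p + 1) * q) • wedge (contract w P) Q := by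
  cases p with
  | zero => rw [hP.contract_zero, map_zero, map_zero, LinearMap.zero_apply, smul_zero]
  | succ p =>
    rw [hQ.wedge_comm (hP.contract w)]
    congr 1
    simp only [pow_mul, pow_succ]
    rw [← pow_mul, mul_comm, pow_mul]
    simp

/-- The Schouten bracket of the dual `A*_π` of a Jacobi algebroid. -/
def dualSchouten (A : SkewAlgebroid R S) (φ : Module.Dual R S) (π : Bivector R S) :
    Multi R S →ₗ[ℝ] Multi R S →ₗ[ℝ] Multi R S :=
  A.kos φ π.sharp + LinearMap.mk₂ ℝ
    (fun P Q => wedge (degOp P - P) (contract (π.sharp φ) Q) +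
      wedge (contract (π.sharp φ) (invol P)) (degOp Q - Q))
    (by intro P P' Q; simp only [map_add, map_sub, LinearMap.add_apply, LinearMap.sub_apply]; abel)
    (by
      intro c P Q
      rw [degOp.map_smul_of_tower, invol.map_smul_of_tower, contract_real_smul, ← smul_sub,
        wedge_real_smul_left, wedge_real_smul_left, smul_add])
    (by intro P Q Q'; simp only [map_add, map_sub]; abel)
    (by
      intro c P Q
      rw [degOp.map_smul_of_tower, contract_real_smul, ← smul_sub,
        wedge_real_smul_right, wedge_real_smul_right, smul_add])

variable (A : SkewAlgebroid R S) (φ : Module.Dual R S) (π : Bivector R S)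

theorem dualSchouten_apply (P Q : Multi R S) : A.dualSchouten φ π P Q =
    A.kos φ π.sharp P Q + (wedge (degOp P - P) (contract (π.sharp φ) Q) +
      wedge (contract (π.sharp φ) (invol P)) (degOp Q - Q)) := rfl

theorem dualSchouten_of_hasDeg {p q : ℕ} {P Q : Multi R S} (hP : HasDeg p P) (hQ : HasDeg q Q) :
    A.dualSchouten φ π P Q = A.kos φ π.sharp P Q +
      ((p : ℝ) - 1) • wedge P (contract (π.sharp φ) Q) +
      ((-1 : ℝ) ^ p * ((q : ℝ) - 1)) • wedge (contract (π.sharp φ) P) Q := by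
  rw [dualSchouten_apply, hP.degOp_eq, hQ.degOp_eq, hP.invol_eq, contract_real_smul,
    wedge_real_smul_left, map_sub, map_sub, LinearMap.sub_apply, wedge_real_smul_left,
    wedge_real_smul_right]
  module

theorem jacobiBracket_dualSchouten {p q : ℕ} {P Q : Multi R S} (hP : HasDeg p P)
    (hQ : HasDeg q Q) :
    jacobiBracket (A.dualSchouten φ π) (-π.sharp φ) p q P Q = A.kos φ π.sharp P Q := by
  rw [jacobiBracket, A.dualSchouten_of_hasDeg φ π hP hQ, contract_neg_left, contract_neg_left,
    map_neg, map_neg, LinearMap.neg_apply, pow_succ]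
  module

theorem isSchoutenBracket_dualSchouten :
    (A.dualOf φ π).IsSchoutenBracket LinearMap.id (A.dualSchouten φ π) where
  degree p q P Q n hn := by
    refine apply_eq_zero_of_degOp (c := (p : ℝ) + q - 1) ?_ ?_
    · rw [A.dualSchouten_of_hasDeg φ π (hasDeg_hom P) (hasDeg_hom Q)]
      simp only [map_add, degOp_kos, LinearMap.map_smul_of_tower, degOp_wedge, degOp_contract,
        degOp_hom, map_sub, LinearMap.sub_apply,
        map_smul, LinearMap.smul_apply]
      module
    · intro h
      refine hn ?_
      have : ((n + 1 : ℕ) : ℝ) = ((p + q : ℕ) : ℝ) := by push_cast; linarith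
      exact_mod_cast this
  section_section X Y := by
    rw [A.dualSchouten_of_hasDeg φ π (hasDeg_one _) (hasDeg_one _), A.kos_one_one φ π.skew]
    simp only [Nat.cast_one, sub_self, zero_smul, mul_zero, add_zero]
    rfl
  section_function X f := by
    rw [A.dualSchouten_of_hasDeg φ π (hasDeg_one _) (hasDeg_fn _), kos_one_fn, contract_one,
      wedge_fn, ← fn_smul]
    simp only [Nat.cast_one, Nat.cast_zero, sub_self, zero_smul, add_zero, pow_one, zero_sub,
      LinearMap.id_apply, mul_neg, mul_one, neg_neg, one_smul, ← fn_add]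
    rw [π.swap X φ]
    congr 1
    change A.anchor (π.sharp X) f + f * φ (π.sharp X) + f * -(φ (π.sharp X)) =
      A.anchor (π.sharp X) f
    ring
  skew p q P Q := by
    have hP := hasDeg_hom P
    have hQ := hasDeg_hom Q
    rw [A.dualSchouten_of_hasDeg φ π hP hQ, A.dualSchouten_of_hasDeg φ π hQ hP,
      A.kos_swap φ π.skew hP hQ, wedge_contract_comm _ hP hQ, wedge_contract_comm _ hQ hP]
    simp only [pow_mul, pow_succ]
    rcases neg_one_pow_eq_or ℝ p with h | h <;> rcases neg_one_pow_eq_or ℝ q with h' | h' <;>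
      simp only [h, h', one_mul, one_pow, neg_mul, mul_one, neg_neg, mul_neg] <;> module
  leibniz p q r P Q U := by
    have hP := hasDeg_hom P
    have hQ := hasDeg_hom Q
    have hU := hasDeg_hom U
    rw [A.dualSchouten_of_hasDeg φ π hP (hQ.wedge hU), A.dualSchouten_of_hasDeg φ π hP hQ,
      A.dualSchouten_of_hasDeg φ π hP hU, A.kos_wedge φ _ hP hQ, contract_wedge, hQ.invol_eq,
      brace_one_right π.skew φ hP]
    simp only [map_add, LinearMap.add_apply, wedge_real_smul_left, wedge_real_smul_right,
      map_neg, LinearMap.neg_apply]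
    rw [← wedge_assoc (hom q Q) (hom p P), hQ.wedge_comm hP,
      ← wedge_assoc (hom q Q) (contract (π.sharp φ) (hom p P)), wedge_contract_comm _ hP hQ]
    simp only [wedge_real_smul_left, wedge_assoc]
    push_cast
    rw [mul_comm q p]
    simp only [pow_mul, pow_succ]
    rcases neg_one_pow_eq_or ℝ p with h | h <;> rcases neg_one_pow_eq_or ℝ q with h' | h' <;>
      simp only [h, h', one_mul, one_pow, neg_mul, neg_neg] <;> module

end SkewAlgebroid

end Algebroid

namespace Algebroid

variable {R S : Type*} [CommRing R] [Algebra ℝ R]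
  [AddCommGroup S] [Module R S] [Module ℝ S] [IsScalarTower ℝ R S]

theorem HasDeg.neg {p : ℕ} {P : Multi R S} (hP : HasDeg p P) : HasDeg p (-P) := by
  obtain ⟨P, rfl⟩ := hP
  exact ⟨-P, (hom_neg P).symm⟩

theorem HasDeg.sub {p : ℕ} {P Q : Multi R S} (hP : HasDeg p P) (hQ : HasDeg p Q) :
    HasDeg p (P - Q) := by
  rw [sub_eq_add_neg]
  exact hP.add hQ.neg

theorem HasDeg.eq_zero_of_contract_contract {P : Multi R S} (hP : HasDeg 2 P)
    (h : ∀ X Y, Algebroid.contract Y (Algebroid.contract X P) = 0) : P = 0 := by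
  obtain ⟨P, rfl⟩ := hP
  refine eq_zero_of_contract (scalarPart_hom_succ P) fun X => eq_zero_of_contract ?_ (h X)
  rw [contract_hom_succ]
  exact scalarPart_hom_succ _

theorem contract_contract_hom_three (X Y : S) (η : Alt R S 3) :
    contract X (contract Y (hom 3 η)) = one (contractPair X Y η) := by
  rw [contract_hom_succ, contract_hom_succ, one, contractPair, Equiv.apply_symm_apply]

namespace SkewAlgebroid

section Deform

theorem deform_bracket (A : SkewAlgebroid R S) (N : S →ₗ[R] S) (X Y : S) :
    (A.deform N).bracket X Y = A.bracket (N X) Y + A.bracket X (N Y) - N (A.bracket X Y) := rfl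

theorem lie_deform (A : SkewAlgebroid R S) (N : S →ₗ[R] S) (X : S) (P : Multi R S) :
    (A.deform N).lie X P = ins N (A.lie X P) - A.lie X (ins N P) + A.lie (N X) P := by
  rw [← sub_eq_zero]
  refine eq_zero_of_contract₁ (fun P => (A.deform N).lie X P -
    (ins N (A.lie X P) - A.lie X (ins N P) + A.lie (N X) P)) ?_ ?_ ?_ P
  · intro P P'
    simp only [map_add]
    abel
  · intro P
    simp only [map_sub, map_add, scalarPart_lie, scalarPart_ins, map_zero]
    change A.anchor (N X) _ - _ = _
    ring
  · intro t P h
    simp only [map_sub, map_add, contract_lie, contract_ins, deform_bracket, contract_sub_left,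
      contract_add_left]
    linear_combination (norm := module) h

theorem diff_deform (A : SkewAlgebroid R S) (N : S →ₗ[R] S) (P : Multi R S) :
    (A.deform N).diff P = ins N (A.diff P) - A.diff (ins N P) := by
  rw [← sub_eq_zero]
  refine eq_zero_of_contract₁ (fun P => (A.deform N).diff P -
    (ins N (A.diff P) - A.diff (ins N P))) ?_ ?_ ?_ P
  · intro P P'
    simp only [map_add]
    abel
  · intro P
    simp
  · intro t P h
    simp only [map_sub, map_add, contract_diff, contract_ins, lie_deform]
    linear_combination (norm := module) -h

theorem twDiff_deform (A : SkewAlgebroid R S) (N : S →ₗ[R] S) (φ : Module.Dual R S)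
    (P : Multi R S) : (A.deform N).twDiff (N.dualMap φ) P =
      ins N (A.twDiff φ P) - A.twDiff φ (ins N P) := by
  simp only [twDiff_apply, diff_deform, map_add, ins_wedge, ins_one]
  abel

end Deform

section Concomitant

variable (A : SkewAlgebroid R S) (φ : Module.Dual R S) (s : Module.Dual R S →ₗ[R] S)
  (N : S →ₗ[R] S)

/-- The extension to forms of the Magri-Morosi concomitant. -/
def concomitant (P Q : Multi R S) : Multi R S :=
  A.kos φ (N ∘ₗ s) P Q + ins N (A.kos φ s P Q) - A.kos φ s (ins N P) Q - A.kos φ s P (ins N Q)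

variable {s N}

theorem concomitant_wedge (hs : ∀ a : Module.Dual R S, a (s a) = 0)
    (hNs : ∀ a : Module.Dual R S, a (N (s a)) = 0) {p q : ℕ} {P Q : Multi R S}
    (hP : HasDeg p P) (hQ : HasDeg q Q) (U : Multi R S) :
    A.concomitant φ s N P (wedge Q U) = wedge (A.concomitant φ s N P Q) U +
      (-1 : ℝ) ^ ((p + 1) * q) • wedge Q (A.concomitant φ s N P U) := by
  simp only [concomitant, ins_wedge, map_add, map_sub, LinearMap.add_apply, LinearMap.sub_apply,
    A.kos_wedge φ _ hP hQ, A.kos_wedge φ _ (hP.ins N) hQ, A.kos_wedge φ _ hP (hQ.ins N),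
    LinearMap.map_smul_of_tower, brace_one_right hs φ hP, brace_one_right hs φ (hP.ins N),
    brace_one_right (s := N ∘ₗ s) hNs φ hP, contract_ins, map_neg, LinearMap.neg_apply,
    LinearMap.comp_apply]
  module

theorem concomitant_swap (hs : ∀ a : Module.Dual R S, a (s a) = 0)
    (hNs : ∀ a : Module.Dual R S, a (N (s a)) = 0) {p q : ℕ} {P Q : Multi R S}
    (hP : HasDeg p P) (hQ : HasDeg q Q) :
    A.concomitant φ s N P Q =
      -(-1 : ℝ) ^ ((p + 1) * (q + 1)) • A.concomitant φ s N Q P := by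
  rw [concomitant, concomitant, A.kos_swap φ hs hP hQ, A.kos_swap φ (s := N ∘ₗ s) hNs hP hQ,
    A.kos_swap φ hs (hP.ins N) hQ, A.kos_swap φ hs hP (hQ.ins N), LinearMap.map_smul_of_tower]
  module

theorem concomitant_one_fn (hcomm : N ∘ₗ s = s ∘ₗ N.dualMap) (a : Module.Dual R S) (g : R) :
    A.concomitant φ s N (one a) (fn g) = 0 := by
  simp only [concomitant, ins_fn, map_zero, ins_one, kos_one_fn]
  rw [hcomm]
  simp

theorem concomitant_fn_fn (f g : R) : A.concomitant φ s N (fn f) (fn g) = 0 := by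
  simp [concomitant, kos_fn_fn]

theorem concomitant_eq_zero_of_generators
    (hloc : IsLocallyDualizable (LinearMap.id : Module.Dual R S →ₗ[R] Module.Dual R S))
    (hs : ∀ a : Module.Dual R S, a (s a) = 0)
    (hNs : ∀ a : Module.Dual R S, a (N (s a)) = 0) {p : ℕ} {P : Multi R S} (hP : HasDeg p P)
    (h0 : ∀ g, A.concomitant φ s N P (fn g) = 0)
    (h1 : ∀ b, A.concomitant φ s N P (one b) = 0) (Q : Multi R S) :
    A.concomitant φ s N P Q = 0 := by
  refine eq_zero_of_local hloc (A.concomitant φ s N P) ?_ ?_ h0 ?_ Q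
  · intro Q Q'
    simp only [concomitant, map_add]
    abel
  · intro f Q
    rw [← fn_wedge, A.concomitant_wedge φ hs hNs hP (hasDeg_fn f), h0, fn_wedge]
    simp
  · intro e Q hQ
    rw [A.concomitant_wedge φ hs hNs hP (hasDeg_one _), h1, hQ]
    simp

theorem concomitant_eq_zero
    (hloc : IsLocallyDualizable (LinearMap.id : Module.Dual R S →ₗ[R] Module.Dual R S))
    (hs : ∀ a : Module.Dual R S, a (s a) = 0)
    (hNs : ∀ a : Module.Dual R S, a (N (s a)) = 0)
    (hcomm : N ∘ₗ s = s ∘ₗ N.dualMap)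
    (h1 : ∀ a b, A.concomitant φ s N (one a) (one b) = 0) (P Q : Multi R S) :
    A.concomitant φ s N P Q = 0 := by
  have hfn : ∀ g Q, A.concomitant φ s N (fn g) Q = 0 := by
    intro g
    refine A.concomitant_eq_zero_of_generators φ hloc hs hNs (hasDeg_fn g)
      (A.concomitant_fn_fn φ g) fun b => ?_
    rw [A.concomitant_swap φ hs hNs (hasDeg_fn g) (hasDeg_one b),
      A.concomitant_one_fn φ hcomm, smul_zero]
  have hone : ∀ a Q, A.concomitant φ s N (one a) Q = 0 := fun a =>
    A.concomitant_eq_zero_of_generators φ hloc hs hNs (hasDeg_one a)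
      (A.concomitant_one_fn φ hcomm a) (h1 a)
  induction P using DirectSum.induction_on with
  | zero => simp [concomitant]
  | add P P' h h' =>
    have : A.concomitant φ s N (P + P') Q =
        A.concomitant φ s N P Q + A.concomitant φ s N P' Q := by
      simp only [concomitant, map_add, LinearMap.add_apply]
      abel
    rw [this, h, h', add_zero]
  | of p P =>
    refine A.concomitant_eq_zero_of_generators φ hloc hs hNs (hasDeg_hom P) (fun g => ?_)
      (fun b => ?_) Q
    · rw [A.concomitant_swap φ hs hNs (hasDeg_hom P) (hasDeg_fn g), hfn, smul_zero]
    · rw [A.concomitant_swap φ hs hNs (hasDeg_hom P) (hasDeg_one b), hone, smul_zero]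

end Concomitant

section QuasiDifferential

variable {A : SkewAlgebroid R S} {φ : Module.Dual R S} {π : Bivector R S} {N : S →ₗ[R] S}

theorem IsCompatible.skew (h : A.IsCompatible φ π N) (a : Module.Dual R S) :
    a (N (π.sharp a)) = 0 := by
  have h1 : N (π.sharp a) = π.sharp (N.dualMap a) := LinearMap.congr_fun h.comm a
  have h2 : a (N (π.sharp a)) = -a (N (π.sharp a)) := by
    conv_lhs => rw [h1, π.swap]
    rfl
  refine nsmul_cancel two_ne_zero (?_ : 2 • _ = 2 • (0 : R))
  rw [smul_zero, two_nsmul]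
  linear_combination h2

theorem IsCompatible.ins_kos (h : A.IsCompatible φ π N)
    (hloc : IsLocallyDualizable (LinearMap.id : Module.Dual R S →ₗ[R] Module.Dual R S))
    (P Q : Multi R S) :
    ins N (A.kos φ π.sharp P Q) = A.kos φ π.sharp (ins N P) Q + A.kos φ π.sharp P (ins N Q) -
      A.kos φ (N ∘ₗ π.sharp) P Q := by
  have h1 := A.concomitant_eq_zero φ hloc π.skew h.skew h.comm (fun a b => ?_) P Q
  · rw [SkewAlgebroid.concomitant] at h1
    linear_combination (norm := module) h1
  · rw [SkewAlgebroid.concomitant, ins_one, ins_one, A.kos_one_one φ (s := N ∘ₗ π.sharp) h.skew,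
      A.kos_one_one φ π.skew, A.kos_one_one φ π.skew, A.kos_one_one φ π.skew, h.concomitant,
      ins_one, ← one_add, ← one_sub, ← one_sub]
    refine (congrArg one ?_).trans one_zero
    change A.coBracket φ π.sharp (N.dualMap a) b + A.coBracket φ π.sharp a (N.dualMap b) -
      N.dualMap (A.coBracket φ π.sharp a b) + N.dualMap (A.coBracket φ π.sharp a b) -
      A.coBracket φ π.sharp (N.dualMap a) b - A.coBracket φ π.sharp a (N.dualMap b) = 0
    abel

theorem IsCompatible.twDiff_deform_kos (h : A.IsCompatible φ π N)
    (hloc : IsLocallyDualizable (LinearMap.id : Module.Dual R S →ₗ[R] Module.Dual R S))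
    (hA : A.IsLie) (hφ : A.IsCocycle (Module.Dual.eval R S) φ) (P Q : Multi R S) :
    (A.deform N).twDiff (N.dualMap φ) (A.kos φ π.sharp P Q) =
      A.kos φ π.sharp ((A.deform N).twDiff (N.dualMap φ) P) Q -
        A.kos φ π.sharp (invol P) ((A.deform N).twDiff (N.dualMap φ) Q) := by
  simp only [twDiff_deform, h.ins_kos hloc, twDiff_kos _ hA hφ, map_add, map_sub,
    LinearMap.sub_apply, invol_ins]
  abel

end QuasiDifferential

section Square

variable {A : SkewAlgebroid R S} {φ : Module.Dual R S} {π : Bivector R S} {N : S →ₗ[R] S}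

/-- The operator `[i_N, d_N] - [i_{N²}, d]`, with twisted differentials. -/
def defect (A : SkewAlgebroid R S) (φ : Module.Dual R S) (N : S →ₗ[R] S) (P : Multi R S) :
    Multi R S :=
  ins N ((A.deform N).twDiff (N.dualMap φ) P) - (A.deform N).twDiff (N.dualMap φ) (ins N P) -
    (A.deform (N ∘ₗ N)).twDiff ((N ∘ₗ N).dualMap φ) P

theorem defect_wedge (P Q : Multi R S) :
    A.defect φ N (wedge P Q) = wedge (A.defect φ N P) Q + wedge (invol P) (A.defect φ N Q) := by
  have h : (N ∘ₗ N).dualMap φ = N.dualMap (N.dualMap φ) := rfl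
  simp only [defect, twDiff_wedge, ins_wedge, map_add, map_sub, LinearMap.sub_apply,
    invol_ins, ins_one, h]
  abel

theorem defect_fn (f : R) : A.defect φ N (fn f) = 0 := by
  simp only [defect, twDiff_fn, ins_fn, map_zero, ins_one, sub_zero]
  exact sub_self _

theorem contract_contract_twDiff_one (a : Module.Dual R S) (X Y : S) :
    contract Y (contract X (A.twDiff φ (one a))) =
      fn (A.anchor X (a Y) - A.anchor Y (a X) - a (A.bracket X Y) + φ X * a Y - a X * φ Y) := by
  rw [twDiff_apply, map_add, map_add, contract_contract_diff_one, contract_wedge, contract_one,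
    contract_one, fn_wedge, invol_one, wedge_fn, map_add, map_smul, map_smul, map_neg,
    contract_one, contract_one, ← fn_neg, ← fn_smul, ← fn_smul, ← fn_add, ← fn_add]
  congr 1
  ring

theorem defect_one (a : Module.Dual R S) (X Y : S) :
    contract Y (contract X (A.defect φ N (one a))) = -(2 : ℝ) • fn (a (A.torsion N X Y)) := by
  simp only [defect, twDiff_deform, map_sub, map_add, ins_one, contract_ins,
    contract_contract_twDiff_one, ins_fn, LinearMap.comp_apply, zero_add]
  have h2 : ∀ f : R, -(2 : ℝ) • (fn f : Multi R S) = fn (-(f + f)) := by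
    intro f
    rw [fn_neg, fn_add]
    module
  rw [h2]
  simp only [← fn_add, ← fn_sub]
  congr 1
  simp only [torsion, deform_bracket, map_add, map_sub, LinearMap.dualMap_apply,
    LinearMap.comp_apply]
  ring

theorem defect_eq (hloc : IsLocallyDualizable (LinearMap.id : Module.Dual R S →ₗ[R] Module.Dual R S))
    {η : Alt R S 3} (hT : ∀ X Y, A.torsion N X Y = -π.sharp (contractPair X Y η))
    (P : Multi R S) :
    A.defect φ N P = -(2 : ℝ) • brace (sharpForm π.sharp) (hom 3 η) P := by
  have hη := hasDeg_hom η
  have h1 : ∀ a, A.defect φ N (one a) + (2 : ℝ) • brace (sharpForm π.sharp) (hom 3 η) (one a) =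
      0 := by
    intro a
    rw [brace_one_right π.skew a hη]
    refine HasDeg.eq_zero_of_contract_contract ?_ fun X Y => ?_
    · rw [two_smul]
      refine HasDeg.add (HasDeg.sub (HasDeg.sub ?_ ?_) ?_) (HasDeg.add ?_ ?_)
      · exact (hasDeg_twDiff _ _ (hasDeg_one a)).ins N
      · exact hasDeg_twDiff _ _ ((hasDeg_one a).ins N)
      · exact hasDeg_twDiff _ _ (hasDeg_one a)
      · exact (hη.contract _).neg
      · exact (hη.contract _).neg
    · have h3 : contract Y (contract X (contract (π.sharp a) (hom 3 η))) =
          fn (a (π.sharp (contractPair X Y η))) := by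
        rw [contract_contract_swap X, map_neg, contract_contract_swap Y, neg_neg,
          contract_contract_swap Y, contract_contract_hom_three, map_neg, contract_one,
          π.swap, fn_neg, neg_neg]
      rw [map_add, map_add, defect_one, hT, contract_real_smul, contract_real_smul, map_neg,
        map_neg, map_neg, h3, fn_neg]
      module
  have h2 : A.defect φ N P + (2 : ℝ) • brace (sharpForm π.sharp) (hom 3 η) P = 0 := by
    have hw : ∀ {q : ℕ} {Q : Multi R S}, HasDeg q Q → ∀ U, A.defect φ N (wedge Q U) +
        (2 : ℝ) • brace (sharpForm π.sharp) (hom 3 η) (wedge Q U) =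
        wedge (A.defect φ N Q + (2 : ℝ) • brace (sharpForm π.sharp) (hom 3 η) Q) U +
        (-1 : ℝ) ^ q • wedge Q (A.defect φ N U +
          (2 : ℝ) • brace (sharpForm π.sharp) (hom 3 η) U) := by
      intro q Q hQ U
      rw [defect_wedge, hη.brace_wedge _ hQ, hQ.invol_eq, pow_mul]
      simp only [map_add, LinearMap.add_apply, wedge_real_smul_left, wedge_real_smul_right,
        (by norm_num : (-1 : ℝ) ^ 3 = -1)]
      module
    refine eq_zero_of_local hloc (fun P => A.defect φ N P +
      (2 : ℝ) • brace (sharpForm π.sharp) (hom 3 η) P) ?_ ?_ ?_ ?_ P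
    · intro P Q
      simp only [defect, map_add, smul_add]
      abel
    · intro f Q
      have := hw (hasDeg_fn f) Q
      rw [defect_fn, brace_fn_right] at this
      simpa [fn_wedge] using this
    · intro f
      simp only [defect_fn, brace_fn_right, smul_zero, add_zero]
    · intro e Q hQ
      beta_reduce at hQ ⊢
      simp only [hw (hasDeg_one _), h1, hQ]
      simp
  linear_combination (norm := module) h2

theorem twDiff_defect (hA : A.IsLie) (hφ : A.IsCocycle (Module.Dual.eval R S) φ)
    (P : Multi R S) :
    A.twDiff φ (A.defect φ N P) + A.defect φ N (A.twDiff φ P) =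
      -(2 : ℝ) • (A.deform N).twDiff (N.dualMap φ) ((A.deform N).twDiff (N.dualMap φ) P) := by
  simp only [defect, twDiff_deform, map_sub, twDiff_twDiff hA hφ, map_zero]
  module

theorem twDiff_deform_twDiff_deform
    (hloc : IsLocallyDualizable (LinearMap.id : Module.Dual R S →ₗ[R] Module.Dual R S))
    (hA : A.IsLie) (hφ : A.IsCocycle (Module.Dual.eval R S) φ)
    {η : Alt R S 3} (hT : ∀ X Y, A.torsion N X Y = -π.sharp (contractPair X Y η))
    (hη : A.twDiff φ (hom 3 η) = 0) (P : Multi R S) :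
    (A.deform N).twDiff (N.dualMap φ) ((A.deform N).twDiff (N.dualMap φ) P) =
      A.kos φ π.sharp (hom 3 η) P := by
  have h := twDiff_defect (N := N) hA hφ P
  rw [defect_eq hloc hT, defect_eq hloc hT, twDiff_real_smul] at h
  refine two_smul_cancel ?_
  rw [kos_apply, hη, invol_hom, brace_real_smul_left, map_zero, LinearMap.zero_apply]
  linear_combination (norm := module) h

end Square

end SkewAlgebroid

end Algebroid

namespace Algebroid

variable {R S : Type*} [CommRing R] [Algebra ℝ R]
  [AddCommGroup S] [Module R S] [Module ℝ S] [IsScalarTower ℝ R S]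

theorem Bivector.contract_toAlt (π : Bivector R S) (α : Module.Dual R S) :
    contract α (hom 2 π.toAlt) = one (Module.Dual.eval R S (π.sharp α)) := by
  rw [contract_hom_succ, one]
  congr 1

namespace SkewAlgebroid

section Schouten

variable {T : Type*} [AddCommGroup T] [Module R T] {A : SkewAlgebroid R S}
  {pair : S →ₗ[R] T →ₗ[R] R} {br : Multi R T →ₗ[ℝ] Multi R T →ₗ[ℝ] Multi R T}

theorem IsSchoutenBracket.hasDeg (h : A.IsSchoutenBracket pair br) {p q n : ℕ} {P Q : Multi R T}
    (hP : HasDeg p P) (hQ : HasDeg q Q) (hn : n + 1 = p + q) : HasDeg n (br P Q) := by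
  obtain ⟨P, rfl⟩ := hP
  obtain ⟨Q, rfl⟩ := hQ
  refine ⟨br (hom p P) (hom q Q) n, DFinsupp.ext fun m => ?_⟩
  by_cases hm : m = n
  · subst hm
    exact (DirectSum.of_eq_same _ _).symm
  · refine (h.degree p q P Q m ?_).trans (DirectSum.of_eq_of_ne _ _ _ hm).symm
    omega

theorem IsSchoutenBracket.swap (h : A.IsSchoutenBracket pair br) {p q : ℕ} {P Q : Multi R T}
    (hP : HasDeg p P) (hQ : HasDeg q Q) :
    br P Q = -(-1 : ℝ) ^ ((p + 1) * (q + 1)) • br Q P := by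
  obtain ⟨P, rfl⟩ := hP
  obtain ⟨Q, rfl⟩ := hQ
  exact h.skew p q P Q

theorem IsSchoutenBracket.wedge_right (h : A.IsSchoutenBracket pair br) {p q : ℕ}
    {P Q : Multi R T} (hP : HasDeg p P) (hQ : HasDeg q Q) (U : Multi R T) :
    br P (wedge Q U) = wedge (br P Q) U + (-1 : ℝ) ^ ((p + 1) * q) • wedge Q (br P U) := by
  obtain ⟨P, rfl⟩ := hP
  obtain ⟨Q, rfl⟩ := hQ
  induction U using DirectSum.induction_on with
  | zero => simp
  | add U U' h h' => simp only [map_add, h, h', smul_add]; abel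
  | of r U => exact h.leibniz p q r P Q U

theorem IsSchoutenBracket.fn_fn (h : A.IsSchoutenBracket pair br) (f g : R) :
    br (fn f) (fn g) = 0 :=
  DFinsupp.ext fun n => h.degree 0 0 _ _ n (by omega)

end Schouten

section Dual

variable {A : SkewAlgebroid R S}
  {br : Multi R (Module.Dual R S) →ₗ[ℝ] Multi R (Module.Dual R S) →ₗ[ℝ] Multi R (Module.Dual R S)}

theorem IsSchoutenBracket.fn_left (h : A.IsSchoutenBracket (Module.Dual.eval R S) br)
    (hloc : IsLocallyDualizable (Module.Dual.eval R S)) (g : R)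
    (Q : Multi R (Module.Dual R S)) : br (fn g) Q = -contract (A.dFun g) Q := by
  rw [← sub_eq_zero, sub_neg_eq_add]
  have hw : ∀ {q : ℕ} {Q : Multi R (Module.Dual R S)}, HasDeg q Q → ∀ U,
      br (fn g) (wedge Q U) + contract (A.dFun g) (wedge Q U) =
        wedge (br (fn g) Q + contract (A.dFun g) Q) U +
          (-1 : ℝ) ^ q • wedge Q (br (fn g) U + contract (A.dFun g) U) := by
    intro q Q hQ U
    rw [h.wedge_right (hasDeg_fn g) hQ, contract_wedge, hQ.invol_eq, zero_add, one_mul]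
    simp only [map_add, LinearMap.add_apply, wedge_real_smul_left]
    module
  refine eq_zero_of_local hloc (fun Q => br (fn g) Q + contract (A.dFun g) Q) ?_ ?_ ?_ ?_ Q
  · intro P Q
    simp only [map_add]
    abel
  · intro f Q
    have := hw (hasDeg_fn f) Q
    rw [h.fn_fn, contract_fn] at this
    simpa [fn_wedge] using this
  · intro f
    simp [h.fn_fn]
  · intro X Q hQ
    beta_reduce at hQ ⊢
    rw [hw (hasDeg_one _), hQ, h.swap (hasDeg_fn g) (hasDeg_one _), h.section_function,
      contract_one]
    simp [dFun]

theorem IsSchoutenBracket.contract_section (h : A.IsSchoutenBracket (Module.Dual.eval R S) br)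
    (hloc : IsLocallyDualizable (Module.Dual.eval R S)) (X : S) (α : Module.Dual R S)
    (Q : Multi R (Module.Dual R S)) :
    contract α (br (one (Module.Dual.eval R S X)) Q) =
      br (one (Module.Dual.eval R S X)) (contract α Q) - contract (A.lieDer X α) Q := by
  rw [← sub_eq_zero]
  set K : Multi R (Module.Dual R S) → Multi R (Module.Dual R S) := fun Q =>
    contract α (br (one (Module.Dual.eval R S X)) Q) -
      (br (one (Module.Dual.eval R S X)) (contract α Q) - contract (A.lieDer X α) Q) with hK
  have hw : ∀ {q : ℕ} {Q : Multi R (Module.Dual R S)}, HasDeg q Q → ∀ U,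
      K (wedge Q U) = wedge (K Q) U + (-1 : ℝ) ^ q • wedge Q (K U) := by
    intro q Q hQ U
    have h1 : ∀ U, br (one (Module.Dual.eval R S X)) (wedge Q U) =
        wedge (br (one (Module.Dual.eval R S X)) Q) U +
          wedge Q (br (one (Module.Dual.eval R S X)) U) := by
      intro U
      rw [h.wedge_right (hasDeg_one _) hQ, pow_mul]
      norm_num
    have h2 : br (one (Module.Dual.eval R S X)) (wedge (contract α Q) U) =
        wedge (br (one (Module.Dual.eval R S X)) (contract α Q)) U +
          wedge (contract α Q) (br (one (Module.Dual.eval R S X)) U) := by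
      cases q with
      | zero => simp [hQ.contract_zero]
      | succ q =>
        rw [h.wedge_right (hasDeg_one _) (hQ.contract α), pow_mul]
        norm_num
    simp only [hK, h1, h2, contract_wedge, hQ.invol_eq, map_add, map_sub, LinearMap.sub_apply,
      wedge_real_smul_left, map_smul,
      (h.hasDeg (hasDeg_one _) hQ (add_comm q 1)).invol_eq, smul_add, smul_sub]
    module
  have hfn : ∀ f, K (fn f) = 0 := by
    intro f
    simp only [hK, h.section_function, contract_fn, map_zero, sub_zero]
  refine eq_zero_of_local hloc K ?_ ?_ hfn ?_ Q
  · intro P Q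
    simp only [hK, map_add]
    abel
  · intro f Q
    have := hw (hasDeg_fn f) Q
    rw [hfn] at this
    simpa [fn_wedge] using this
  · intro Y Q hQ
    rw [hw (hasDeg_one _), hQ]
    simp only [hK, h.section_section, contract_one, h.section_function, Module.Dual.eval_apply,
      lieDer, LinearMap.coe_mk, AddHom.coe_mk, fn_sub]
    simp

/-- The endomorphism `β ↦ i_{π^♯ β} dα` of `Γ(A*)`. -/
def contractDiff (A : SkewAlgebroid R S) (s : Module.Dual R S →ₗ[R] S) (α : Module.Dual R S) :
    Module.Dual R S →ₗ[R] Module.Dual R S where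
  toFun β := A.lieDer (s β) α - A.dFun (α (s β))
  map_add' β γ := by
    ext Y
    simp only [lieDer, dFun, map_add, LinearMap.add_apply, LinearMap.sub_apply, LinearMap.coe_mk,
      AddHom.coe_mk, Derivation.add_apply]
    ring
  map_smul' f β := by
    ext Y
    simp only [lieDer, dFun, map_smul, A.leibniz_left, map_sub, LinearMap.smul_apply,
      LinearMap.sub_apply, LinearMap.coe_mk, AddHom.coe_mk, Derivation.smul_apply, smul_eq_mul,
      Derivation.leibniz, RingHom.id_apply]
    ring

theorem contractDiff_apply (s : Module.Dual R S →ₗ[R] S) (α β : Module.Dual R S) (Y : S) :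
    A.contractDiff s α β Y =
      A.anchor (s β) (α Y) - α (A.bracket (s β) Y) - A.anchor Y (α (s β)) := rfl

variable (π : Bivector R S)

theorem IsSchoutenBracket.bivector_section
    (h : A.IsSchoutenBracket (Module.Dual.eval R S) br) (Y : S) :
    br (hom 2 π.toAlt) (one (Module.Dual.eval R S Y)) =
      -br (one (Module.Dual.eval R S Y)) (hom 2 π.toAlt) := by
  rw [h.swap (hasDeg_hom π.toAlt) (hasDeg_one _)]
  norm_num

theorem IsSchoutenBracket.bivector_fn (h : A.IsSchoutenBracket (Module.Dual.eval R S) br)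
    (hloc : IsLocallyDualizable (Module.Dual.eval R S)) (f : R) :
    br (hom 2 π.toAlt) (fn f) = -one (Module.Dual.eval R S (π.sharp (A.dFun f))) := by
  rw [h.swap (hasDeg_hom π.toAlt) (hasDeg_fn f), h.fn_left hloc, π.contract_toAlt]
  norm_num

theorem IsSchoutenBracket.contract_section_bivector
    (h : A.IsSchoutenBracket (Module.Dual.eval R S) br)
    (hloc : IsLocallyDualizable (Module.Dual.eval R S)) (X : S) (α : Module.Dual R S) :
    contract α (br (one (Module.Dual.eval R S X)) (hom 2 π.toAlt)) =
      one (Module.Dual.eval R S (A.bracket X (π.sharp α) - π.sharp (A.lieDer X α))) := by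
  rw [h.contract_section hloc, π.contract_toAlt, π.contract_toAlt, h.section_section, map_sub,
    one_sub]

theorem IsSchoutenBracket.contract_bivector (h : A.IsSchoutenBracket (Module.Dual.eval R S) br)
    (hloc : IsLocallyDualizable (Module.Dual.eval R S)) (α : Module.Dual R S)
    (Q : Multi R (Module.Dual R S)) :
    contract α (br (hom 2 π.toAlt) Q) + br (hom 2 π.toAlt) (contract α Q) =
      br (one (Module.Dual.eval R S (π.sharp α))) Q + ins (A.contractDiff π.sharp α) Q := by
  rw [← sub_eq_zero]
  have hπ := hasDeg_hom π.toAlt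
  set K : Multi R (Module.Dual R S) → Multi R (Module.Dual R S) := fun Q =>
    contract α (br (hom 2 π.toAlt) Q) + br (hom 2 π.toAlt) (contract α Q) -
      (br (one (Module.Dual.eval R S (π.sharp α))) Q + ins (A.contractDiff π.sharp α) Q) with hK
  have hw : ∀ {q : ℕ} {Q : Multi R (Module.Dual R S)}, HasDeg q Q → ∀ U,
      K (wedge Q U) = wedge (K Q) U + wedge Q (K U) := by
    intro q Q hQ U
    have h1 : ∀ {q : ℕ} {Q : Multi R (Module.Dual R S)}, HasDeg q Q → ∀ U,
        br (hom 2 π.toAlt) (wedge Q U) = wedge (br (hom 2 π.toAlt) Q) U +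
          wedge (invol Q) (br (hom 2 π.toAlt) U) := by
      intro q Q hQ U
      rw [h.wedge_right hπ hQ, pow_mul, hQ.invol_eq, wedge_real_smul_left]
      norm_num
    have h2 : br (hom 2 π.toAlt) (wedge (contract α Q) U) =
        wedge (br (hom 2 π.toAlt) (contract α Q)) U +
          wedge (invol (contract α Q)) (br (hom 2 π.toAlt) U) := by
      cases q with
      | zero => simp [hQ.contract_zero]
      | succ q => exact h1 (hQ.contract α) U
    have h3 : br (one (Module.Dual.eval R S (π.sharp α))) (wedge Q U) =
        wedge (br (one (Module.Dual.eval R S (π.sharp α))) Q) U +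
          wedge Q (br (one (Module.Dual.eval R S (π.sharp α))) U) := by
      rw [h.wedge_right (hasDeg_one _) hQ, pow_mul]
      norm_num
    have h4 : invol (br (hom 2 π.toAlt) Q) = -br (hom 2 π.toAlt) (invol Q) := by
      rw [(h.hasDeg hπ hQ (by omega : q + 1 + 1 = 2 + q)).invol_eq, hQ.invol_eq, map_smul,
        pow_succ]
      module
    have h6 : HasDeg q (invol Q) := by
      obtain ⟨Q, rfl⟩ := hQ
      rcases invol_hom_eq_or Q with e | e <;> rw [e]
      · exact hasDeg_hom Q
      · exact ⟨-Q, (hom_neg Q).symm⟩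
    simp only [hK, h1 hQ, h2, h3, h1 h6, h4, contract_wedge, contract_invol, invol_invol, ins_wedge,
      map_add, map_sub, map_neg, LinearMap.add_apply, LinearMap.sub_apply, LinearMap.neg_apply]
    abel
  have hfn : ∀ f, K (fn f) = 0 := by
    intro f
    simp only [hK, h.bivector_fn π hloc, contract_fn, map_zero, h.section_function, ins_fn, map_neg,
      contract_one, Module.Dual.eval_apply, ← fn_neg, add_zero, ← fn_sub]
    rw [π.swap]
    refine (congrArg fn ?_).trans fn_zero
    simp [dFun]
  refine eq_zero_of_local hloc K ?_ ?_ hfn ?_ Q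
  · intro P Q
    simp only [hK, map_add]
    abel
  · intro f Q
    have := hw (hasDeg_fn f) Q
    rw [hfn] at this
    simpa [fn_wedge] using this
  · intro Y Q hQ
    rw [hw (hasDeg_one _), hQ, map_zero, add_zero]
    have h1 : K (one (Module.Dual.eval R S Y)) = 0 := by
      simp only [hK, h.bivector_section, h.section_section, contract_one, h.bivector_fn π hloc,
        map_neg, ins_one, h.contract_section_bivector π hloc, Module.Dual.eval_apply, ← one_neg,
        ← one_add, ← one_sub]
      refine (congrArg one ?_).trans one_zero
      ext β
      simp only [LinearMap.sub_apply, LinearMap.add_apply, LinearMap.neg_apply,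
        Module.Dual.eval_apply, LinearMap.dualMap_apply, contractDiff_apply, map_sub,
        LinearMap.zero_apply, π.swap β, A.bracket_swap (π.sharp α) Y,
        A.bracket_swap (π.sharp β) Y, map_neg]
      simp only [lieDer, dFun, LinearMap.coe_mk, AddHom.coe_mk]
      ring
    rw [h1, map_zero, LinearMap.zero_apply]

end Dual

end SkewAlgebroid

end Algebroid

namespace Algebroid

variable {R S : Type*} [CommRing R] [Algebra ℝ R]
  [AddCommGroup S] [Module R S] [Module ℝ S] [IsScalarTower ℝ R S]

namespace SkewAlgebroid

section Morphism

variable {A : SkewAlgebroid R S} {φ : Module.Dual R S} {π : Bivector R S}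

/-- The map `π^♯` of a Jacobi bivector preserves brackets. -/
theorem IsJacobiBivector.sharp_coBracket (h : A.IsJacobiBivector φ π)
    (hloc : IsLocallyDualizable (Module.Dual.eval R S))
    (hsep : ∀ X : S, (∀ α : Module.Dual R S, α X = 0) → X = 0) (α β : Module.Dual R S) :
    π.sharp (A.coBracket φ π.sharp α β) = A.bracket (π.sharp α) (π.sharp β) := by
  obtain ⟨br, hbr, h0⟩ := h
  have hπ := hasDeg_hom π.toAlt
  rw [← sub_eq_zero]
  refine hsep _ fun γ => ?_
  have h1 : contract α (br (hom 2 π.toAlt) (hom 2 π.toAlt)) =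
      (2 : ℝ) • br (one (Module.Dual.eval R S (π.sharp α))) (hom 2 π.toAlt) +
        ins (A.contractDiff π.sharp α) (hom 2 π.toAlt) := by
    have := hbr.contract_bivector π hloc α (hom 2 π.toAlt)
    rw [π.contract_toAlt, hbr.bivector_section] at this
    linear_combination (norm := module) this
  have h2 : br (hom 2 π.toAlt) (hom 2 π.toAlt) +
      (2 : ℝ) • wedge (one (Module.Dual.eval R S (π.sharp φ))) (hom 2 π.toAlt) = 0 := by
    rw [jacobiBracket, π.contract_toAlt, hπ.wedge_comm (hasDeg_one _)] at h0
    norm_num at h0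
    linear_combination (norm := module) h0
  have h3 := congrArg (fun P => contract γ (contract β (contract α P))) h2
  simp only [map_add, map_zero, h1, contract_real_smul, hbr.contract_section_bivector π hloc,
    contract_ins, π.contract_toAlt, ins_one, contract_wedge, contract_one, fn_wedge, invol_one,
    map_neg, LinearMap.neg_apply, map_smul, wedge_fn, Module.Dual.eval_apply,
    LinearMap.dualMap_apply, ← fn_smul] at h3
  have h4 := congrArg scalarPart h3
  simp only [map_add, map_neg, map_zero, scalarPart_fn, LinearMap.map_smul_of_tower] at h4
  refine nsmul_cancel two_ne_zero (?_ : 2 • _ = 2 • (0 : R))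
  rw [smul_zero, two_nsmul]
  simp only [two_smul, map_sub, π.swap γ, contractDiff_apply, coBracket, lieDerTw, lieDer, dFunTw,
    dFun, LinearMap.add_apply, LinearMap.smul_apply, LinearMap.coe_mk,
    AddHom.coe_mk, smul_eq_mul, π.swap α β, π.swap α φ, π.swap β φ, map_neg,
    A.bracket_swap (π.sharp γ) (π.sharp β)] at h4 ⊢
  linear_combination -h4

theorem IsJacobiBivector.isCocycle (h : A.IsJacobiBivector φ π)
    (hloc : IsLocallyDualizable (Module.Dual.eval R S))
    (hsep : ∀ X : S, (∀ α : Module.Dual R S, α X = 0) → X = 0)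
    (hφ : A.IsCocycle (Module.Dual.eval R S) φ) :
    (A.dualOf φ π).IsCocycle LinearMap.id (-π.sharp φ) := by
  intro α β
  have h1 := hφ (π.sharp α) (π.sharp β)
  rw [← h.sharp_coBracket hloc hsep] at h1
  simp only [Module.Dual.eval_apply] at h1
  change A.anchor (π.sharp α) (β (-π.sharp φ)) - A.anchor (π.sharp β) (α (-π.sharp φ)) -
    A.coBracket φ π.sharp α β (-π.sharp φ) = 0
  simp only [map_neg, π.swap _ φ, neg_neg]
  exact h1

end Morphism

section TwistedLie

variable (A : SkewAlgebroid R S) (φ : Module.Dual R S)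

/-- The twisted Lie derivative `L^φ_X = L_X + φ(X)` of forms. -/
def twLie (X : S) (P : Multi R S) : Multi R S := A.lie X P + φ X • P

theorem twLie_eq (X : S) (P : Multi R S) :
    A.twLie φ X P = contract X (A.twDiff φ P) + A.twDiff φ (contract X P) := by
  simp only [twLie, lie_apply, twDiff_apply, map_add, contract_wedge, contract_one, fn_wedge,
    invol_one, map_neg, LinearMap.neg_apply]
  abel

theorem contract_twLie (X Y : S) (P : Multi R S) :
    contract Y (A.twLie φ X P) = A.twLie φ X (contract Y P) - contract (A.bracket X Y) P := by
  simp only [twLie, map_add, contract_lie, map_smul]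
  abel

theorem lie_smul (X : S) (f : R) (P : Multi R S) :
    A.lie X (f • P) = f • A.lie X P + A.anchor X f • P := by
  rw [← fn_wedge, lie_wedge, lie_fn, fn_wedge, fn_wedge, add_comm]

variable {A φ}

theorem twLie_bracket (hA : A.IsLie) (hφ : A.IsCocycle (Module.Dual.eval R S) φ) (X Y : S)
    (P : Multi R S) :
    A.twLie φ (A.bracket X Y) P =
      A.twLie φ X (A.twLie φ Y P) - A.twLie φ Y (A.twLie φ X P) := by
  have h : φ (A.bracket X Y) = A.anchor X (φ Y) - A.anchor Y (φ X) := by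
    have := hφ X Y
    simp only [Module.Dual.eval_apply] at this
    linear_combination -this
  simp only [twLie, map_add, lie_smul, lie_bracket hA, h]
  module

theorem twDiff_twLie (hA : A.IsLie) (hφ : A.IsCocycle (Module.Dual.eval R S) φ) (X : S)
    (P : Multi R S) : A.twDiff φ (A.twLie φ X P) = A.twLie φ X (A.twDiff φ P) := by
  simp only [twLie_eq, map_add, twDiff_twDiff hA hφ, map_zero, add_zero, zero_add]

theorem twDiff_contract_twDiff (hA : A.IsLie) (hφ : A.IsCocycle (Module.Dual.eval R S) φ) (X : S)
    (P : Multi R S) :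
    A.twDiff φ (contract X (A.twDiff φ P)) = A.twLie φ X (A.twDiff φ P) := by
  rw [twLie_eq, twDiff_twDiff hA hφ, map_zero, zero_add]

theorem twLie_sub (X : S) (P Q : Multi R S) :
    A.twLie φ X (P - Q) = A.twLie φ X P - A.twLie φ X Q := by
  simp only [twLie, map_sub, smul_sub]
  abel

theorem one_coBracket (A : SkewAlgebroid R S) (φ : Module.Dual R S) (π : Bivector R S)
    (α β : Module.Dual R S) :
    one (A.coBracket φ π.sharp α β) = A.twLie φ (π.sharp α) (one β) -
      contract (π.sharp β) (A.twDiff φ (one α)) := by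
  rw [← A.kos_one_one φ π.skew, kos_apply, brace_one_left, invol_one, map_neg,
    LinearMap.neg_apply, brace_one_left, brace_one_right π.skew β (A.hasDeg_twDiff φ (hasDeg_one α)),
    twLie_eq]
  abel

theorem IsJacobiBivector.isLie {π : Bivector R S} (h : A.IsJacobiBivector φ π)
    (hloc : IsLocallyDualizable (Module.Dual.eval R S))
    (hsep : ∀ X : S, (∀ α : Module.Dual R S, α X = 0) → X = 0)
    (hA : A.IsLie) (hφ : A.IsCocycle (Module.Dual.eval R S) φ) : (A.dualOf φ π).IsLie where
  jacobi α β γ := by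
    change A.coBracket φ π.sharp α (A.coBracket φ π.sharp β γ) =
      A.coBracket φ π.sharp (A.coBracket φ π.sharp α β) γ +
        A.coBracket φ π.sharp β (A.coBracket φ π.sharp α γ)
    have key : one (A.coBracket φ π.sharp α (A.coBracket φ π.sharp β γ)) =
        one (A.coBracket φ π.sharp (A.coBracket φ π.sharp α β) γ +
          A.coBracket φ π.sharp β (A.coBracket φ π.sharp α γ)) := by
      rw [one_add]
      simp only [one_coBracket, h.sharp_coBracket hloc hsep, map_sub, twLie_sub,
        twDiff_twLie hA hφ, twDiff_contract_twDiff hA hφ, twLie_bracket hA hφ, contract_twLie]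
      abel
    rw [← linearPart_one (A.coBracket φ π.sharp α _), key, linearPart_one]
  anchor_bracket α β := by
    change A.anchor (π.sharp (A.coBracket φ π.sharp α β)) = _
    rw [h.sharp_coBracket hloc hsep, hA.anchor_bracket]
    rfl

end TwistedLie

theorem IsJacobiQuasiNijenhuis.isQuasiJacobiBialgebroid {A : SkewAlgebroid R S}
    {φ : Module.Dual R S} {π : Bivector R S} {N : S →ₗ[R] S} {η : Alt R S 3}
    (h : A.IsJacobiQuasiNijenhuis φ π N η)
    (hloc : IsLocallyDualizable (LinearMap.id : Module.Dual R S →ₗ[R] Module.Dual R S))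
    (hloc' : IsLocallyDualizable (Module.Dual.eval R S))
    (hsep : ∀ X : S, (∀ α : Module.Dual R S, α X = 0) → X = 0) :
    (A.dualOf φ π).IsQuasiJacobiBialgebroid LinearMap.id (-π.sharp φ) (N.dualMap φ)
      ((A.deform N).twDiff (N.dualMap φ)) η := by
  have hA := h.jacobiAlgebroid.isLie
  have hφ := h.jacobiAlgebroid.cocycle
  refine ⟨⟨h.jacobiBivector.isLie hloc' hsep hA hφ, h.jacobiBivector.isCocycle hloc' hsep hφ⟩,
    A.dualSchouten φ π, A.isSchoutenBracket_dualSchouten φ π, ⟨?_, ?_, ?_⟩, ?_, ?_⟩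
  · intro p P n hn
    obtain ⟨Q, hQ⟩ := (A.deform N).hasDeg_twDiff (N.dualMap φ) (hasDeg_hom P)
    rw [hQ]
    exact DirectSum.of_eq_of_ne _ _ _ hn
  · intro p q P Q
    rw [twDiff_wedge, invol_hom, wedge_real_smul_left]
    rfl
  · intro p q P Q
    have hP := hasDeg_hom P
    have hQ := hasDeg_hom Q
    rw [A.jacobiBracket_dualSchouten φ π hP hQ,
      A.jacobiBracket_dualSchouten φ π (hasDeg_twDiff _ _ hP) hQ,
      A.jacobiBracket_dualSchouten φ π hP (hasDeg_twDiff _ _ hQ),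
      h.compatible.twDiff_deform_kos hloc hA hφ, invol_hom, map_smul, LinearMap.smul_apply,
      pow_succ]
    module
  · rw [twDiff_deform, h.closed, ins_hom, h.closed_insert, map_zero, sub_zero]
  · intro q Q
    rw [A.jacobiBracket_dualSchouten φ π (hasDeg_hom η) (hasDeg_hom Q)]
    exact twDiff_deform_twDiff_deform hloc hA hφ h.torsion_eq h.closed _

end SkewAlgebroid

end Algebroid

namespace Algebroid

section Dualizable

variable {R S : Type*} [CommRing R] [Algebra ℝ R] [AddCommGroup S] [Module R S]

theorem IsDualizable.eval {f : R}
    (hf : IsDualizable (LinearMap.id : Module.Dual R S →ₗ[R] Module.Dual R S) f) :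
    IsDualizable (Module.Dual.eval R S) f := by
  obtain ⟨n, ε, e, h⟩ := hf
  refine ⟨n, e, ε, fun α => ?_⟩
  ext X
  have h1 := congrArg α (h X)
  simp only [map_smul, map_sum, smul_eq_mul, LinearMap.id_apply] at h1
  simp only [LinearMap.smul_apply, smul_eq_mul, LinearMap.sum_apply, Module.Dual.eval_apply, h1]
  exact Finset.sum_congr rfl fun i _ => mul_comm _ _

end Dualizable

end Algebroid

section Frames

variable {E : Type*} [NormedAddCommGroup E] [NormedSpace ℝ E] [FiniteDimensional ℝ E]
  {H : Type*} [TopologicalSpace H] {I : ModelWithCorners ℝ E H}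
  {M : Type*} [TopologicalSpace M] [ChartedSpace H M] [IsManifold I ∞ M] [T2Space M]
  {F : Type*} [NormedAddCommGroup F] [NormedSpace ℝ F] [FiniteDimensional ℝ F]
  {V : M → Type*} [TopologicalSpace (Bundle.TotalSpace F V)]
  [∀ x, TopologicalSpace (V x)] [∀ x, AddCommGroup (V x)] [∀ x, Module ℝ (V x)]
  [FiberBundle F V] [VectorBundle ℝ F V] [ContMDiffVectorBundle ∞ F V I]

/-- Cutting off a local frame and its dual frame near `x`. -/
theorem exists_isDualizable_eq_one (x : M) : ∃ f : C^∞⟮I, M; ℝ⟯, f x = 1 ∧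
    Algebroid.IsDualizable (LinearMap.id : Module.Dual C^∞⟮I, M; ℝ⟯ Cₛ^∞⟮I; F, V⟯ →ₗ[_] _) f := by
  have : ContMDiffVectorBundle 1 F V I := ContMDiffVectorBundle.of_le (n := ∞) (by simp)
  let e := trivializationAt F V x
  let b := Module.finBasis ℝ F
  have hx : e.baseSet ∈ nhds x :=
    e.open_baseSet.mem_nhds (FiberBundle.mem_baseSet_trivializationAt' x)
  obtain ⟨χ, -, hχ⟩ := (SmoothBumpFunction.nhds_basis_tsupport (I := I) x).mem_iff.mp hx
  let c : C^∞⟮I, M; ℝ⟯ := ⟨χ, χ.contMDiff⟩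
  let s : Fin (Module.finrank ℝ F) → Cₛ^∞⟮I; F, V⟯ := fun i =>
    ⟨fun y => χ y • e.localFrame b i y,
      ContMDiffOn.smul_section_of_tsupport χ.contMDiff.contMDiffOn e.open_baseSet hχ
        (e.contMDiffOn_localFrame_baseSet ∞ b i)⟩
  have hε : ∀ i (t : Cₛ^∞⟮I; F, V⟯), ContMDiff I 𝓘(ℝ, ℝ) ∞
      (fun y => χ y * e.localFrameCoeff I b i y (t y)) := by
    intro i t
    refine contMDiff_of_tsupport fun y hy => ?_
    have hy' : y ∈ e.baseSet := hχ (tsupport_mul_subset_left hy)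
    exact χ.contMDiff.contMDiffAt.mul
      (contMDiffAt_localFrameCoeff b hy' t.contMDiff.contMDiffAt i)
  let ε : Fin (Module.finrank ℝ F) → Module.Dual C^∞⟮I, M; ℝ⟯ Cₛ^∞⟮I; F, V⟯ := fun i =>
    { toFun := fun t => ⟨fun y => χ y * e.localFrameCoeff I b i y (t y), hε i t⟩
      map_add' := fun t t' => by
        ext y
        change χ y * e.localFrameCoeff I b i y (t y + t' y) =
          χ y * e.localFrameCoeff I b i y (t y) + χ y * e.localFrameCoeff I b i y (t' y)
        rw [map_add, mul_add]
      map_smul' := fun g t => by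
        ext y
        change χ y * e.localFrameCoeff I b i y (g y • t y) =
          g y * (χ y * e.localFrameCoeff I b i y (t y))
        rw [map_smul, smul_eq_mul, mul_left_comm] }
  refine ⟨c * c, ?_, Module.finrank ℝ F, ε, s, fun t => ?_⟩
  · change χ x * χ x = 1
    rw [χ.eq_one, one_mul]
  · ext y
    have h1 : (∑ i, ε i t • s i) y = ∑ i, (χ y * e.localFrameCoeff I b i y (t y)) • (χ y • e.localFrame b i y) := by
      rw [← ContMDiffSection.coeAddHom_apply, map_sum, Finset.sum_apply]
      rfl
    refine Eq.trans ?_ h1.symm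
    change (χ y * χ y) • t y = _
    by_cases hy : y ∈ e.baseSet
    · conv_lhs => rw [e.eq_sum_localFrameCoeff_smul (I := I) (b := b) (s := t) hy]
      rw [Finset.smul_sum]
      refine Finset.sum_congr rfl fun i _ => ?_
      rw [smul_smul, smul_smul]
      congr 1
      ring
    · have h0 : χ y = 0 := image_eq_zero_of_notMem_tsupport fun h => hy (hχ h)
      simp [h0]

theorem isLocallyDualizable_id : Algebroid.IsLocallyDualizable
    (LinearMap.id : Module.Dual C^∞⟮I, M; ℝ⟯ Cₛ^∞⟮I; F, V⟯ →ₗ[_] _) := by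
  intro r hr
  ext x
  obtain ⟨f, hf, hd⟩ := exists_isDualizable_eq_one (I := I) (F := F) (V := V) x
  obtain ⟨k, hk⟩ := hr f hd
  have h : f x ^ k * r x = 0 := by
    have := congrArg (fun g : C^∞⟮I, M; ℝ⟯ => g x) hk
    simpa using this
  simpa [hf] using h

theorem isLocallyDualizable_eval : Algebroid.IsLocallyDualizable
    (Module.Dual.eval C^∞⟮I, M; ℝ⟯ Cₛ^∞⟮I; F, V⟯) :=
  fun r hr => isLocallyDualizable_id (F := F) (V := V) r fun f hf => hr f hf.eval

theorem section_eq_zero_of_dual (X : Cₛ^∞⟮I; F, V⟯)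
    (h : ∀ α : Module.Dual C^∞⟮I, M; ℝ⟯ Cₛ^∞⟮I; F, V⟯, α X = 0) : X = 0 := by
  ext x
  obtain ⟨f, hf, n, ε, s, hd⟩ := exists_isDualizable_eq_one (I := I) (F := F) (V := V) x
  have h1 : f • X = 0 := by
    rw [hd X]
    exact Finset.sum_eq_zero fun i _ => by rw [LinearMap.id_apply, h, zero_smul]
  have h2 : f x • X x = 0 := congrArg (fun t : Cₛ^∞⟮I; F, V⟯ => t x) h1
  rwa [hf, one_smul] at h2

end Frames

end

/-- Let `(A, φ, π, N, η)` be a Jacobi quasi-Nijenhuis algebroid over the manifold `M`, where the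
vector bundle `A` is `V`.  Then `A*_π` with the `1`-cocycle `-π^♯ φ`, the operator `d_N^{N* φ}`,
which is an `N* φ`-quasi differential, and the `3`-form `η` is a quasi-Jacobi bialgebroid. -/
theorem mainTheorem1
    {E : Type*} [NormedAddCommGroup E] [NormedSpace ℝ E] [FiniteDimensional ℝ E]
    {H : Type*} [TopologicalSpace H] (I : ModelWithCorners ℝ E H)
    {M : Type*} [TopologicalSpace M] [ChartedSpace H M] [IsManifold I ∞ M]
    [BoundarylessManifold I M] [T2Space M] [SigmaCompactSpace M]
    (F : Type*) [NormedAddCommGroup F] [NormedSpace ℝ F] [FiniteDimensional ℝ F]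
    (V : M → Type*) [TopologicalSpace (Bundle.TotalSpace F V)]
    [∀ x, TopologicalSpace (V x)] [∀ x, AddCommGroup (V x)] [∀ x, Module ℝ (V x)]
    [FiberBundle F V] [VectorBundle ℝ F V] [ContMDiffVectorBundle ∞ F V I]
    (A : Algebroid.SkewAlgebroid C^∞⟮I, M; ℝ⟯ Cₛ^∞⟮I; F, V⟯)
    (φ : Module.Dual C^∞⟮I, M; ℝ⟯ Cₛ^∞⟮I; F, V⟯)
    (π : Algebroid.Bivector C^∞⟮I, M; ℝ⟯ Cₛ^∞⟮I; F, V⟯)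
    (N : Cₛ^∞⟮I; F, V⟯ →ₗ[C^∞⟮I, M; ℝ⟯] Cₛ^∞⟮I; F, V⟯)
    (η : Algebroid.Alt C^∞⟮I, M; ℝ⟯ Cₛ^∞⟮I; F, V⟯ 3)
    (h : A.IsJacobiQuasiNijenhuis φ π N η) :
    (A.dualOf φ π).IsQuasiJacobiBialgebroid LinearMap.id (-π.sharp φ) (N.dualMap φ)
      ((A.deform N).twDiff (N.dualMap φ)) η := by
  exact h.isQuasiJacobiBialgebroid isLocallyDualizable_id isLocallyDualizable_eval
    section_eq_zero_of_dual
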